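/- Let $\omega\in\mathbb R$ be an exponent achieved by some matrix multiplication method: there is a program multiplying any two $d\times d$ complex matrices in $O(d^{\omega})$ operations, using memory of size $O(d^3)$. Here a program is a fixed finite text for a random-access machine whose control flow is governed by natural numbers (unit-cost addition, truncated subtraction, comparison, memory access) and whose data are exact complex numbers (unit-cost field operations, conjugation, square roots of nonnegative reals, exponential); memory size is the number of cells per memory bank, and a program names finitely many banks. For $n\ge 2$ qubits consider the generators $$\mathcal G_{S_n}=\Big\{\tfrac1n\sum_{j=1}^nP_j,\ \tfrac{2}{n(n-1)}\sum_{1\le k<j\le n}P_jP_k \ :\ P\in\{X,Y,Z\}\Big\},$$ the observables $\chi=\mathcal G_{S_n}\cup\{P^{\otimes n}: P\in\{X,Y,Z\}\}$, and circuits $U=\prod_{\ell=1}^{L}e^{-i\theta_\ell G_\ell}$ with $L\ge 0$, $G_\ell\in\mathcal G_{S_n}$ and $\theta_\ell\in\mathbb R$. For $0\le m\le n/2$ and $0\le q\le n-2m$ let $$|m,q\rangle=\Big(\tfrac{|01\rangle-|10\rangle}{\sqrt2}\Big)^{\otimes m}\otimes\binom{n-2m}{q}^{-1/2}\sum_{x\in\{0,1\}^{n-2m},\,|x|=q}|x\rangle$$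 be the canonical Schur basis vectors of the irrep $\lambda=(n-m,m)$, and let $(A_\lambda)_{q,q'}=\langle m,q|A|m,q'\rangle$ be the block of an operator $A$. Then there are a single program and a constant $C$ (depending only on $\omega$ and the multiplication method) such that, for all $n\ge2$, all $L$, all such circuits $U$ and all $O\in\chi$, given $n$, $L$, the labels of $O$ and of $G_1,\dots,G_L$, and the angles $\theta_1,\dots,\theta_L$ as read-only input, the program computes all the blocks $(U^\dagger OU)_\lambda$, $\lambda=(n-m,m)$, $0\le m\le n/2$, in time at most $C\,(n^3+L\,n^{\omega+1})$ and with memory of size at most $C\,n^3$. Moreover these blocks describe the action of $U^\dagger OU$ on all permuted copies of the canonical irrep spaces: writing $R(\sigma)$ for the permutation of the tensor factors by $\sigma\in S_n$, $$U^\dagger OU\,R(\sigma)|m,q'\rangle=\sum_{q=0}^{n-2m}\big((U^\dagger OU)_\lambda\big)_{q,q'}\,R(\sigma)|m,q\rangle .$$ -/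

import Mathlib

open scoped Matrix

noncomputable section

/-! ## A random-access machine with exact complex arithmetic

Control flow is governed by natural numbers, on which the machine can add, subtract and compare.
Data are exact complex numbers; complex values never influence the control flow. Every elementary
operation costs one unit of time. Programs are single finite texts, used for all input sizes. -/

namespace CRAM

/-- Read-only input of a program. -/
structure Input where
  nat : ℕ → ℕ
  cpx : ℕ → ℂ

/-- Writable memory: integer variables, banks of integers, and banks of complex numbers. In
`nat b a` and `cpx b a`, `b` is the bank and `a` the address inside it. A program names only
finitely many variables and banks, and cannot compute the name of a bank. -/
structure State where
  var : ℕ → ℕ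
  nat : ℕ → ℕ → ℕ
  cpx : ℕ → ℕ → ℂ

def State.setVar (s : State) (x v : ℕ) : State :=
  { s with var := Function.update s.var x v }

def State.setNat (s : State) (b a v : ℕ) : State :=
  { s with nat := Function.update s.nat b (Function.update (s.nat b) a v) }

def State.setCpx (s : State) (b a : ℕ) (z : ℂ) : State :=
  { s with cpx := Function.update s.cpx b (Function.update (s.cpx b) a z) }

/-- Integer expressions: constants, variables, memory and input reads, sum, truncated difference. -/
inductive NExp where
  | lit (c : ℕ)
  | var (x : ℕ)
  | mem (b : ℕ) (a : NExp)
  | inp (a : NExp)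
  | add (e f : NExp)
  | sub (e f : NExp)

namespace NExp

def eval (i : Input) (s : State) : NExp → ℕ
  | lit c => c
  | var x => s.var x
  | mem b a => s.nat b (a.eval i s)
  | inp a => i.nat (a.eval i s)
  | add e f => e.eval i s + f.eval i s
  | sub e f => e.eval i s - f.eval i s

/-- Number of elementary operations in an expression. -/
def cost : NExp → ℕ
  | lit _ => 1
  | var _ => 1
  | mem _ a => a.cost + 1
  | inp a => a.cost + 1
  | add e f => e.cost + f.cost + 1
  | sub e f => e.cost + f.cost + 1

/-- All memory accesses stay below address `S`. -/
def Safe (i : Input) (S : ℕ) (s : State) : NExp → Prop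
  | lit _ => True
  | var _ => True
  | mem _ a => a.Safe i S s ∧ a.eval i s < S
  | inp a => a.Safe i S s
  | add e f => e.Safe i S s ∧ f.Safe i S s
  | sub e f => e.Safe i S s ∧ f.Safe i S s

end NExp

/-- Complex expressions: integers, the imaginary unit, memory and input reads, field operations,
conjugation, square roots of nonnegative reals, and the exponential function. -/
inductive CExp where
  | ofNat (e : NExp)
  | imag
  | mem (b : ℕ) (a : NExp)
  | inp (a : NExp)
  | add (e f : CExp)
  | sub (e f : CExp)
  | mul (e f : CExp)
  | div (e f : CExp)
  | conj (e : CExp)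
  | sqrt (e : CExp)
  | exp (e : CExp)

namespace CExp

def eval (i : Input) (s : State) : CExp → ℂ
  | ofNat e => (e.eval i s : ℂ)
  | imag => Complex.I
  | mem b a => s.cpx b (a.eval i s)
  | inp a => i.cpx (a.eval i s)
  | add e f => e.eval i s + f.eval i s
  | sub e f => e.eval i s - f.eval i s
  | mul e f => e.eval i s * f.eval i s
  | div e f => e.eval i s / f.eval i s
  | conj e => star (e.eval i s)
  | sqrt e => (Real.sqrt (e.eval i s).re : ℂ)
  | exp e => Complex.exp (e.eval i s)

/-- Number of elementary operations in an expression. -/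
def cost : CExp → ℕ
  | ofNat e => e.cost + 1
  | imag => 1
  | mem _ a => a.cost + 1
  | inp a => a.cost + 1
  | add e f => e.cost + f.cost + 1
  | sub e f => e.cost + f.cost + 1
  | mul e f => e.cost + f.cost + 1
  | div e f => e.cost + f.cost + 1
  | conj e => e.cost + 1
  | sqrt e => e.cost + 1
  | exp e => e.cost + 1

/-- All memory accesses stay below address `S`, no division by zero occurs, and square roots are
taken of nonnegative reals only. -/
def Safe (i : Input) (S : ℕ) (s : State) : CExp → Prop
  | ofNat e => e.Safe i S s
  | imag => True
  | mem _ a => a.Safe i S s ∧ a.eval i s < S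
  | inp a => a.Safe i S s
  | add e f => e.Safe i S s ∧ f.Safe i S s
  | sub e f => e.Safe i S s ∧ f.Safe i S s
  | mul e f => e.Safe i S s ∧ f.Safe i S s
  | div e f => e.Safe i S s ∧ f.Safe i S s ∧ f.eval i s ≠ 0
  | conj e => e.Safe i S s
  | sqrt e => e.Safe i S s ∧ ∃ r : ℝ, 0 ≤ r ∧ e.eval i s = (r : ℂ)
  | exp e => e.Safe i S s

end CExp

/-- Programs. -/
inductive Prog where
  /-- do nothing -/
  | skip
  /-- assign to an integer variable -/
  | setVar (x : ℕ) (e : NExp)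
  /-- store an integer in bank `b` at address `a` -/
  | setNat (b : ℕ) (a e : NExp)
  /-- store a complex number in bank `b` at address `a` -/
  | setCpx (b : ℕ) (a : NExp) (e : CExp)
  /-- first `P`, then `Q` -/
  | seq (P Q : Prog)
  /-- if `e < f` then `P` else `Q` -/
  | cond (e f : NExp) (P Q : Prog)
  /-- while `e < f` do `P` -/
  | loop (e f : NExp) (P : Prog)

/-- `Exec i S P s s' t`: on a machine whose memory banks have `S` cells each, with read-only input
`i` and initial memory `s`, the program `P` halts after `t` elementary operations with memory `s'`,
without illegal accesses on the way. -/
inductive Exec (i : Input) (S : ℕ) : Prog → State → State → ℕ → Prop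
  | skip (s : State) : Exec i S Prog.skip s s 1
  | setVar (x : ℕ) (e : NExp) (s : State) (he : e.Safe i S s) :
      Exec i S (Prog.setVar x e) s (s.setVar x (e.eval i s)) (e.cost + 1)
  | setNat (b : ℕ) (a e : NExp) (s : State) (ha : a.Safe i S s) (he : e.Safe i S s)
      (hS : a.eval i s < S) :
      Exec i S (Prog.setNat b a e) s (s.setNat b (a.eval i s) (e.eval i s)) (a.cost + e.cost + 1)
  | setCpx (b : ℕ) (a : NExp) (e : CExp) (s : State) (ha : a.Safe i S s) (he : e.Safe i S s)
      (hS : a.eval i s < S) :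
      Exec i S (Prog.setCpx b a e) s (s.setCpx b (a.eval i s) (e.eval i s)) (a.cost + e.cost + 1)
  | seq {P Q : Prog} {s s₁ s₂ : State} {t₁ t₂ : ℕ}
      (h₁ : Exec i S P s s₁ t₁) (h₂ : Exec i S Q s₁ s₂ t₂) :
      Exec i S (Prog.seq P Q) s s₂ (t₁ + t₂)
  | cond_true {e f : NExp} {P Q : Prog} {s s' : State} {t : ℕ}
      (he : e.Safe i S s) (hf : f.Safe i S s) (hlt : e.eval i s < f.eval i s)
      (h : Exec i S P s s' t) :
      Exec i S (Prog.cond e f P Q) s s' (e.cost + f.cost + 1 + t)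
  | cond_false {e f : NExp} {P Q : Prog} {s s' : State} {t : ℕ}
      (he : e.Safe i S s) (hf : f.Safe i S s) (hge : ¬ e.eval i s < f.eval i s)
      (h : Exec i S Q s s' t) :
      Exec i S (Prog.cond e f P Q) s s' (e.cost + f.cost + 1 + t)
  | loop_done {e f : NExp} {P : Prog} {s : State}
      (he : e.Safe i S s) (hf : f.Safe i S s) (hge : ¬ e.eval i s < f.eval i s) :
      Exec i S (Prog.loop e f P) s s (e.cost + f.cost + 1)
  | loop_step {e f : NExp} {P : Prog} {s s₁ s₂ : State} {t₁ t₂ : ℕ}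
      (he : e.Safe i S s) (hf : f.Safe i S s) (hlt : e.eval i s < f.eval i s)
      (h₁ : Exec i S P s s₁ t₁) (h₂ : Exec i S (Prog.loop e f P) s₁ s₂ t₂) :
      Exec i S (Prog.loop e f P) s s₂ (e.cost + f.cost + 1 + t₁ + t₂)

/-- `ω` is an exponent achieved by a matrix multiplication method: some program multiplies any two
`d × d` complex matrices in `O(d ^ ω)` operations (and `O(d ^ 3)` memory). The size is given in
variable `0`, the factors row by row in complex banks `0` and `1`, the product is returned row by
row in complex bank `2`; the rest of the memory (and the read-only input) is arbitrary. -/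
def IsMatMulExponent (ω : ℝ) : Prop :=
  ∃ (P : Prog) (C : ℕ), ∀ (d : ℕ), 1 ≤ d → ∀ (A B : Matrix (Fin d) (Fin d) ℂ) (i : Input)
    (s : State), s.var 0 = d →
    (∀ j k : Fin d, s.cpx 0 ((j : ℕ) * d + k) = A j k) →
    (∀ j k : Fin d, s.cpx 1 ((j : ℕ) * d + k) = B j k) →
    ∃ (s' : State) (t : ℕ), Exec i (C * d ^ 3) P s s' t ∧
      (t : ℝ) ≤ C * (d : ℝ) ^ ω ∧
      ∀ j k : Fin d, s'.cpx 2 ((j : ℕ) * d + k) = (A * B) j k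

end CRAM

/-! ## Permutation-equivariant circuits on `n` qubits -/

namespace SnCircuit

/-- Operators on `n` qubits, as matrices in the computational basis of bit strings. -/
abbrev Op (n : ℕ) := Matrix (Fin n → Fin 2) (Fin n → Fin 2) ℂ

inductive Pauli where
  | X
  | Y
  | Z

def Pauli.mat : Pauli → Matrix (Fin 2) (Fin 2) ℂ
  | X => !![0, 1; 1, 0]
  | Y => !![0, -Complex.I; Complex.I, 0]
  | Z => !![1, 0; 0, -1]

/-- The tensor product `A 0 ⊗ ⋯ ⊗ A (n - 1)`. -/
def tensorOp {n : ℕ} (A : Fin n → Matrix (Fin 2) (Fin 2) ℂ) : Op n :=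
  fun x y => ∏ j, A j (x j) (y j)

/-- The Pauli matrix `P` acting on qubit `j`. -/
def Pauli.at (P : Pauli) {n : ℕ} (j : Fin n) : Op n :=
  tensorOp (Function.update (fun _ => 1) j P.mat)

/-- Labels of the generators: a one-body or a two-body symmetrized Pauli operator. -/
inductive Generator where
  | one (P : Pauli)
  | two (P : Pauli)

/-- `(1 / n) ∑ j, P_j` and `(2 / (n (n - 1))) ∑_{k < j} P_j P_k`. -/
def Generator.op (n : ℕ) : Generator → Op n
  | one P => (1 / (n : ℂ)) • ∑ j : Fin n, P.at j
  | two P => (2 / ((n : ℂ) * ((n : ℂ) - 1))) •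
      ∑ j : Fin n, ∑ k ∈ Finset.univ.filter (fun k : Fin n => k < j), P.at j * P.at k

/-- Labels of the observables: the generators and the global operators `P ⊗ ⋯ ⊗ P`. -/
inductive Observable where
  | gen (G : Generator)
  | glob (P : Pauli)

def Observable.op (n : ℕ) : Observable → Op n
  | gen G => G.op n
  | glob P => tensorOp (fun _ => P.mat)

/-- The gate `exp (-i θ G)`, given by a generator `G` and a real parameter `θ`. -/
structure Gate where
  gen : Generator
  angle : ℝ

def Gate.op (n : ℕ) (g : Gate) : Op n :=
  NormedSpace.exp ((-(Complex.I * (g.angle : ℂ))) • g.gen.op n)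

/-- The circuit `U = ∏_{ℓ = 1}^L exp (-i θ_ℓ G_ℓ)`. -/
def circuitOp (n : ℕ) (gates : List Gate) : Op n :=
  (gates.map (Gate.op n)).prod

/-- The Heisenberg-evolved observable `U† O U`. -/
def heisenberg (n : ℕ) (gates : List Gate) (O : Observable) : Op n :=
  (circuitOp n gates)ᴴ * O.op n * circuitOp n gates

/-- Amplitudes of the two-qubit singlet `(|01⟩ - |10⟩) / √2`. -/
def singlet (a b : Fin 2) : ℂ :=
  if a = 0 ∧ b = 1 then 1 / (Real.sqrt 2 : ℂ)
  else if a = 1 ∧ b = 0 then -1 / (Real.sqrt 2 : ℂ)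
  else 0

/-- The `k`-th bit of a bit string (only used for `k < n`). -/
def bit {n : ℕ} (x : Fin n → Fin 2) (k : ℕ) : Fin 2 :=
  if h : k < n then x ⟨k, h⟩ else 0

/-- The canonical Schur basis vector for the irrep `(n - m, m)` with dimension label `q`: singlets
on the `m` pairs of qubits `(0, 1), (2, 3), …, (2m - 2, 2m - 1)`, tensored with the Dicke state of
Hamming weight `q` on the remaining `n - 2m` qubits. Meant for `2 * m ≤ n` and `q ≤ n - 2 * m`. -/
def schurVec (n m q : ℕ) (x : Fin n → Fin 2) : ℂ :=
  (∏ j ∈ Finset.range m, singlet (bit x (2 * j)) (bit x (2 * j + 1))) *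
    (if (Finset.univ.filter (fun k : Fin n => 2 * m ≤ (k : ℕ) ∧ x k = 1)).card = q
      then 1 / (Real.sqrt ((n - 2 * m).choose q : ℝ) : ℂ) else 0)

/-- The action of a permutation on `n`-qubit vectors, permuting the tensor factors. -/
def permVec {n : ℕ} (σ : Equiv.Perm (Fin n)) (v : (Fin n → Fin 2) → ℂ) : (Fin n → Fin 2) → ℂ :=
  fun x => v (fun j => x (σ j))

/-- The block of an operator at the irrep `(n - m, m)`, in the canonical Schur basis. -/
def schurBlock {n : ℕ} (A : Op n) (m : ℕ) :
    Matrix (Fin (n - 2 * m + 1)) (Fin (n - 2 * m + 1)) ℂ :=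
  fun q q' => star (schurVec n m q) ⬝ᵥ (A *ᵥ schurVec n m q')

/-! ### Encoding of the simulation task as machine input -/

def Pauli.code : Pauli → ℕ
  | X => 0
  | Y => 1
  | Z => 2

def Generator.code : Generator → ℕ
  | one P => P.code
  | two P => 3 + P.code

def Observable.code : Observable → ℕ
  | gen G => G.code
  | glob P => 6 + P.code

/-- The integer input is `n`, `L`, the code of the observable, and then the codes of the `L`
generators; the complex input consists of the `L` angles. -/
def taskInput (n : ℕ) (gates : List Gate) (O : Observable) : CRAM.Input where
  nat := fun a => (n :: gates.length :: O.code :: gates.map (fun g => g.gen.code)).getD a 0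
  cpx := fun a => (gates.map (fun g => (g.angle : ℂ))).getD a 0

end SnCircuit

end

/-! The proof has an algebraic half and a machine half.

Algebra. Fix `m`, put `N = n - 2m`, and let `T` be the matrix whose columns are the unnormalized
Schur vectors (`schurMat`), whose entries need no square roots beyond those of the singlets. A
collective operator `∑ j, P_j` annihilates each singlet and acts on the remaining qubits through
Hamming weights, so `(∑ j, P_j) T = T K` with `K` an explicit tridiagonal matrix of size `N + 1`
(`sum_at_mul_schurMat`). The two-body generators are quadratic polynomials in collective operators
(`Generator.op_two`), and `P ⊗ ⋯ ⊗ P` only contributes a sign per singlet (`global_mul_schurMat`).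
Hence every generator and observable satisfies `A T = T B` with explicit `B`. Invariance under
permutations gives the same `B` when the rows of `T` are permuted, which yields the claim about all
permuted copies.

The matrix `K` is diagonalized explicitly: the Kravchuk matrix for `X`, the same matrix with phases
`i ^ k` for `Y`, and the identity for `Z`, always with eigenvalues `N - 2k`
(`collective_mul_eigenMat`, `eigenMat_mul_eigenInvMat`). So a gate acts on blocks by conjugation
with `V D V⁻¹`, where `D` is a diagonal matrix of scalar exponentials
(`Generator.exp_mul_permSchurMat`). Intertwining relations compose, so the gates can be processed
one at a time, starting from the one next to the observable (`heisenberg_mul_permSchurMat`). Since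
`T† T` is a diagonal matrix of binomial coefficients, normalization is an entrywise rescaling at the
end (`schurBlock_apply`).

Machine. Each gate costs four multiplications of size at most `n + 1` per block and `O(n ^ 2)`
further work; there are `n / 2 + 1` blocks. The extra work is absorbed because `2 ≤ ω`: a product
has `d ^ 2` cells and a step writes at most one (`IsMatMulExponent.two_le`). The given
multiplication program may overwrite anything it names, so its variables and banks are renamed to
lie above those that the simulation must preserve (`Exec.shift`). Preparing and writing the blocks
costs `O(n ^ 3)` in total. -/

noncomputable section

/-! ### Relocating an arbitrary program, and the lower bound on the exponent. -/

namespace CRAM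

/-! ### Renaming of variables and banks -/

def NExp.shift (K : ℕ) : NExp → NExp
  | lit c => lit c
  | var x => var (x + K)
  | mem b a => mem (b + K) (a.shift K)
  | inp a => inp (a.shift K)
  | add e f => add (e.shift K) (f.shift K)
  | sub e f => sub (e.shift K) (f.shift K)

def CExp.shift (K : ℕ) : CExp → CExp
  | ofNat e => ofNat (e.shift K)
  | imag => imag
  | mem b a => mem (b + K) (a.shift K)
  | inp a => inp (a.shift K)
  | add e f => add (e.shift K) (f.shift K)
  | sub e f => sub (e.shift K) (f.shift K)
  | mul e f => mul (e.shift K) (f.shift K)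
  | div e f => div (e.shift K) (f.shift K)
  | conj e => conj (e.shift K)
  | sqrt e => sqrt (e.shift K)
  | exp e => exp (e.shift K)

/-- The same program, with all names of variables and banks increased by `K`. -/
def Prog.shift (K : ℕ) : Prog → Prog
  | skip => skip
  | setVar x e => setVar (x + K) (e.shift K)
  | setNat b a e => setNat (b + K) (a.shift K) (e.shift K)
  | setCpx b a e => setCpx (b + K) (a.shift K) (e.shift K)
  | seq P Q => seq (P.shift K) (Q.shift K)
  | cond e f P Q => cond (e.shift K) (f.shift K) (P.shift K) (Q.shift K)
  | loop e f P => loop (e.shift K) (f.shift K) (P.shift K)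

/-- The part of the memory seen by a program whose names are shifted by `K`. -/
def State.view (K : ℕ) (s : State) : State where
  var x := s.var (x + K)
  nat b := s.nat (b + K)
  cpx b := s.cpx (b + K)

section shift

variable (K : ℕ) (i : Input) (S : ℕ) (s : State)

theorem NExp.eval_shift (e : NExp) : (e.shift K).eval i s = e.eval i (s.view K) := by
  induction e <;> simp_all [NExp.shift, NExp.eval, State.view]

theorem NExp.cost_shift (e : NExp) : (e.shift K).cost = e.cost := by
  induction e <;> simp_all [NExp.shift, NExp.cost]

theorem NExp.safe_shift (e : NExp) : (e.shift K).Safe i S s ↔ e.Safe i S (s.view K) := by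
  induction e <;> simp_all [NExp.shift, NExp.Safe, NExp.eval_shift]

theorem CExp.eval_shift (e : CExp) : (e.shift K).eval i s = e.eval i (s.view K) := by
  induction e <;> simp_all [CExp.shift, CExp.eval, NExp.eval_shift]
  simp [State.view]

theorem CExp.cost_shift (e : CExp) : (e.shift K).cost = e.cost := by
  induction e <;> simp_all [CExp.shift, CExp.cost, NExp.cost_shift]

theorem CExp.safe_shift (e : CExp) : (e.shift K).Safe i S s ↔ e.Safe i S (s.view K) := by
  induction e <;>
    simp_all [CExp.shift, CExp.Safe, CExp.eval_shift, NExp.eval_shift, NExp.safe_shift]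

theorem State.view_setVar (x v : ℕ) :
    (s.setVar (x + K) v).view K = (s.view K).setVar x v := by
  simp only [State.view, State.setVar, State.mk.injEq, and_self, and_true]
  funext y
  simp [Function.update_apply]

theorem State.view_setNat (b a v : ℕ) :
    (s.setNat (b + K) a v).view K = (s.view K).setNat b a v := by
  simp only [State.view, State.setNat, State.mk.injEq, true_and, and_true]
  funext y
  simp [Function.update_apply]

theorem State.view_setCpx (b a : ℕ) (z : ℂ) :
    (s.setCpx (b + K) a z).view K = (s.view K).setCpx b a z := by
  simp only [State.view, State.setCpx, State.mk.injEq, true_and]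
  funext y
  simp [Function.update_apply]

end shift

/-- The variables and complex banks with names below `K` agree. -/
def SameBelow (K : ℕ) (s s' : State) : Prop :=
  (∀ x < K, s'.var x = s.var x) ∧ ∀ b < K, s'.cpx b = s.cpx b

theorem SameBelow.trans {K : ℕ} {s s' s'' : State} (h : SameBelow K s s')
    (h' : SameBelow K s' s'') : SameBelow K s s'' :=
  ⟨fun x hx => (h'.1 x hx).trans (h.1 x hx), fun x hx => (h'.2 x hx).trans (h.2 x hx)⟩

/-- A shifted program simulates the original one and leaves the names below `K` untouched. -/
theorem Exec.shift {i : Input} {S : ℕ} {P : Prog} {s s' : State} {t : ℕ} (h : Exec i S P s s' t)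
    (K : ℕ) : ∀ r : State, r.view K = s →
      ∃ r', Exec i S (P.shift K) r r' t ∧ r'.view K = s' ∧ SameBelow K r r' := by
  induction h with
  | skip s => exact fun r hr => ⟨r, .skip r, hr, fun _ _ => rfl, fun _ _ => rfl⟩
  | setVar x e s he =>
    rintro r rfl
    refine ⟨_, ?_, State.view_setVar K r x _, ?_, fun _ _ => rfl⟩
    · have := Exec.setVar (x + K) (e.shift K) r ((NExp.safe_shift K i S r e).2 he)
      rwa [NExp.eval_shift, NExp.cost_shift] at this
    · intro y hy
      simp [State.setVar, Function.update_apply]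
      omega
  | setNat b a e s ha he hS =>
    rintro r rfl
    refine ⟨_, ?_, State.view_setNat K r b _ _, fun _ _ => rfl, fun _ _ => rfl⟩
    have := Exec.setNat (b + K) (a.shift K) (e.shift K) r ((NExp.safe_shift K i S r a).2 ha)
      ((NExp.safe_shift K i S r e).2 he) (by rwa [NExp.eval_shift])
    rwa [NExp.eval_shift, NExp.cost_shift, NExp.eval_shift, NExp.cost_shift] at this
  | setCpx b a e s ha he hS =>
    rintro r rfl
    refine ⟨_, ?_, State.view_setCpx K r b _ _, fun _ _ => rfl, ?_⟩
    · have := Exec.setCpx (b + K) (a.shift K) (e.shift K) r ((NExp.safe_shift K i S r a).2 ha)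
        ((CExp.safe_shift K i S r e).2 he) (by rwa [NExp.eval_shift])
      rwa [NExp.eval_shift, NExp.cost_shift, CExp.eval_shift, CExp.cost_shift] at this
    · intro y hy
      have : y ≠ b + K := by omega
      simp [State.setCpx, this]
  | seq h₁ h₂ ih₁ ih₂ =>
    intro r hr
    obtain ⟨r₁, hx₁, hv₁, hb₁⟩ := ih₁ r hr
    obtain ⟨r₂, hx₂, hv₂, hb₂⟩ := ih₂ r₁ hv₁
    exact ⟨r₂, .seq hx₁ hx₂, hv₂, hb₁.trans hb₂⟩
  | @cond_true e f P Q s s' t he hf hlt h ih =>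
    rintro r rfl
    obtain ⟨r₁, hx₁, hv₁, hb₁⟩ := ih r rfl
    refine ⟨r₁, ?_, hv₁, hb₁⟩
    rw [← NExp.cost_shift K e, ← NExp.cost_shift K f]
    exact .cond_true ((NExp.safe_shift ..).2 he) ((NExp.safe_shift ..).2 hf)
      (by rwa [NExp.eval_shift, NExp.eval_shift]) hx₁
  | @cond_false e f P Q s s' t he hf hlt h ih =>
    rintro r rfl
    obtain ⟨r₁, hx₁, hv₁, hb₁⟩ := ih r rfl
    refine ⟨r₁, ?_, hv₁, hb₁⟩
    rw [← NExp.cost_shift K e, ← NExp.cost_shift K f]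
    exact .cond_false ((NExp.safe_shift ..).2 he) ((NExp.safe_shift ..).2 hf)
      (by rwa [NExp.eval_shift, NExp.eval_shift]) hx₁
  | @loop_done e f P s he hf hge =>
    rintro r rfl
    refine ⟨r, ?_, rfl, fun _ _ => rfl, fun _ _ => rfl⟩
    rw [← NExp.cost_shift K e, ← NExp.cost_shift K f]
    exact .loop_done ((NExp.safe_shift ..).2 he) ((NExp.safe_shift ..).2 hf)
      (by rwa [NExp.eval_shift, NExp.eval_shift])
  | @loop_step e f P s s₁ s₂ t₁ t₂ he hf hlt h₁ h₂ ih₁ ih₂ =>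
    rintro r rfl
    obtain ⟨r₁, hx₁, hv₁, hb₁⟩ := ih₁ r rfl
    obtain ⟨r₂, hx₂, hv₂, hb₂⟩ := ih₂ r₁ hv₁
    refine ⟨r₂, ?_, hv₂, hb₁.trans hb₂⟩
    rw [← NExp.cost_shift K e, ← NExp.cost_shift K f]
    exact .loop_step ((NExp.safe_shift ..).2 he) ((NExp.safe_shift ..).2 hf)
      (by rwa [NExp.eval_shift, NExp.eval_shift]) hx₁ hx₂

/-! ### Monotonicity in the memory bound -/

theorem NExp.Safe.mono {i : Input} {S S' : ℕ} (hSS : S ≤ S') {s : State} {e : NExp}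
    (h : e.Safe i S s) : e.Safe i S' s := by
  induction e <;> simp_all [NExp.Safe]; omega

theorem CExp.Safe.mono {i : Input} {S S' : ℕ} (hSS : S ≤ S') {s : State} {e : CExp}
    (h : e.Safe i S s) : e.Safe i S' s := by
  induction e with
  | ofNat e => exact NExp.Safe.mono hSS h
  | imag => trivial
  | mem b a => exact ⟨NExp.Safe.mono hSS h.1, h.2.trans_le hSS⟩
  | inp a => exact NExp.Safe.mono hSS h
  | _ => simp_all [CExp.Safe]

theorem Exec.mono {i : Input} {S S' : ℕ} (hSS : S ≤ S') {P : Prog} {s s' : State} {t : ℕ}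
    (h : Exec i S P s s' t) : Exec i S' P s s' t := by
  induction h with
  | skip s => exact .skip s
  | setVar x e s he => exact .setVar x e s (he.mono hSS)
  | setNat b a e s ha he hS => exact .setNat b a e s (ha.mono hSS) (he.mono hSS) (by omega)
  | setCpx b a e s ha he hS => exact .setCpx b a e s (ha.mono hSS) (he.mono hSS) (by omega)
  | seq h₁ h₂ ih₁ ih₂ => exact .seq ih₁ ih₂
  | cond_true he hf hlt h ih => exact .cond_true (he.mono hSS) (hf.mono hSS) hlt ih
  | cond_false he hf hlt h ih => exact .cond_false (he.mono hSS) (hf.mono hSS) hlt ih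
  | loop_done he hf hge => exact .loop_done (he.mono hSS) (hf.mono hSS) hge
  | loop_step he hf hlt h₁ h₂ ih₁ ih₂ =>
    exact .loop_step (he.mono hSS) (hf.mono hSS) hlt ih₁ ih₂

/-! ### A matrix multiplication exponent is at least two -/

/-- In `t` steps at most `t` complex cells change. -/
theorem Exec.exists_changed_cells {i : Input} {S : ℕ} {P : Prog} {s s' : State} {t : ℕ}
    (h : Exec i S P s s' t) : ∃ F : Finset (ℕ × ℕ), F.card ≤ t ∧
      ∀ b a, (b, a) ∉ F → s'.cpx b a = s.cpx b a := by
  induction h with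
  | skip s => exact ⟨∅, by simp, fun _ _ _ => rfl⟩
  | setVar x e s he => exact ⟨∅, by simp, fun _ _ _ => rfl⟩
  | setNat b a e s ha he hS => exact ⟨∅, by simp, fun _ _ _ => rfl⟩
  | setCpx b a e s ha he hS =>
    refine ⟨{(b, a.eval i s)}, by simp, fun b' a' h => ?_⟩
    by_cases hb : b' = b
    · subst hb
      have : a' ≠ a.eval i s := fun h' => h (by simp [h'])
      simp [State.setCpx, this]
    · simp [State.setCpx, hb]
  | seq h₁ h₂ ih₁ ih₂ =>
    obtain ⟨F₁, hc₁, hF₁⟩ := ih₁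
    obtain ⟨F₂, hc₂, hF₂⟩ := ih₂
    classical
    refine ⟨F₁ ∪ F₂, (Finset.card_union_le _ _).trans (by omega), fun b a h => ?_⟩
    rw [Finset.mem_union, not_or] at h
    rw [hF₂ b a h.2, hF₁ b a h.1]
  | cond_true he hf hlt h ih =>
    obtain ⟨F, hc, hF⟩ := ih
    exact ⟨F, by omega, hF⟩
  | cond_false he hf hlt h ih =>
    obtain ⟨F, hc, hF⟩ := ih
    exact ⟨F, by omega, hF⟩
  | loop_done he hf hge => exact ⟨∅, by simp, fun _ _ _ => rfl⟩
  | loop_step he hf hlt h₁ h₂ ih₁ ih₂ =>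
    obtain ⟨F₁, hc₁, hF₁⟩ := ih₁
    obtain ⟨F₂, hc₂, hF₂⟩ := ih₂
    classical
    refine ⟨F₁ ∪ F₂, (Finset.card_union_le _ _).trans (by omega), fun b a h => ?_⟩
    rw [Finset.mem_union, not_or] at h
    rw [hF₂ b a h.2, hF₁ b a h.1]

/-- All `d ^ 2` output cells may hold wrong values at the start, so a correct program has to write
each of them. This is what lets quadratic overheads be charged to a multiplication. -/
theorem IsMatMulExponent.two_le {ω : ℝ} (h : IsMatMulExponent ω) : 2 ≤ ω := by
  obtain ⟨P, C, h⟩ := h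
  have key : ∀ d : ℕ, 1 ≤ d → (d : ℝ) ^ 2 ≤ C * (d : ℝ) ^ ω := by
    intro d hd
    -- Both factors vanish while the output bank is filled with ones, so every output cell must
    -- change.
    let s : State := ⟨fun _ => d, fun _ _ => 0, fun b _ => if b = 2 then 1 else 0⟩
    obtain ⟨s', t, hx, ht, hr⟩ := h d hd 0 0 ⟨fun _ => 0, fun _ => 0⟩ s rfl (by simp [s])
      (by simp [s])
    refine le_trans ?_ ht
    obtain ⟨F, hc, hF⟩ := hx.exists_changed_cells
    have hsub : (Finset.range (d * d)).image (fun a => ((2 : ℕ), a)) ⊆ F := by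
      intro x hx
      obtain ⟨a, ha, rfl⟩ := Finset.mem_image.1 hx
      rw [Finset.mem_range] at ha
      by_contra hn
      have h1 := hF 2 a hn
      have h2 := hr ⟨a / d, Nat.div_lt_of_lt_mul ha⟩ ⟨a % d, Nat.mod_lt _ hd⟩
      rw [Nat.div_add_mod'] at h2
      rw [h1] at h2
      simp [s] at h2
    have h3 := Finset.card_le_card hsub
    rw [Finset.card_image_of_injective _ (fun a b hab => by simpa using hab),
      Finset.card_range] at h3
    have : d ^ 2 ≤ t := by nlinarith
    exact_mod_cast this
  by_contra hlt
  push Not at hlt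
  -- If `ω < 2`, then `d ^ (2 - ω)` eventually exceeds the fixed constant `C`.
  have hpos : 0 < 2 - ω := by linarith
  have ht := (tendsto_rpow_atTop hpos).comp tendsto_natCast_atTop_atTop
  obtain ⟨d, hd1, hd2⟩ :=
    ((ht.eventually_gt_atTop (C : ℝ)).and (Filter.eventually_ge_atTop 1)).exists
  have h1 := key d hd2
  have hd0 : (0 : ℝ) < d := by exact_mod_cast hd2
  have h2 : (d : ℝ) ^ (2 - ω) * (d : ℝ) ^ ω = (d : ℝ) ^ 2 := by
    rw [← Real.rpow_add hd0]; simp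
  have h3 : (C : ℝ) * (d : ℝ) ^ ω < (d : ℝ) ^ (2 - ω) * (d : ℝ) ^ ω :=
    mul_lt_mul_of_pos_right hd1 (Real.rpow_pos_of_pos hd0 _)
  linarith

end CRAM

/-! ### A Hoare-style calculus for timed programs, and the array-filling routine. -/

namespace CRAM

/-! ### Total correctness with a time bound -/

/-- Started in `s`, the program `P` halts within time `T` in a state satisfying `Q`. -/
def Runs (i : Input) (S : ℕ) (P : Prog) (s : State) (T : ℕ) (Q : State → Prop) : Prop :=
  ∃ s' t, Exec i S P s s' t ∧ t ≤ T ∧ Q s'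

@[simp] theorem State.var_setVar (s : State) (x v y : ℕ) :
    (s.setVar x v).var y = if y = x then v else s.var y := by
  simp [State.setVar, Function.update_apply]

@[simp] theorem State.cpx_setVar (s : State) (x v : ℕ) : (s.setVar x v).cpx = s.cpx := rfl

@[simp] theorem State.var_setCpx (s : State) (b a : ℕ) (z : ℂ) :
    (s.setCpx b a z).var = s.var := rfl

@[simp] theorem State.cpx_setCpx (s : State) (b a : ℕ) (z : ℂ) (b' a' : ℕ) :
    (s.setCpx b a z).cpx b' a' = if b' = b ∧ a' = a then z else s.cpx b' a' := by
  by_cases h : b' = b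
  · subst h
    simp [State.setCpx, Function.update_apply]
  · simp [State.setCpx, h]

namespace Runs

variable {i : Input} {S : ℕ} {s : State}

theorem weaken {P : Prog} {T T' : ℕ} {Q Q' : State → Prop} (h : Runs i S P s T Q)
    (hT : T ≤ T') (hQ : ∀ s', Q s' → Q' s') : Runs i S P s T' Q' := by
  obtain ⟨s', t, hx, ht, hq⟩ := h
  exact ⟨s', t, hx, ht.trans hT, hQ s' hq⟩

theorem setVar {x : ℕ} {e : NExp} {T : ℕ} {Q : State → Prop} (he : e.Safe i S s)
    (hT : e.cost + 1 ≤ T) (hQ : Q (s.setVar x (e.eval i s))) :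
    Runs i S (.setVar x e) s T Q :=
  ⟨_, _, .setVar x e s he, hT, hQ⟩

theorem setCpx {b : ℕ} {a : NExp} {e : CExp} {T : ℕ} {Q : State → Prop} (ha : a.Safe i S s)
    (he : e.Safe i S s) (hS : a.eval i s < S) (hT : a.cost + e.cost + 1 ≤ T)
    (hQ : Q (s.setCpx b (a.eval i s) (e.eval i s))) :
    Runs i S (.setCpx b a e) s T Q :=
  ⟨_, _, .setCpx b a e s ha he hS, hT, hQ⟩

theorem seq {P P' : Prog} {T₁ T₂ : ℕ} {Q : State → Prop} (R : State → Prop)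
    (h₁ : Runs i S P s T₁ R) (h₂ : ∀ s', R s' → Runs i S P' s' T₂ Q) :
    Runs i S (.seq P P') s (T₁ + T₂) Q := by
  obtain ⟨s₁, t₁, hx₁, ht₁, hr⟩ := h₁
  obtain ⟨s₂, t₂, hx₂, ht₂, hq⟩ := h₂ s₁ hr
  exact ⟨s₂, _, .seq hx₁ hx₂, by omega, hq⟩

/-- A loop whose guard fails exactly after `N` rounds. -/
theorem loop {e f : NExp} {P : Prog} {T N : ℕ} (Inv : ℕ → State → Prop)
    (hguard : ∀ k s, k ≤ N → Inv k s →
      e.Safe i S s ∧ f.Safe i S s ∧ (e.eval i s < f.eval i s ↔ k < N))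
    (hbody : ∀ k s, k < N → Inv k s → Runs i S P s T (Inv (k + 1)))
    (h0 : Inv 0 s) :
    Runs i S (.loop e f P) s (N * (T + (e.cost + f.cost + 1)) + (e.cost + f.cost + 1))
      (Inv N) := by
  have key : ∀ j k s, k + j = N → Inv k s → Runs i S (.loop e f P) s
      (j * (T + (e.cost + f.cost + 1)) + (e.cost + f.cost + 1)) (Inv N) := by
    intro j
    induction j with
    | zero =>
      intro k s hk hI
      obtain ⟨he, hf, hg⟩ := hguard k s (by omega) hI
      have hkN : k = N := by omega
      exact ⟨s, _, .loop_done he hf (by rw [hg]; omega), by omega, hkN ▸ hI⟩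
    | succ j ih =>
      intro k s hk hI
      obtain ⟨he, hf, hg⟩ := hguard k s (by omega) hI
      obtain ⟨s₁, t₁, hx₁, ht₁, hI₁⟩ := hbody k s (by omega) hI
      obtain ⟨s₂, t₂, hx₂, ht₂, hI₂⟩ := ih (k + 1) s₁ (by omega) hI₁
      refine ⟨s₂, _, .loop_step he hf (by rw [hg]; omega) hx₁ hx₂, ?_, hI₂⟩
      rw [Nat.succ_mul]
      omega
  simpa using key N 0 s (by omega) h0

end Runs

/-! ### Frames -/

/-- Only the variables in `V` and the complex banks in `B` may differ. -/
def Frame (V B : Finset ℕ) (s s' : State) : Prop :=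
  (∀ x ∉ V, s'.var x = s.var x) ∧ ∀ b ∉ B, s'.cpx b = s.cpx b

namespace Frame

variable {V B : Finset ℕ} {s s' s'' : State}

theorem refl (s : State) : Frame V B s s := ⟨fun _ _ => rfl, fun _ _ => rfl⟩

theorem trans (h : Frame V B s s') (h' : Frame V B s' s'') : Frame V B s s'' :=
  ⟨fun x hx => (h'.1 x hx).trans (h.1 x hx), fun b hb => (h'.2 b hb).trans (h.2 b hb)⟩

theorem mono (h : Frame V B s s') {V' B' : Finset ℕ} (hV : V ⊆ V') (hB : B ⊆ B') :
    Frame V' B' s s' :=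
  ⟨fun x hx => h.1 x (fun h' => hx (hV h')), fun b hb => h.2 b (fun h' => hb (hB h'))⟩

theorem setVar (h : Frame V B s s') {x : ℕ} (hx : x ∈ V) (v : ℕ) :
    Frame V B s (s'.setVar x v) :=
  ⟨fun y hy => by
    have : y ≠ x := fun h' => hy (h' ▸ hx)
    simp [this, h.1 y hy], h.2⟩

theorem setCpx (h : Frame V B s s') {b : ℕ} (hb : b ∈ B) (a : ℕ) (z : ℂ) :
    Frame V B s (s'.setCpx b a z) :=
  ⟨h.1, fun c hc => by
    have : c ≠ b := fun h' => hc (h' ▸ hb)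
    funext a'
    simp [this, h.2 c hc]⟩

end Frame

/-! ### Filling a square array -/

/-- Writes a `d × d` array (`d` in variable 2) into bank `b`, starting at address `a₀` and skipping
`pad` cells after each row. The entry may refer to the row in variable 10, the column in variable
11, and the position `row * d + column` in variable 13. -/
def Prog.fill (b : ℕ) (a₀ pad : NExp) (e : CExp) : Prog :=
  .seq (.setVar 12 a₀) <| .seq (.setVar 13 (.lit 0)) <| .seq (.setVar 10 (.lit 0)) <|
    .loop (.var 10) (.var 2) <|
      .seq (.setVar 11 (.lit 0)) <|
      .seq (.loop (.var 11) (.var 2) <|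
        .seq (.setCpx b (.var 12) e) <|
        .seq (.setVar 12 (.add (.var 12) (.lit 1))) <|
        .seq (.setVar 13 (.add (.var 13) (.lit 1))) <|
        .setVar 11 (.add (.var 11) (.lit 1))) <|
      .seq (.setVar 12 (.add (.var 12) pad)) <|
      .setVar 10 (.add (.var 10) (.lit 1))

/-- The variables used by `Prog.fill`. -/
abbrev fillVars : Finset ℕ := {10, 11, 12, 13}

/-- The entry expression may rely on the entries already written, which is needed for the recursive
Kravchuk table. The padding and the untouched cells below `A` serve the output bank, where blocks of
different sizes are stored with a common stride. -/
theorem runs_fill {i : Input} {S : ℕ} {s : State} {b : ℕ} {a₀ pad : NExp} {e : CExp}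
    {d A p : ℕ} (F : Matrix (Fin d) (Fin d) ℂ) (hd : s.var 2 = d) (hd1 : 1 ≤ d)
    (ha₀ : a₀.Safe i S s) (hA : a₀.eval i s = A)
    (hpad : ∀ s₁, Frame fillVars {b} s s₁ → pad.Safe i S s₁ ∧ pad.eval i s₁ = p)
    (hS : A + d * (d + p) ≤ S)
    (he : ∀ (k q : Fin d) (s₁ : State), Frame fillVars {b} s s₁ → s₁.var 10 = k →
      s₁.var 11 = q → s₁.var 13 = k * d + q →
      (∀ k' q' : Fin d, k' < k ∨ k' = k ∧ q' < q → s₁.cpx b (A + k' * (d + p) + q') = F k' q') →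
      e.Safe i S s₁ ∧ e.eval i s₁ = F k q) :
    Runs i S (.fill b a₀ pad e) s ((a₀.cost + pad.cost + e.cost + 60) * d ^ 2) fun s' =>
      Frame fillVars {b} s s' ∧ (∀ k q : Fin d, s'.cpx b (A + k * (d + p) + q) = F k q) ∧
        ∀ a < A, s'.cpx b a = s.cpx b a := by
  -- `J` is the invariant within row `k`, `I` the one between rows. The machine cannot multiply
  -- integers, so the addresses in variables 12 and 13 are advanced incrementally.
  let J : ℕ → ℕ → State → Prop := fun k q s₁ =>
    Frame fillVars {b} s s₁ ∧ s₁.var 10 = k ∧ s₁.var 11 = q ∧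
      s₁.var 12 = A + k * (d + p) + q ∧ s₁.var 13 = k * d + q ∧
      (∀ k' q' : Fin d, (k' : ℕ) < k ∨ (k' : ℕ) = k ∧ (q' : ℕ) < q →
        s₁.cpx b (A + k' * (d + p) + q') = F k' q') ∧ ∀ a < A, s₁.cpx b a = s.cpx b a
  let I : ℕ → State → Prop := fun k s₁ =>
    Frame fillVars {b} s s₁ ∧ s₁.var 10 = k ∧
      s₁.var 12 = A + k * (d + p) ∧ s₁.var 13 = k * d ∧
      (∀ k' q' : Fin d, (k' : ℕ) < k →
        s₁.cpx b (A + k' * (d + p) + q') = F k' q') ∧ ∀ a < A, s₁.cpx b a = s.cpx b a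
  have hdV : ∀ s₁, Frame fillVars {b} s s₁ → s₁.var 2 = d := fun s₁ h => by
    rw [h.1 2 (by decide), hd]
  have inner : ∀ k q s₁, k < d → q < d → J k q s₁ → Runs i S
      (.seq (.setCpx b (.var 12) e) <|
        .seq (.setVar 12 (.add (.var 12) (.lit 1))) <|
        .seq (.setVar 13 (.add (.var 13) (.lit 1))) <|
        .setVar 11 (.add (.var 11) (.lit 1))) s₁ (e.cost + 14) (J k (q + 1)) := by
    rintro k q s₁ hk hq ⟨hF, h10, h11, h12, h13, hc, hlow⟩
    obtain ⟨heS, heV⟩ := he ⟨k, hk⟩ ⟨q, hq⟩ s₁ hF h10 h11 h13 (by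
      intro k' q' h
      apply hc
      simpa [Fin.lt_def, Fin.ext_iff] using h)
    have haddr : A + k * (d + p) + q < S := by
      have h1 : (k + 1) * (d + p) ≤ d * (d + p) := Nat.mul_le_mul_right _ hk
      rw [Nat.succ_mul] at h1
      omega
    refine (Runs.seq (T₁ := e.cost + 2) (T₂ := 12)
      (fun s₂ => s₂ = s₁.setCpx b (A + k * (d + p) + q) (F ⟨k, hk⟩ ⟨q, hq⟩)) ?_ ?_)
    · refine Runs.setCpx trivial heS ?_ ?_ ?_
      · simpa [NExp.eval, h12] using haddr
      · simp [NExp.cost]; omega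
      · simp [NExp.eval, h12, heV]
    rintro s₂ rfl
    refine (Runs.seq (T₁ := 4) (T₂ := 8) _ (Runs.setVar ?_ ?_ rfl) ?_)
    · simp [NExp.Safe]
    · simp [NExp.cost]
    rintro s₂ rfl
    refine (Runs.seq (T₁ := 4) (T₂ := 4) _ (Runs.setVar ?_ ?_ rfl) ?_)
    · simp [NExp.Safe]
    · simp [NExp.cost]
    rintro s₂ rfl
    refine Runs.setVar (by simp [NExp.Safe]) (by simp [NExp.cost]) ?_
    refine ⟨?_, ?_, ?_, ?_, ?_, ?_, ?_⟩
    · exact (((hF.setCpx (by simp) _ _).setVar (by decide) _).setVar (by decide) _).setVar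
        (by decide) _
    · simp [h10]
    · simp [NExp.eval, h11]
    · simp [NExp.eval, h12]; omega
    · simp [NExp.eval, h13]; omega
    · intro k' q' h
      simp only [State.cpx_setVar, State.cpx_setCpx, true_and]
      -- An address determines row and column, because the column index is below `d` and the stride
      -- is `d + p`.
      split_ifs with heq
      · have hkk : (k' : ℕ) = k := by
          rcases h with h | h
          · exfalso
            have h1 : ((k' : ℕ) + 1) * (d + p) ≤ k * (d + p) := Nat.mul_le_mul_right _ h
            rw [Nat.succ_mul] at h1
            have := q'.2
            omega
          · exact h.1
        have hqq : (q' : ℕ) = q := by rw [hkk] at heq; omega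
        congr 1 <;> exact Fin.ext (by simp [hkk, hqq])
      · apply hc
        rcases h with h | ⟨h, h'⟩
        · exact Or.inl h
        · refine Or.inr ⟨h, ?_⟩
          rcases Nat.lt_succ_iff_lt_or_eq.1 h' with h'' | h''
          · exact h''
          · rw [h, h''] at heq; exact absurd rfl heq
    · intro a ha
      have : a ≠ A + k * (d + p) + q := by omega
      simp [this, hlow a ha]
  have outer : ∀ k s₁, k < d → I k s₁ → Runs i S
      (.seq (.setVar 11 (.lit 0)) <|
      .seq (.loop (.var 11) (.var 2) <|
        .seq (.setCpx b (.var 12) e) <|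
        .seq (.setVar 12 (.add (.var 12) (.lit 1))) <|
        .seq (.setVar 13 (.add (.var 13) (.lit 1))) <|
        .setVar 11 (.add (.var 11) (.lit 1))) <|
      .seq (.setVar 12 (.add (.var 12) pad)) <|
      .setVar 10 (.add (.var 10) (.lit 1))) s₁
        (2 + ((d * (e.cost + 14 + 3) + 3) + ((pad.cost + 3) + 4))) (I (k + 1)) := by
    rintro k s₁ hk ⟨hF, h10, h12, h13, hc, hlow⟩
    refine Runs.seq (J k 0) ?_ fun s₂ h₂ => Runs.seq (J k d) ?_ fun s₃ h₃ => ?_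
    · refine Runs.setVar trivial (by simp [NExp.cost]) ?_
      refine ⟨hF.setVar (by decide) _, by simp [h10], by simp [NExp.eval], by simp [h12],
        by simp [h13], ?_, hlow⟩
      intro k' q' h
      apply hc
      omega
    · refine Runs.loop (J k) ?_ (fun q s hq hJ => inner k q s hk hq hJ) h₂
      rintro q s hq ⟨hF, h10, h11, -⟩
      simp [NExp.Safe, NExp.eval, h11, hdV s hF]
    · obtain ⟨hF, h10, h11, h12, h13, hc, hlow⟩ := h₃
      obtain ⟨hp, hpe⟩ := hpad s₃ hF
      refine Runs.seq _ (Runs.setVar ?_ ?_ rfl) ?_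
      · simp [NExp.Safe, hp]
      · simp [NExp.cost]; omega
      rintro s₄ rfl
      refine Runs.setVar (by simp [NExp.Safe]) (by simp [NExp.cost]) ?_
      refine ⟨(hF.setVar (by decide) _).setVar (by decide) _, by simp [NExp.eval, h10], ?_, ?_,
        ?_, hlow⟩
      · simp [NExp.eval, h12, hpe]; ring
      · simp [h13]; ring
      · intro k' q' h
        apply hc
        have := q'.2
        omega
  have hmain : Runs i S (.fill b a₀ pad e) s ((a₀.cost + 1) + (2 + (2 +
      (d * ((2 + ((d * (e.cost + 14 + 3) + 3) + ((pad.cost + 3) + 4))) + 3) + 3)))) (I d) := by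
    refine Runs.seq _ (Runs.setVar ha₀ le_rfl rfl) ?_
    rintro s₁ rfl
    refine Runs.seq _ (Runs.setVar (by simp [NExp.Safe]) (by simp [NExp.cost]) rfl) ?_
    rintro s₁ rfl
    refine Runs.seq (I 0) (Runs.setVar (by simp [NExp.Safe]) (by simp [NExp.cost]) ?_) ?_
    · exact ⟨(((Frame.refl s).setVar (by decide) _).setVar (by decide) _).setVar (by decide) _,
        by simp [NExp.eval], by simp [hA], by simp [NExp.eval], by simp, by simp⟩
    · intro s₁ h₁
      refine Runs.loop I ?_ (fun k s hk hI => outer k s hk hI) h₁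
      rintro k s hk ⟨hF, h10, -⟩
      simp [NExp.Safe, NExp.eval, h10, hdV s hF]
  refine hmain.weaken ?_ ?_
  · have h1 : 1 ≤ d ^ 2 := Nat.one_le_pow _ _ hd1
    have h2 : d ≤ d ^ 2 := by nlinarith
    have h3 : d * pad.cost ≤ d ^ 2 * pad.cost := Nat.mul_le_mul_right _ h2
    have h4 : a₀.cost ≤ d ^ 2 * a₀.cost := Nat.le_mul_of_pos_left _ h1
    nlinarith
  · rintro s' ⟨hF, -, -, -, hc, hlow⟩
    exact ⟨hF, fun k q => hc k q k.2, hlow⟩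

end CRAM

/-! ### Explicit diagonalization of the collective spin operators. -/

namespace SnCircuit

open Polynomial

/-! ### Kravchuk matrices -/

/-- The generating polynomial of a row of the Kravchuk matrix. -/
def krawPoly (N k : ℕ) : ℂ[X] := (1 + X) ^ (N - k) * (1 - X) ^ k

/-- Entries of the Kravchuk matrix. -/
def kraw (N k q : ℕ) : ℂ := (krawPoly N k).coeff q

theorem kraw_zero_left (N q : ℕ) : kraw N 0 q = N.choose q := by
  simp [kraw, krawPoly, coeff_one_add_X_pow]

theorem kraw_zero_right (N k : ℕ) : kraw N k 0 = 1 := by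
  simp [kraw, krawPoly, coeff_zero_eq_eval_zero]

theorem kraw_zero_succ (N q : ℕ) :
    kraw N 0 (q + 1) = kraw N 0 q * ((N - q : ℕ) : ℂ) / ((q + 1 : ℕ) : ℂ) := by
  rw [kraw_zero_left, kraw_zero_left, eq_div_iff (by exact_mod_cast Nat.succ_ne_zero q)]
  exact_mod_cast Nat.choose_succ_right_eq N q

/-- Passing to the next row trades a factor `1 + X` for `1 - X`; comparing coefficients gives a
local recursion, so that the whole table costs constant time per entry. -/
theorem kraw_succ_succ {N k : ℕ} (hk : k + 1 ≤ N) (q : ℕ) :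
    kraw N (k + 1) (q + 1) = kraw N k (q + 1) - kraw N k q - kraw N (k + 1) q := by
  have h : krawPoly N (k + 1) * (1 + X) = krawPoly N k * (1 - X) := by
    obtain ⟨a, rfl⟩ := Nat.exists_eq_add_of_le hk
    have h1 : k + 1 + a - (k + 1) = a := by omega
    have h2 : k + 1 + a - k = a + 1 := by omega
    rw [krawPoly, krawPoly, h1, h2]
    ring
  have h' := congrArg (fun p => p.coeff (q + 1)) h
  simp only [mul_add, mul_sub, mul_one, coeff_add, coeff_sub, coeff_mul_X] at h'
  simp only [kraw]
  linear_combination h'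

/-- The eigenvalue equation behind the diagonalization: the generating polynomial `p` of row `k`
turns the left side into `N p - 2 X p'`. At `k = 0` and `k = N` the neighbour outside the range has
coefficient zero. -/
theorem kraw_three_term {N k : ℕ} (hk : k ≤ N) (q : ℕ) :
    (k : ℂ) * kraw N (k - 1) q + ((N : ℂ) - k) * kraw N (k + 1) q =
      ((N : ℂ) - 2 * q) * kraw N k q := by
  obtain ⟨a, rfl⟩ := Nat.exists_eq_add_of_le hk
  have h : (k : ℂ[X]) * krawPoly (k + a) (k - 1) + (a : ℂ[X]) * krawPoly (k + a) (k + 1) =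
      ((k + a : ℕ) : ℂ[X]) * krawPoly (k + a) k - 2 * (X * derivative (krawPoly (k + a) k)) := by
    have h1 : k + a - k = a := by omega
    rw [krawPoly, krawPoly, krawPoly, h1]
    rcases k with _ | k <;> rcases a with _ | a
    · simp
    · simp [derivative_pow]; ring
    · simp [derivative_pow]; ring
    · have h2 : k + 1 + (a + 1) - (k + 1 - 1) = a + 2 := by omega
      have h3 : k + 1 + (a + 1) - (k + 1 + 1) = a := by omega
      rw [h2, h3]
      simp [derivative_pow]
      ring
  -- The Euler operator multiplies the coefficient at `q` by `q`; this produces the eigenvalue `N -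
  -- 2q`.
  have hX : ∀ p : ℂ[X], (X * derivative p).coeff q = q * p.coeff q := by
    intro p
    rcases q with _ | q
    · simp
    · rw [coeff_X_mul, coeff_derivative]; push_cast; ring
  have h' := congrArg (fun p => p.coeff q) h
  rw [← C_ofNat] at h'
  simp only [coeff_add, coeff_sub, coeff_natCast_mul, coeff_C_mul, hX] at h'
  simp only [kraw]
  push_cast at h' ⊢
  linear_combination h'

/-- The homogenized generating function of a row. -/
theorem sum_coeff_homogeneous (a b : ℕ) (s t : ℂ[X]) :
    ∑ r ∈ Finset.range (a + b + 1),
      C (((1 + X) ^ a * (1 - X) ^ b : ℂ[X]).coeff r) * (s ^ (a + b - r) * t ^ r) =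
      (s + t) ^ a * (s - t) ^ b := by
  -- Homogenization is multiplicative; it suffices to adjoin one factor `1 + v X`, used with `v = 1`
  -- and `v = -1`.
  have step : ∀ (p : ℂ[X]) (n : ℕ) (v : ℂ), p.natDegree ≤ n →
      ∑ r ∈ Finset.range (n + 1 + 1), C ((p * (1 + C v * X)).coeff r) * (s ^ (n + 1 - r) * t ^ r) =
      (∑ r ∈ Finset.range (n + 1), C (p.coeff r) * (s ^ (n - r) * t ^ r)) * (s + C v * t) := by
    intro p n v hp
    have h1 : ∀ r, (p * (1 + C v * X)).coeff r = p.coeff r + v * (p * X).coeff r := by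
      intro r
      have : p * (1 + C v * X) = p + C v * (p * X) := by ring
      rw [this, coeff_add, coeff_C_mul]
    simp only [h1, C_add, C_mul, add_mul, Finset.sum_add_distrib]
    rw [mul_add, Finset.sum_range_succ, coeff_eq_zero_of_natDegree_lt (by omega : p.natDegree < n + 1)]
    congr 1
    · simp only [C_0, zero_mul, add_zero]
      rw [Finset.sum_mul]
      refine Finset.sum_congr rfl fun r hr => ?_
      rw [Finset.mem_range] at hr
      rw [show n + 1 - r = (n - r) + 1 by omega]
      ring
    · rw [Finset.sum_range_succ', Finset.sum_mul]
      simp only [coeff_mul_X, mul_coeff_zero, coeff_X_zero, mul_zero, C_0, zero_mul, add_zero]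
      refine Finset.sum_congr rfl fun r hr => ?_
      rw [show n + 1 - (r + 1) = n - r by omega]
      ring
  induction b with
  | zero =>
    induction a with
    | zero => simp
    | succ a ih =>
      have := step ((1 + X) ^ a * (1 - X) ^ 0) (a + 0) 1 (by
        simp only [pow_zero, mul_one, add_zero]
        compute_degree)
      rw [ih] at this
      rw [show a + 1 + 0 = a + 0 + 1 by ring]
      simp only [C_1, one_mul] at this
      rw [show (1 + X : ℂ[X]) ^ (a + 1) * (1 - X) ^ 0 = (1 + X) ^ a * (1 - X) ^ 0 * (1 + X) by ring,
        this]
      ring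
  | succ b ih =>
    have := step ((1 + X) ^ a * (1 - X) ^ b) (a + b) (-1) (by compute_degree)
    rw [ih] at this
    simp only [C_neg, C_1, neg_mul, one_mul, ← sub_eq_add_neg] at this
    rw [show (1 + X : ℂ[X]) ^ a * (1 - X) ^ (b + 1) = (1 + X) ^ a * (1 - X) ^ b * (1 - X) by ring,
      ← add_assoc, this]
    ring

/-- Substituting `s = 1 + X`, `t = 1 - X` in the homogenized generating function gives `s + t = 2`
and `s - t = 2X`, hence `2 ^ N X ^ k`. So the Kravchuk matrix is its own inverse up to `2 ^ N`. -/
theorem sum_kraw_mul_kraw {N k : ℕ} (hk : k ≤ N) (q : ℕ) :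
    ∑ r ∈ Finset.range (N + 1), kraw N k r * kraw N r q = if q = k then 2 ^ N else 0 := by
  have h := sum_coeff_homogeneous (N - k) k (1 + X) (1 - X)
  rw [Nat.sub_add_cancel hk] at h
  have h' := congrArg (fun p => p.coeff q) h
  simp only [finsetSum_coeff, coeff_C_mul] at h'
  refine h'.trans ?_
  rw [show (1 + X + (1 - X) : ℂ[X]) = C 2 by rw [C_ofNat]; ring,
    show (1 + X - (1 - X) : ℂ[X]) = C 2 * X by rw [C_ofNat]; ring, mul_pow, ← mul_assoc, ← pow_add,
    Nat.sub_add_cancel hk, ← C_pow, coeff_C_mul, coeff_X_pow]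
  simp

/-! ### Blocks of the collective Pauli operators -/

/-- Entries of the block of `∑ j, P_j` in the basis of unnormalized Dicke states. -/
def collectiveEntry (P : Pauli) (N k q : ℕ) : ℂ :=
  (if k = q then ((N : ℂ) - k) * P.mat 0 0 + k * P.mat 1 1 else 0) +
    (if q + 1 = k then k * P.mat 1 0 else 0) + (if k + 1 = q then ((N : ℂ) - k) * P.mat 0 1 else 0)

def collective (P : Pauli) (N : ℕ) : Matrix (Fin (N + 1)) (Fin (N + 1)) ℂ :=
  fun k q => collectiveEntry P N k q

/-- Row `k` of the product of a collective Pauli block with another matrix. -/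
theorem sum_collectiveEntry_mul (P : Pauli) {N k : ℕ} (hk : k ≤ N) (f : ℕ → ℂ) :
    ∑ r ∈ Finset.range (N + 1), collectiveEntry P N k r * f r =
      (((N : ℂ) - k) * P.mat 0 0 + k * P.mat 1 1) * f k + k * P.mat 1 0 * f (k - 1) +
        ((N : ℂ) - k) * P.mat 0 1 * f (k + 1) := by
  simp only [collectiveEntry, add_mul, ite_mul, zero_mul, Finset.sum_add_distrib]
  congr 1
  · congr 1
    · rw [Finset.sum_ite_eq, if_pos (by simpa using Nat.lt_succ_of_le hk)]
    · rcases k with _ | k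
      · simp
      · simp only [add_left_inj, Nat.add_sub_cancel]
        rw [Finset.sum_ite_eq', if_pos (by simp; omega)]
  · rw [Finset.sum_ite_eq]
    rcases Nat.lt_or_ge k N with h | h
    · rw [if_pos (by simpa using h)]
    · obtain rfl : k = N := by omega
      simp

theorem sum_fin_collectiveEntry_mul (P : Pauli) {N k : ℕ} (hk : k ≤ N) (f : ℕ → ℂ) :
    ∑ r : Fin (N + 1), collectiveEntry P N k r * f r =
      (((N : ℂ) - k) * P.mat 0 0 + k * P.mat 1 1) * f k + k * P.mat 1 0 * f (k - 1) +
        ((N : ℂ) - k) * P.mat 0 1 * f (k + 1) := by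
  rw [← sum_collectiveEntry_mul P hk f, Finset.sum_range]

/-- Entries of a matrix of eigenvectors of the block of `∑ j, P_j`. -/
def eigenEntry : Pauli → ℕ → ℕ → ℕ → ℂ
  | .X, N, k, q => kraw N k q
  | .Y, N, k, q => Complex.I ^ k * kraw N k q
  | .Z, _, k, q => if k = q then 1 else 0

/-- Entries of the inverse of the matrix of eigenvectors. -/
def eigenInvEntry : Pauli → ℕ → ℕ → ℕ → ℂ
  | .X, N, k, q => kraw N k q / 2 ^ N
  | .Y, N, k, q => kraw N k q * Complex.I ^ (3 * q) / 2 ^ N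
  | .Z, _, k, q => if k = q then 1 else 0

def eigenMat (P : Pauli) (N : ℕ) : Matrix (Fin (N + 1)) (Fin (N + 1)) ℂ :=
  fun k q => eigenEntry P N k q

def eigenInvMat (P : Pauli) (N : ℕ) : Matrix (Fin (N + 1)) (Fin (N + 1)) ℂ :=
  fun k q => eigenInvEntry P N k q

/-- The weights of the spin `N / 2` representation. -/
def weight (N : ℕ) (k : Fin (N + 1)) : ℂ := (N : ℂ) - 2 * (k : ℕ)

/-- For `X` this is the three-term relation. For `Y` the phases `i ^ k` turn the entries `∓i` into
those of `X`, and `Z` is already diagonal. -/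
theorem collective_mul_eigenMat (P : Pauli) (N : ℕ) :
    collective P N * eigenMat P N = eigenMat P N * Matrix.diagonal (weight N) := by
  ext k q
  rw [Matrix.mul_diagonal, Matrix.mul_apply]
  have hk : (k : ℕ) ≤ N := Nat.lt_succ_iff.1 k.2
  have h := sum_fin_collectiveEntry_mul P hk (fun r => eigenEntry P N r q)
  simp only [collective, eigenMat, weight]
  rw [h]
  have h3 := kraw_three_term hk q
  cases P
  · simp [Pauli.mat, eigenEntry]
    linear_combination h3
  · simp only [Pauli.mat, eigenEntry, Matrix.of_apply, Matrix.cons_val', Matrix.cons_val_zero,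
      Matrix.cons_val_one, Matrix.cons_val_fin_one, mul_zero, add_zero, zero_mul, zero_add]
    -- Row zero is separated because the truncated `k - 1` also occurs in an exponent of `i`.
    rcases hk0 : (k : ℕ) with _ | j
    · rw [hk0] at h3
      simp at h3 ⊢
      linear_combination h3 - (N : ℂ) * kraw N 1 q * Complex.I_sq
    · rw [hk0] at h3
      simp only [Nat.add_sub_cancel] at h3 ⊢
      rw [pow_succ, pow_succ]
      linear_combination Complex.I ^ j * Complex.I * h3
        - Complex.I ^ j * Complex.I * ((N : ℂ) - ((j + 1 : ℕ) : ℂ)) * kraw N (j + 1 + 1) q *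
          Complex.I_sq
  · simp only [Pauli.mat, eigenEntry, Matrix.of_apply, Matrix.cons_val', Matrix.cons_val_zero,
      Matrix.cons_val_one, Matrix.cons_val_fin_one, mul_zero, add_zero, zero_mul]
    split_ifs with h
    · rw [← h]; ring
    · simp

/-- The closed form makes matrix inversion unnecessary in the program. For `Y`, the inverse phase `i
^ (-q)` is written as `i ^ (3q)` to keep exponents natural. -/
theorem eigenMat_mul_eigenInvMat (P : Pauli) (N : ℕ) : eigenMat P N * eigenInvMat P N = 1 := by
  ext k q
  have hk : (k : ℕ) ≤ N := Nat.lt_succ_iff.1 k.2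
  have h2 : (2 : ℂ) ^ N ≠ 0 := pow_ne_zero _ two_ne_zero
  have h := sum_kraw_mul_kraw hk q
  rw [Finset.sum_range] at h
  rw [Matrix.mul_apply, Matrix.one_apply]
  simp only [eigenMat, eigenInvMat]
  have hqk : ((q : ℕ) = k) ↔ k = q := by rw [← Fin.ext_iff, eq_comm]
  cases P
  · simp only [eigenEntry, eigenInvEntry, mul_div_assoc', ← Finset.sum_div, h, hqk]
    split_ifs <;> simp
  · simp only [eigenEntry, eigenInvEntry]
    calc _ = Complex.I ^ (k : ℕ) * Complex.I ^ (3 * (q : ℕ)) *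
          (∑ r : Fin (N + 1), kraw N k r * kraw N r q) / 2 ^ N := by
          rw [Finset.mul_sum, Finset.sum_div]
          exact Finset.sum_congr rfl fun r _ => by ring
      _ = _ := by
          rw [h]
          simp only [hqk]
          split_ifs with hkq
          · rw [mul_div_cancel_right₀ _ h2, hkq, ← pow_add,
              show (q : ℕ) + 3 * q = 4 * q by ring, pow_mul, Complex.I_pow_four, one_pow]
          · simp
  · simp only [eigenEntry, eigenInvEntry, ← Fin.ext_iff]
    simp

theorem eigenInvMat_mul_eigenMat (P : Pauli) (N : ℕ) : eigenInvMat P N * eigenMat P N = 1 :=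
  mul_eq_one_comm.1 (eigenMat_mul_eigenInvMat P N)

theorem collective_eq (P : Pauli) (N : ℕ) :
    collective P N = eigenMat P N * Matrix.diagonal (weight N) * eigenInvMat P N := by
  rw [← collective_mul_eigenMat, Matrix.mul_assoc, eigenMat_mul_eigenInvMat, Matrix.mul_one]

end SnCircuit

/-! ### Schur vectors and the action of collective and global Pauli operators on them. -/

namespace SnCircuit

/-! ### Unnormalized Schur vectors -/

theorem eq_zero_or_eq_one (a : Fin 2) : a = 0 ∨ a = 1 := by
  revert a
  decide

/-- The singlet factor of the canonical Schur vectors. -/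
def singletPart {n : ℕ} (m : ℕ) (x : Fin n → Fin 2) : ℂ :=
  ∏ j ∈ Finset.range m, singlet (bit x (2 * j)) (bit x (2 * j + 1))

/-- The Hamming weight of the qubits outside the singlets. -/
def tailWeight {n : ℕ} (m : ℕ) (x : Fin n → Fin 2) : ℕ :=
  (Finset.univ.filter (fun k : Fin n => 2 * m ≤ (k : ℕ) ∧ x k = 1)).card

/-- The unnormalized canonical Schur vectors of the irrep `(n - m, m)` as columns of a matrix. -/
def schurMat (n m : ℕ) : Matrix (Fin n → Fin 2) (Fin (n - 2 * m + 1)) ℂ :=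
  fun x q => singletPart m x * if tailWeight m x = q then 1 else 0

theorem schurVec_eq (n m : ℕ) (q : Fin (n - 2 * m + 1)) (x : Fin n → Fin 2) :
    schurVec n m q x = schurMat n m x q / (Real.sqrt ((n - 2 * m).choose q : ℝ) : ℂ) := by
  have h : schurVec n m q x = singletPart m x * if tailWeight m x = q then
      1 / (Real.sqrt ((n - 2 * m).choose q : ℝ) : ℂ) else 0 := rfl
  rw [h, schurMat]
  split_ifs <;> simp [div_eq_mul_inv]

theorem tailWeight_eq_sum {n : ℕ} (m : ℕ) (x : Fin n → Fin 2) :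
    tailWeight m x = ∑ k : Fin n, if 2 * m ≤ (k : ℕ) then (x k : ℕ) else 0 := by
  rw [tailWeight, Finset.card_filter]
  refine Finset.sum_congr rfl fun k _ => ?_
  by_cases h : 2 * m ≤ (k : ℕ)
  · have : ∀ a : Fin 2, (if a = 1 then 1 else 0) = (a : ℕ) := by decide
    simp [h, this]
  · simp [h]

theorem tailWeight_zero {n : ℕ} (x : Fin n → Fin 2) : tailWeight 0 x = ∑ k, (x k : ℕ) := by
  simp [tailWeight_eq_sum]

open Matrix in
-- Together with `singletPart_succ`, this removes the first pair of qubits and supports every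
-- induction on the number of singlets below.
theorem tailWeight_succ {n : ℕ} (m : ℕ) (a b : Fin 2) (y : Fin n → Fin 2) :
    tailWeight (m + 1) (vecCons a (vecCons b y)) = tailWeight m y := by
  rw [tailWeight_eq_sum, tailWeight_eq_sum, Fin.sum_univ_succ, Fin.sum_univ_succ,
    if_neg (by simp), if_neg (by simp; omega), zero_add, zero_add]
  simp only [cons_val_succ, Fin.val_succ]
  exact Finset.sum_congr rfl fun k _ => by
    congr 1
    simp only [eq_iff_iff]
    omega

open Matrix in
theorem singletPart_succ {n : ℕ} (m : ℕ) (a b : Fin 2) (y : Fin n → Fin 2) :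
    singletPart (m + 1) (vecCons a (vecCons b y)) = singlet a b * singletPart m y := by
  have hbit : ∀ k, bit (vecCons a (vecCons b y)) (k + 2) = bit y k := by
    intro k
    by_cases h : k < n
    · rw [bit, bit, dif_pos h, dif_pos (Nat.add_lt_add_right h 2)]
      rfl
    · rw [bit, bit, dif_neg h, dif_neg (by omega)]
  rw [singletPart, Finset.prod_range_succ', mul_comm]
  congr 1
  refine Finset.prod_congr rfl fun j _ => ?_
  rw [show 2 * (j + 1) + 1 = (2 * j + 1) + 2 by ring, show 2 * (j + 1) = 2 * j + 2 by ring,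
    hbit, hbit]

open Matrix in
theorem exists_vecCons_vecCons {n : ℕ} (x : Fin (n + 2) → Fin 2) :
    ∃ a b y, x = vecCons a (vecCons b y) :=
  ⟨x 0, x 1, fun k => x k.succ.succ, by
    funext k
    refine Fin.cases rfl (fun k => ?_) k
    exact Fin.cases rfl (fun k => rfl) k⟩

open Matrix in
theorem update_vecCons_zero {n : ℕ} (a b : Fin 2) (y : Fin n → Fin 2) :
    Function.update (vecCons a y) 0 b = vecCons b y := Fin.update_cons_zero ..

open Matrix in
theorem update_vecCons_succ {n : ℕ} (a b : Fin 2) (y : Fin n → Fin 2) (j : Fin n) :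
    Function.update (vecCons a y) j.succ b = vecCons a (Function.update y j b) :=
  (Fin.cons_update (α := fun _ => Fin 2) a y j b).symm

theorem tailWeight_le {n : ℕ} (m : ℕ) (x : Fin n → Fin 2) : tailWeight m x ≤ n - 2 * m := by
  rw [tailWeight]
  calc _ ≤ (Finset.univ.filter (fun k : Fin n => 2 * m ≤ (k : ℕ))).card :=
        Finset.card_le_card fun k hk => by simp_all
    _ ≤ ((Finset.Ico (2 * m) n)).card := by
        refine Finset.card_le_card_of_injOn (fun k => (k : ℕ)) ?_ Fin.val_injective.injOn
        intro k hk
        simp_all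
    _ = n - 2 * m := Nat.card_Ico _ _

theorem sum_vecCons {n : ℕ} {M : Type*} [AddCommMonoid M] (f : (Fin (n + 1) → Fin 2) → M) :
    ∑ x, f x = ∑ y, (f (Matrix.vecCons 0 y) + f (Matrix.vecCons 1 y)) := by
  rw [← (Fin.consEquiv (fun _ => Fin 2)).sum_comp, Fintype.sum_prod_type_right]
  refine Finset.sum_congr rfl fun y _ => ?_
  rw [Fin.sum_univ_two]
  rfl

theorem sum_sum_bits_eq (n q : ℕ) :
    (∑ x : Fin n → Fin 2, if ∑ k, (x k : ℕ) = q then (1 : ℂ) else 0) = n.choose q := by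
  induction n generalizing q with
  | zero => cases q <;> simp
  | succ n ih =>
    rw [sum_vecCons, Finset.sum_add_distrib]
    simp only [Fin.sum_univ_succ, Matrix.cons_val_zero, Matrix.cons_val_succ, Fin.val_zero,
      Fin.val_one, zero_add]
    rw [ih]
    cases q with
    | zero => simp
    | succ q =>
      have : ∀ a : ℕ, (1 + a = q + 1) ↔ a = q := fun a => by omega
      simp only [this]
      rw [ih, Nat.choose_succ_succ]
      push_cast
      ring

/-- Each singlet has norm one and can be summed out, leaving the count of strings of weight `q` on
the other qubits. -/
theorem sum_normSq_singletPart (n m q : ℕ) (h : 2 * m ≤ n) :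
    (∑ x : Fin n → Fin 2, star (singletPart m x) * singletPart m x *
      if tailWeight m x = q then 1 else 0) = (n - 2 * m).choose q := by
  induction m generalizing n with
  | zero =>
    simp only [singletPart, Finset.range_zero, Finset.prod_empty, star_one, one_mul, mul_one,
      tailWeight_zero]
    exact sum_sum_bits_eq n q
  | succ m ih =>
    obtain ⟨n, rfl⟩ : ∃ k, n = k + 2 := ⟨n - 2, by omega⟩
    rw [sum_vecCons, sum_vecCons, show n + 2 - 2 * (m + 1) = n - 2 * m by omega,
      ← ih n (by omega)]
    refine Finset.sum_congr rfl fun y _ => ?_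
    have hs : ∀ a b : Fin 2, singletPart (m + 1) (Matrix.vecCons a (Matrix.vecCons b y)) =
      singlet a b * singletPart m y := fun a b => singletPart_succ m a b y
    have hw : ∀ a b : Fin 2, tailWeight (m + 1) (Matrix.vecCons a (Matrix.vecCons b y)) =
      tailWeight m y := fun a b => tailWeight_succ m a b y
    simp only [hs, hw]
    have h2 : (Real.sqrt 2 : ℂ) * (Real.sqrt 2 : ℂ) = 2 := by
      rw [← Complex.ofReal_mul, Real.mul_self_sqrt (by norm_num)]; simp
    have h2' : (Real.sqrt 2 : ℂ)⁻¹ * (Real.sqrt 2 : ℂ)⁻¹ = 2⁻¹ := by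
      rw [← mul_inv, h2]
    simp only [singlet, StarMul.star_mul]
    generalize (if tailWeight m y = q then (1 : ℂ) else 0) = r
    simp [Complex.conj_ofReal, neg_div]
    linear_combination (2 * (starRingEnd ℂ (singletPart m y)) * singletPart m y * r) * h2'

/-- The unnormalized Schur vectors are orthogonal. -/
theorem schurMat_gram (n m : ℕ) (h : 2 * m ≤ n) : (schurMat n m)ᴴ * schurMat n m =
    Matrix.diagonal fun q : Fin (n - 2 * m + 1) => ((n - 2 * m).choose (q : ℕ) : ℂ) := by
  ext k q
  rw [Matrix.mul_apply, Matrix.diagonal_apply, ← sum_normSq_singletPart n m k h]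
  split_ifs with hkq
  · subst hkq
    refine Finset.sum_congr rfl fun x _ => ?_
    rw [Matrix.conjTranspose_apply, schurMat]
    split_ifs <;> simp
  · refine Finset.sum_eq_zero fun x _ => ?_
    rw [Matrix.conjTranspose_apply]
    by_cases h1 : tailWeight m x = k
    · have h2 : tailWeight m x ≠ q := fun h2 => hkq (Fin.ext (h1.symm.trans h2))
      simp [schurMat, h2]
    · simp [schurMat, h1]

/-! ### Action of local operators -/

/-- Row `x` of a one-qubit operator is supported on the strings that agree with `x` away from `j`.
-/
theorem mulMat_single_site (P : Pauli) {n : ℕ} {ι : Type*} (j : Fin n)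
    (T : Matrix (Fin n → Fin 2) ι ℂ) (x : Fin n → Fin 2) (q : ι) :
    ((P.at j : Op n) * T) x q = ∑ b, P.mat (x j) b * T (Function.update x j b) q := by
  have h1 : ∀ b, (P.at j : Op n) x (Function.update x j b) = P.mat (x j) b := by
    intro b
    rw [Pauli.at, tensorOp, Finset.prod_eq_single j]
    · simp
    · intro l _ hl
      simp [hl]
    · simp
  have hinj : Function.Injective (Function.update x j) := Function.update_injective x j
  rw [Matrix.mul_apply]
  simp only [← h1]
  rw [← Finset.sum_image (s := Finset.univ) (g := Function.update x j)
    (f := fun y => (P.at j : Op n) x y * T y q) hinj.injOn]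
  symm
  refine Finset.sum_subset (Finset.subset_univ _) fun y _ hy => ?_
  have : ∃ l, l ≠ j ∧ x l ≠ y l := by
    by_contra hcon
    push Not at hcon
    refine hy (Finset.mem_image.2 ⟨y j, Finset.mem_univ _, ?_⟩)
    funext l
    by_cases hl : l = j
    · subst hl; simp
    · simp [hl, hcon l hl]
  obtain ⟨l, hl, hxy⟩ := this
  rw [Pauli.at, tensorOp, Finset.prod_eq_zero (Finset.mem_univ l), zero_mul]
  simp [hl, hxy]

/-- The two terms acting on one singlet cancel, so only the tail qubits count. There the result
depends on `x` through its weight alone, which gives a tridiagonal matrix indexed by weights. -/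
theorem sum_single_site (P : Pauli) (n m q : ℕ) (h : 2 * m ≤ n) (x : Fin n → Fin 2) :
    ∑ j : Fin n, ∑ b, P.mat (x j) b * (singletPart m (Function.update x j b) *
      if tailWeight m (Function.update x j b) = q then 1 else 0) =
    singletPart m x * collectiveEntry P (n - 2 * m) (tailWeight m x) q := by
  induction m generalizing n with
  | zero =>
    simp only [singletPart, Finset.range_zero, Finset.prod_empty, one_mul, tailWeight_zero]
    have hw : ∀ (j : Fin n) (b : Fin 2), ∑ k, (Function.update x j b k : ℕ) + (x j : ℕ) =
        ∑ k, (x k : ℕ) + b := by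
      intro j b
      rw [← Finset.add_sum_erase _ _ (Finset.mem_univ j),
        ← Finset.add_sum_erase (f := fun k => (x k : ℕ)) _ (Finset.mem_univ j),
        Finset.sum_congr rfl (g := fun k => (x k : ℕ)) fun k hk => by
          rw [Function.update_of_ne (Finset.ne_of_mem_erase hk)]]
      simp only [Function.update_self]
      ring
    set w := ∑ k, (x k : ℕ) with hwdef
    -- Each term is affine in the bit `x j` with coefficients independent of `j`, so the sum over
    -- `j` involves only the total weight.
    have hterm : ∀ j : Fin n, (∑ b, P.mat (x j) b *
        if ∑ k, (Function.update x j b k : ℕ) = q then (1 : ℂ) else 0) =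
        (P.mat 0 0 * (if w = q then 1 else 0) + P.mat 0 1 * if w + 1 = q then 1 else 0) +
        ((x j : ℕ) : ℂ) * ((P.mat 1 0 * (if w = q + 1 then 1 else 0) +
          P.mat 1 1 * if w = q then 1 else 0) -
        (P.mat 0 0 * (if w = q then 1 else 0) + P.mat 0 1 * if w + 1 = q then 1 else 0)) := by
      intro j
      rw [Fin.sum_univ_two]
      have h0 := hw j 0
      have h1 := hw j 1
      have hx := eq_zero_or_eq_one (x j)
      rcases hx with hx | hx
      · rw [hx] at h0 h1 ⊢
        simp only [Fin.val_zero, Fin.val_one, add_zero] at h0 h1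
        rw [h0, h1]
        simp
      · rw [hx] at h0 h1 ⊢
        simp only [Fin.val_zero, Fin.val_one, add_zero] at h0 h1
        rw [show ∑ k, (Function.update x j 1 k : ℕ) = w by omega]
        have h2 : (∑ k, (Function.update x j 0 k : ℕ) = q) ↔ w = q + 1 := by omega
        simp [h2]
    simp only [hterm]
    rw [Finset.sum_add_distrib, ← Finset.sum_mul, Finset.sum_const, Finset.card_univ,
      Fintype.card_fin, ← Nat.cast_sum, ← hwdef, collectiveEntry]
    simp only [eq_comm (a := q + 1), mul_zero, Nat.sub_zero]
    simp only [nsmul_eq_mul]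
    split_ifs <;> ring
  | succ m ih =>
    obtain ⟨n, rfl⟩ : ∃ k, n = k + 2 := ⟨n - 2, by omega⟩
    obtain ⟨a, b, y, rfl⟩ := exists_vecCons_vecCons x
    rw [Fin.sum_univ_succ (n := n + 1), Fin.sum_univ_succ (n := n)]
    simp only [update_vecCons_zero, update_vecCons_succ, singletPart_succ, tailWeight_succ,
      Matrix.cons_val_zero, Matrix.cons_val_succ]
    have := ih n (by omega) y
    rw [show n + 2 - 2 * (m + 1) = n - 2 * m by omega, mul_assoc, ← this, Finset.mul_sum,
      ← add_assoc]
    -- The singlet has total spin zero: `P ⊗ 1 + 1 ⊗ P` annihilates it.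
    have hpair : (∑ c, P.mat a c * (singlet c b * singletPart m y *
        if tailWeight m y = q then 1 else 0)) + (∑ c, P.mat b c * (singlet a c * singletPart m y *
        if tailWeight m y = q then 1 else 0)) = 0 := by
      rw [Fin.sum_univ_two, Fin.sum_univ_two]
      generalize (if tailWeight m y = q then (1 : ℂ) else 0) = r
      have ha : a = 0 ∨ a = 1 := eq_zero_or_eq_one a
      have hb : b = 0 ∨ b = 1 := eq_zero_or_eq_one b
      rcases ha with rfl | rfl <;> rcases hb with rfl | rfl <;> cases P <;>
        simp [singlet, Pauli.mat, neg_div]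
    rw [hpair, zero_add]
    refine Finset.sum_congr rfl fun j _ => ?_
    rw [Finset.mul_sum]
    exact Finset.sum_congr rfl fun c _ => by ring

/-- Multiplying the matrix of Schur vectors by a block. -/
theorem schurMat_mul_apply (n m : ℕ) (f : ℕ → ℕ → ℂ) (x : Fin n → Fin 2)
    (q : Fin (n - 2 * m + 1)) :
    (schurMat n m * Matrix.of fun k q : Fin (n - 2 * m + 1) => f k q) x q =
      singletPart m x * f (tailWeight m x) q := by
  rw [Matrix.mul_apply,
    Finset.sum_eq_single ⟨tailWeight m x, Nat.lt_succ_of_le (tailWeight_le m x)⟩]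
  · simp [schurMat]
  · intro k _ hk
    have : tailWeight m x ≠ k := fun h => hk (Fin.ext h.symm)
    simp [schurMat, this]
  · simp

theorem sum_at_mul_schurMat (P : Pauli) (n m : ℕ) (h : 2 * m ≤ n) :
    (∑ j, (P.at j : Op n)) * schurMat n m = schurMat n m * collective P (n - 2 * m) := by
  ext x q
  have h2 : (schurMat n m * collective P (n - 2 * m)) x q = _ :=
    schurMat_mul_apply n m (collectiveEntry P (n - 2 * m)) x q
  rw [h2, ← sum_single_site P n m q h x, Matrix.sum_mul, Matrix.sum_apply]
  refine Finset.sum_congr rfl fun j _ => ?_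
  rw [mulMat_single_site]
  rfl

/-! ### Action of the global Pauli operators -/

/-- The row where the single nonzero entry of a column of a Pauli matrix sits. -/
def Pauli.flip : Pauli → Fin 2 → Fin 2
  | X => Equiv.swap 0 1
  | Y => Equiv.swap 0 1
  | Z => id

theorem Pauli.mat_apply_of_ne (P : Pauli) {a b : Fin 2} (h : b ≠ P.flip a) : P.mat a b = 0 := by
  revert h
  have ha : a = 0 ∨ a = 1 := eq_zero_or_eq_one a
  have hb : b = 0 ∨ b = 1 := eq_zero_or_eq_one b
  rcases ha with rfl | rfl <;> rcases hb with rfl | rfl <;> cases P <;>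
    simp [Pauli.flip, Pauli.mat]

/-- Entries of the block of the global Pauli operators. -/
def globEntry : Pauli → ℕ → ℕ → ℕ → ℕ → ℂ
  | .X, m, N, k, q => if k + q = N then Complex.I ^ (2 * m) else 0
  | .Y, m, N, k, q => if k + q = N then Complex.I ^ (2 * m + k + 3 * q) else 0
  | .Z, m, _, k, q => if k = q then Complex.I ^ (2 * m + 2 * q) else 0

def globBlock (P : Pauli) (n m : ℕ) : Matrix (Fin (n - 2 * m + 1)) (Fin (n - 2 * m + 1)) ℂ :=
  fun k q => globEntry P m (n - 2 * m) k q

theorem prod_bits (c : Fin 2 → ℂ) {n : ℕ} (x : Fin n → Fin 2) :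
    ∏ j, c (x j) = c 0 ^ (n - ∑ k, (x k : ℕ)) * c 1 ^ ∑ k, (x k : ℕ) := by
  induction n with
  | zero => simp
  | succ n ih =>
    rw [Fin.prod_univ_succ, ih, Fin.sum_univ_succ]
    have hle := tailWeight_le 0 (fun i => x (Fin.succ i))
    rw [tailWeight_zero, mul_zero, Nat.sub_zero] at hle
    have hx := eq_zero_or_eq_one (x 0)
    rcases hx with hx | hx
    · rw [hx, Fin.val_zero, zero_add, show n + 1 - ∑ k, (x (Fin.succ k) : ℕ) = n - ∑ k, (x (Fin.succ k) : ℕ) + 1 by omega]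
      ring
    · rw [hx, Fin.val_one, show ∀ a, n + 1 - (1 + a) = n - a by intro a; omega]
      ring

theorem sum_flip_bits {n : ℕ} (x : Fin n → Fin 2) :
    ∑ k, (Equiv.swap 0 1 (x k) : Fin 2).val = n - ∑ k, (x k : ℕ) := by
  have h : ∀ a : Fin 2, (Equiv.swap 0 1 a).val + a.val = 1 := by decide
  have : ∑ k, (Equiv.swap 0 1 (x k) : Fin 2).val + ∑ k, (x k : ℕ) = n := by
    rw [← Finset.sum_add_distrib]
    simp [h]
  omega

/-- The singlets contribute the sign `(-1) ^ m = i ^ (2m)`. On the tail, `X` and `Y` exchange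
weights `k` and `N - k`, with phase `i ^ k (-i) ^ q` for `Y`, and `Z` gives the parity. -/
theorem global_action (P : Pauli) (n m q : ℕ) (h : 2 * m ≤ n) (x : Fin n → Fin 2) :
    (∏ j, P.mat (x j) (P.flip (x j))) * (singletPart m (fun j => P.flip (x j)) *
      if tailWeight m (fun j => P.flip (x j)) = q then 1 else 0) =
    singletPart m x * globEntry P m (n - 2 * m) (tailWeight m x) q := by
  induction m generalizing n with
  | zero =>
    rw [prod_bits (fun a => P.mat a (P.flip a))]
    have hle := tailWeight_le 0 x
    simp only [singletPart, Finset.range_zero, Finset.prod_empty, one_mul, tailWeight_zero,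
      mul_zero, Nat.sub_zero] at hle ⊢
    set w := ∑ k, (x k : ℕ) with hw
    cases P
    · simp only [Pauli.flip, sum_flip_bits, ← hw, globEntry]
      have : n - w = q ↔ w + q = n := by omega
      simp [Pauli.mat, this]
    · simp only [Pauli.flip, sum_flip_bits, ← hw, globEntry]
      have : n - w = q ↔ w + q = n := by omega
      simp only [this]
      split_ifs with hq
      · rw [show n - w = q by omega]
        simp [Pauli.mat]
        rw [pow_add, pow_mul, show Complex.I ^ 3 = -Complex.I by rw [pow_succ, Complex.I_sq]; simp]
        ring
      · simp
    · simp only [Pauli.flip, ← hw, globEntry, id]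
      split_ifs with hq
      · simp [Pauli.mat, pow_mul, hq]
      · simp
  | succ m ih =>
    obtain ⟨n, rfl⟩ : ∃ k, n = k + 2 := ⟨n - 2, by omega⟩
    obtain ⟨a, b, y, rfl⟩ := exists_vecCons_vecCons x
    have hflip : (fun j => P.flip ((Matrix.vecCons a (Matrix.vecCons b y) : Fin (n + 2) → Fin 2) j)) =
        Matrix.vecCons (P.flip a) (Matrix.vecCons (P.flip b) fun j => P.flip (y j)) := by
      funext k
      refine Fin.cases rfl (fun k => ?_) k
      exact Fin.cases rfl (fun k => rfl) k
    rw [hflip, Fin.prod_univ_succ, Fin.prod_univ_succ]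
    simp only [singletPart_succ, tailWeight_succ, Matrix.cons_val_zero, Matrix.cons_val_succ]
    have hih := ih n (by omega) y
    rw [show n + 2 - 2 * (m + 1) = n - 2 * m by omega]
    -- The singlet is an eigenvector of `P ⊗ P` with eigenvalue `-1`.
    have h1 : P.mat a (P.flip a) * P.mat b (P.flip b) * singlet (P.flip a) (P.flip b) =
        -singlet a b := by
      have ha : a = 0 ∨ a = 1 := eq_zero_or_eq_one a
      have hb : b = 0 ∨ b = 1 := eq_zero_or_eq_one b
      rcases ha with rfl | rfl <;> rcases hb with rfl | rfl <;> cases P <;>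
        simp [singlet, Pauli.mat, Pauli.flip, neg_div]
    have h2 : globEntry P (m + 1) (n - 2 * m) (tailWeight m y) q =
        -globEntry P m (n - 2 * m) (tailWeight m y) q := by
      cases P <;> simp only [globEntry] <;> split_ifs <;>
        simp [mul_add, pow_add]
    rw [h2]
    linear_combination (∏ j, P.mat (y j) (P.flip (y j))) *
      (singletPart m (fun j => P.flip (y j)) *
        if tailWeight m (fun j => P.flip (y j)) = q then 1 else 0) * h1 - singlet a b * hih

theorem global_mul_schurMat (P : Pauli) (n m : ℕ) (h : 2 * m ≤ n) :
    (tensorOp (fun _ => P.mat) : Op n) * schurMat n m = schurMat n m * globBlock P n m := by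
  ext x q
  have h2 : (schurMat n m * globBlock P n m) x q = _ :=
    schurMat_mul_apply n m (globEntry P m (n - 2 * m)) x q
  rw [h2, ← global_action P n m q h x, Matrix.mul_apply,
    Finset.sum_eq_single (fun j => P.flip (x j))]
  · rfl
  · intro y _ hy
    have : ∃ j, y j ≠ P.flip (x j) := by
      by_contra hcon
      push Not at hcon
      exact hy (funext hcon)
    obtain ⟨j, hj⟩ := this
    rw [tensorOp, Finset.prod_eq_zero (Finset.mem_univ j) (P.mat_apply_of_ne hj), zero_mul]
  · simp

end SnCircuit

/-! ### Intertwining relations for generators, exponentials and circuits. -/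

namespace SnCircuit

/-! ### Algebra of local operators -/

theorem tensorOp_mul {n : ℕ} (A B : Fin n → Matrix (Fin 2) (Fin 2) ℂ) :
    tensorOp A * tensorOp B = tensorOp fun j => A j * B j := by
  ext x z
  simp only [tensorOp, Matrix.mul_apply, ← Finset.prod_mul_distrib]
  rw [Finset.prod_univ_sum, Fintype.piFinset_univ]

theorem tensorOp_one {n : ℕ} : tensorOp (fun _ : Fin n => 1) = 1 := by
  ext x y
  rw [tensorOp, Matrix.one_apply]
  split_ifs with h
  · subst h
    exact Finset.prod_eq_one fun j _ => Matrix.one_apply_eq _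
  · obtain ⟨j, hj⟩ := Function.ne_iff.1 h
    exact Finset.prod_eq_zero (Finset.mem_univ j) (Matrix.one_apply_ne hj)

theorem tensorOp_conjTranspose {n : ℕ} (A : Fin n → Matrix (Fin 2) (Fin 2) ℂ) :
    (tensorOp A)ᴴ = tensorOp fun j => (A j)ᴴ := by
  ext x y
  simp [tensorOp, Matrix.conjTranspose_apply]

theorem Pauli.mat_mul_self (P : Pauli) : P.mat * P.mat = 1 := by
  ext a b
  rcases eq_zero_or_eq_one a with rfl | rfl <;> rcases eq_zero_or_eq_one b with rfl | rfl <;>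
    cases P <;> simp [Pauli.mat]

theorem Pauli.mat_conjTranspose (P : Pauli) : P.matᴴ = P.mat := by
  ext a b
  rcases eq_zero_or_eq_one a with rfl | rfl <;> rcases eq_zero_or_eq_one b with rfl | rfl <;>
    cases P <;> simp [Pauli.mat]

theorem Pauli.at_mul_self (P : Pauli) {n : ℕ} (j : Fin n) : (P.at j : Op n) * P.at j = 1 := by
  rw [Pauli.at, tensorOp_mul, ← tensorOp_one]
  congr 1
  funext l
  by_cases h : l = j
  · subst h; simp [P.mat_mul_self]
  · simp [h]

theorem Pauli.at_commute (P : Pauli) {n : ℕ} (j k : Fin n) :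
    (P.at j : Op n) * P.at k = P.at k * P.at j := by
  rw [Pauli.at, Pauli.at, tensorOp_mul, tensorOp_mul]
  congr 1
  funext l
  by_cases h : l = j <;> by_cases h' : l = k <;> simp_all

theorem Pauli.at_conjTranspose (P : Pauli) {n : ℕ} (j : Fin n) : (P.at j : Op n)ᴴ = P.at j := by
  rw [Pauli.at, tensorOp_conjTranspose]
  congr 1
  funext l
  by_cases h : l = j
  · subst h; simp [P.mat_conjTranspose]
  · simp [h]

/-- The square splits into diagonal terms, where `P_j ^ 2 = 1`, and two equal off-diagonal halves,
since the `P_j` commute. -/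
theorem sum_pairs (P : Pauli) (n : ℕ) :
    (∑ j : Fin n, (P.at j : Op n)) * ∑ j : Fin n, (P.at j : Op n) = (n : ℂ) • (1 : Op n) +
      (2 : ℂ) • ∑ j : Fin n, ∑ k ∈ Finset.univ.filter (fun k : Fin n => k < j),
        P.at j * P.at k := by
  set W := ∑ j : Fin n, ∑ k ∈ Finset.univ.filter (fun k : Fin n => k < j),
    (P.at j : Op n) * P.at k with hW
  have hW' : ∑ j : Fin n, ∑ k ∈ Finset.univ.filter (fun k : Fin n => j < k),
      (P.at j : Op n) * P.at k = W := by
    rw [hW]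
    simp only [Finset.sum_filter]
    rw [Finset.sum_comm]
    simp only [P.at_commute]
  have hsplit : ∀ j : Fin n, ∑ k, (P.at j : Op n) * P.at k =
      1 + ∑ k ∈ Finset.univ.filter (fun k : Fin n => k < j), (P.at j : Op n) * P.at k +
        ∑ k ∈ Finset.univ.filter (fun k : Fin n => j < k), (P.at j : Op n) * P.at k := by
    intro j
    have : ∀ k, (P.at j : Op n) * P.at k = (if j = k then 1 else 0) +
        (if k < j then (P.at j : Op n) * P.at k else 0) +
        if j < k then (P.at j : Op n) * P.at k else 0 := by
      intro k
      rcases lt_trichotomy j k with h | h | h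
      · simp [h, h.ne, h.le]
      · subst h; simp [P.at_mul_self]
      · simp [h, h.ne', h.le]
    rw [Finset.sum_congr rfl fun k _ => this k]
    simp [Finset.sum_add_distrib, Finset.sum_filter]
  rw [Finset.sum_mul]
  simp only [Finset.mul_sum]
  rw [Finset.sum_congr rfl fun j _ => hsplit j, Finset.sum_add_distrib, Finset.sum_add_distrib,
    hW', ← hW, two_smul, ← add_assoc]
  simp [← Nat.cast_smul_eq_nsmul ℂ]

/-- As a polynomial in the collective operator, the two-body generator shares the eigenbasis of the
one-body generator. -/
theorem Generator.op_two (P : Pauli) {n : ℕ} : (Generator.two P).op n =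
    (1 / ((n : ℂ) * ((n : ℂ) - 1))) • ((∑ j : Fin n, (P.at j : Op n)) *
      (∑ j : Fin n, (P.at j : Op n)) - (n : ℂ) • 1) := by
  rw [sum_pairs, add_sub_cancel_left, smul_smul, Generator.op]
  congr 1
  ring

theorem Generator.op_conjTranspose (G : Generator) {n : ℕ} :
    (G.op n)ᴴ = G.op n := by
  have hs : ∀ P : Pauli, (∑ j : Fin n, (P.at j : Op n))ᴴ = ∑ j : Fin n, (P.at j : Op n) := by
    intro P
    rw [Matrix.conjTranspose_sum]
    exact Finset.sum_congr rfl fun j _ => P.at_conjTranspose j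
  cases G with
  | one P => rw [Generator.op, Matrix.conjTranspose_smul, hs]; simp
  | two P =>
    rw [Generator.op_two P, Matrix.conjTranspose_smul, Matrix.conjTranspose_sub,
      Matrix.conjTranspose_mul, hs, Matrix.conjTranspose_smul]
    simp

/-! ### Intertwining with permuted Schur vectors -/

/-- Permutation of the bits of a bit string. -/
def permBits {n : ℕ} (σ : Equiv.Perm (Fin n)) : (Fin n → Fin 2) ≃ (Fin n → Fin 2) :=
  σ.symm.arrowCongr (Equiv.refl _)

theorem permBits_apply {n : ℕ} (σ : Equiv.Perm (Fin n)) (x : Fin n → Fin 2) :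
    permBits σ x = fun j => x (σ j) := rfl

theorem tensorOp_submatrix {n : ℕ} (σ : Equiv.Perm (Fin n))
    (A : Fin n → Matrix (Fin 2) (Fin 2) ℂ) :
    (tensorOp A).submatrix (permBits σ) (permBits σ) = tensorOp fun j => A (σ.symm j) := by
  ext x y
  simp only [Matrix.submatrix_apply, tensorOp, permBits_apply]
  rw [← Equiv.prod_comp σ (fun j => A (σ.symm j) (x j) (y j))]
  exact Finset.prod_congr rfl fun j _ => by rw [Equiv.symm_apply_apply]

theorem sum_at_submatrix {n : ℕ} (σ : Equiv.Perm (Fin n)) (P : Pauli) :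
    (∑ j : Fin n, (P.at j : Op n)).submatrix (permBits σ) (permBits σ) =
      ∑ j : Fin n, (P.at j : Op n) := by
  conv_rhs => rw [← Equiv.sum_comp σ (fun j => (P.at j : Op n))]
  ext x y
  simp only [Matrix.submatrix_apply, Matrix.sum_apply]
  refine Finset.sum_congr rfl fun j _ => ?_
  have h := congrFun (congrFun (tensorOp_submatrix σ (Function.update (fun _ => 1) j P.mat)) x) y
  rw [Matrix.submatrix_apply] at h
  rw [Pauli.at, h, Pauli.at]
  congr 1
  funext l
  simp [Function.update_apply, Equiv.symm_apply_eq]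

/-- The unnormalized Schur vectors, with permuted tensor factors. -/
def permSchurMat {n : ℕ} (σ : Equiv.Perm (Fin n)) (m : ℕ) :
    Matrix (Fin n → Fin 2) (Fin (n - 2 * m + 1)) ℂ :=
  (schurMat n m).submatrix (permBits σ) id

/-- A permutation-invariant operator acts on every permuted copy by the same block. -/
theorem mul_permSchurMat {n m : ℕ} {σ : Equiv.Perm (Fin n)} {A : Op n}
    {B : Matrix (Fin (n - 2 * m + 1)) (Fin (n - 2 * m + 1)) ℂ}
    (hA : A.submatrix (permBits σ) (permBits σ) = A) (h : A * schurMat n m = schurMat n m * B) :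
    A * permSchurMat σ m = permSchurMat σ m * B := by
  conv_lhs => rw [← hA]
  rw [permSchurMat, Matrix.submatrix_mul_equiv, h]
  rfl

/-- An intertwining relation passes to powers and then, by continuity of multiplication by `T`, to
the exponential series. As `T` is rectangular, invariance of `exp` under conjugation would not
suffice. -/
theorem exp_mul_of_mul_eq {ι κ : Type*} [Fintype ι] [DecidableEq ι] [Fintype κ] [DecidableEq κ]
    {A : Matrix ι ι ℂ} {T : Matrix ι κ ℂ} {B : Matrix κ κ ℂ} (h : A * T = T * B) :
    NormedSpace.exp A * T = T * NormedSpace.exp B := by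
  have hpow : ∀ k : ℕ, A ^ k * T = T * B ^ k := by
    intro k
    induction k with
    | zero => simp
    | succ k ih => rw [pow_succ, Matrix.mul_assoc, h, ← Matrix.mul_assoc, ih, Matrix.mul_assoc,
        ← pow_succ]
  have hA : HasSum (fun k : ℕ => ((k.factorial : ℂ)⁻¹) • A ^ k) (NormedSpace.exp A) := by
    open scoped Matrix.Norms.Operator in
    exact NormedSpace.exp_series_hasSum_exp' (𝕂 := ℂ) A
  have hB : HasSum (fun k : ℕ => ((k.factorial : ℂ)⁻¹) • B ^ k) (NormedSpace.exp B) := by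
    open scoped Matrix.Norms.Operator in
    exact NormedSpace.exp_series_hasSum_exp' (𝕂 := ℂ) B
  have hAT := hA.map (⟨⟨fun M => M * T, Matrix.zero_mul _⟩, fun _ _ => Matrix.add_mul _ _ _⟩ :
    Matrix ι ι ℂ →+ Matrix ι κ ℂ)
    (by exact continuous_id.matrix_mul continuous_const)
  have hTB := hB.map (⟨⟨fun M => T * M, Matrix.mul_zero _⟩, fun _ _ => Matrix.mul_add _ _ _⟩ :
    Matrix κ κ ℂ →+ Matrix ι κ ℂ)
    (by exact continuous_const.matrix_mul continuous_id)
  refine hAT.unique (Eq.mp (congrArg (fun f => HasSum f _) ?_) hTB)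
  funext k
  simp [hpow]

/-! ### Blocks of generators, observables and circuits -/

/-- The eigenvalues of a generator in the irrep `(n - m, m)`. -/
def Generator.eig (n m : ℕ) : Generator → Fin (n - 2 * m + 1) → ℂ
  | one _, k => weight (n - 2 * m) k / n
  | two _, k => (weight (n - 2 * m) k * weight (n - 2 * m) k - n) / (n * (n - 1))

def Generator.pauli : Generator → Pauli
  | one P => P
  | two P => P

/-- The block of a generator in the basis of unnormalized Schur vectors. -/
def Generator.block (n m : ℕ) : Generator →
    Matrix (Fin (n - 2 * m + 1)) (Fin (n - 2 * m + 1)) ℂ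
  | one P => (1 / (n : ℂ)) • collective P (n - 2 * m)
  | two P => (1 / ((n : ℂ) * ((n : ℂ) - 1))) •
      (collective P (n - 2 * m) * collective P (n - 2 * m) - (n : ℂ) • 1)

/-- A polynomial in a diagonalized matrix is the same polynomial in its eigenvalues. -/
theorem Generator.block_eq (G : Generator) (n m : ℕ) : G.block n m =
    eigenMat G.pauli (n - 2 * m) * Matrix.diagonal (G.eig n m) *
      eigenInvMat G.pauli (n - 2 * m) := by
  cases G with
  | one P =>
    rw [Generator.block, collective_eq, ← Matrix.smul_mul, ← Matrix.mul_smul,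
      ← Matrix.diagonal_smul]
    congr 3
    funext k
    simp [Generator.eig, div_eq_inv_mul]
  | two P =>
    have h1 : collective P (n - 2 * m) * collective P (n - 2 * m) = eigenMat P (n - 2 * m) *
        (Matrix.diagonal (weight (n - 2 * m)) * Matrix.diagonal (weight (n - 2 * m))) *
        eigenInvMat P (n - 2 * m) := by
      conv_lhs => rw [collective_eq]
      calc _ = eigenMat P (n - 2 * m) * Matrix.diagonal (weight (n - 2 * m)) *
          (eigenInvMat P (n - 2 * m) * eigenMat P (n - 2 * m)) *
          Matrix.diagonal (weight (n - 2 * m)) * eigenInvMat P (n - 2 * m) := by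
            simp only [Matrix.mul_assoc]
        _ = _ := by rw [eigenInvMat_mul_eigenMat]; simp only [Matrix.mul_assoc, Matrix.one_mul]
    have h2 : (n : ℂ) • (1 : Matrix (Fin (n - 2 * m + 1)) (Fin (n - 2 * m + 1)) ℂ) =
        eigenMat P (n - 2 * m) * ((n : ℂ) • 1) * eigenInvMat P (n - 2 * m) := by
      rw [Matrix.mul_smul, Matrix.smul_mul, Matrix.mul_one, eigenMat_mul_eigenInvMat]
    rw [Generator.block, h1, h2, ← Matrix.sub_mul, ← Matrix.mul_sub, ← Matrix.smul_mul,
      ← Matrix.mul_smul]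
    congr 2
    ext k q
    simp only [Matrix.smul_apply, Matrix.sub_apply, Matrix.diagonal_mul_diagonal,
      Matrix.diagonal_apply, Matrix.one_apply, Generator.eig]
    split_ifs
    · simp [div_eq_inv_mul]
    · simp

def Observable.block (n m : ℕ) : Observable →
    Matrix (Fin (n - 2 * m + 1)) (Fin (n - 2 * m + 1)) ℂ
  | gen G => G.block n m
  | glob P => globBlock P n m

section intertwine

variable {n m : ℕ} (σ : Equiv.Perm (Fin n))

theorem Generator.mul_permSchurMat (hm : 2 * m ≤ n) (G : Generator) :
    G.op n * permSchurMat σ m = permSchurMat σ m * G.block n m := by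
  have h1 : ∀ P : Pauli, (∑ j : Fin n, (P.at j : Op n)) * permSchurMat σ m =
      permSchurMat σ m * collective P (n - 2 * m) := fun P =>
    SnCircuit.mul_permSchurMat (sum_at_submatrix σ P) (sum_at_mul_schurMat P n m hm)
  cases G with
  | one P => rw [Generator.op, Matrix.smul_mul, h1, Generator.block, Matrix.mul_smul]
  | two P =>
    rw [Generator.op_two P, Generator.block, Matrix.smul_mul, Matrix.mul_smul, Matrix.sub_mul,
      Matrix.mul_sub, Matrix.mul_assoc, h1, ← Matrix.mul_assoc, h1, Matrix.mul_assoc,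
      Matrix.smul_mul, Matrix.mul_smul, Matrix.one_mul, Matrix.mul_one]

theorem Observable.mul_permSchurMat (hm : 2 * m ≤ n) (O : Observable) :
    O.op n * permSchurMat σ m = permSchurMat σ m * O.block n m := by
  cases O with
  | gen G => exact G.mul_permSchurMat σ hm
  | glob P =>
    exact SnCircuit.mul_permSchurMat (tensorOp_submatrix σ fun _ => P.mat)
      (global_mul_schurMat P n m hm)

/-- The block of `exp (i t G)`. -/
def Generator.expBlock (G : Generator) (n m : ℕ) (t : ℂ) :
    Matrix (Fin (n - 2 * m + 1)) (Fin (n - 2 * m + 1)) ℂ :=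
  eigenMat G.pauli (n - 2 * m) *
    Matrix.diagonal (fun k => Complex.exp (Complex.I * t * G.eig n m k)) *
      eigenInvMat G.pauli (n - 2 * m)

/-- The intertwiner `T V` relates the operator to a diagonal matrix, so exponentiation reduces to
scalars; `W` then cancels `V`. -/
theorem Generator.exp_mul_permSchurMat (hm : 2 * m ≤ n) (G : Generator) (t : ℂ) :
    NormedSpace.exp ((Complex.I * t) • G.op n) * permSchurMat σ m =
      permSchurMat σ m * G.expBlock n m t := by
  set V := eigenMat G.pauli (n - 2 * m)
  set W := eigenInvMat G.pauli (n - 2 * m)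
  have hWV : W * V = 1 := eigenInvMat_mul_eigenMat _ _
  have hVW : V * W = 1 := eigenMat_mul_eigenInvMat _ _
  have h : ((Complex.I * t) • G.op n) * (permSchurMat σ m * V) =
      (permSchurMat σ m * V) * Matrix.diagonal ((Complex.I * t) • G.eig n m) := by
    rw [Matrix.smul_mul, ← Matrix.mul_assoc, G.mul_permSchurMat σ hm, G.block_eq,
      Matrix.diagonal_smul, Matrix.mul_smul]
    congr 1
    calc _ = permSchurMat σ m * V * Matrix.diagonal (G.eig n m) * (W * V) := by
          simp only [Matrix.mul_assoc, V, W]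
      _ = _ := by rw [hWV, Matrix.mul_one]
  have h' := exp_mul_of_mul_eq h
  rw [Matrix.exp_diagonal] at h'
  have hexp : NormedSpace.exp ((Complex.I * t) • G.eig n m) =
      fun k => Complex.exp (Complex.I * t * G.eig n m k) := by
    funext k
    rw [Pi.coe_exp, Complex.exp_eq_exp_ℂ]
    rfl
  rw [hexp] at h'
  calc _ = NormedSpace.exp ((Complex.I * t) • G.op n) * (permSchurMat σ m * V) * W := by
        rw [Matrix.mul_assoc, Matrix.mul_assoc, hVW, Matrix.mul_one]
    _ = _ := by rw [h', Generator.expBlock]; simp only [Matrix.mul_assoc, V, W]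

/-- The block of `exp (i θ G) A exp (-i θ G)`, from the block of `A`. -/
def Gate.evolveBlock (n m : ℕ) (A : Matrix (Fin (n - 2 * m + 1)) (Fin (n - 2 * m + 1)) ℂ)
    (g : Gate) : Matrix (Fin (n - 2 * m + 1)) (Fin (n - 2 * m + 1)) ℂ :=
  g.gen.expBlock n m g.angle * A * g.gen.expBlock n m (-g.angle)

theorem heisenberg_mul_permSchurMat (hm : 2 * m ≤ n) (gates : List Gate)
    (O : Observable) : heisenberg n gates O * permSchurMat σ m =
      permSchurMat σ m * gates.foldl (Gate.evolveBlock n m) (O.block n m) := by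
  -- The observable is generalized to any intertwined pair. The head of the list is the innermost
  -- gate of `U† A U`, which is why a left fold appears.
  have key : ∀ (A : Op n) (B : Matrix (Fin (n - 2 * m + 1)) (Fin (n - 2 * m + 1)) ℂ),
      A * permSchurMat σ m = permSchurMat σ m * B →
      ((circuitOp n gates)ᴴ * A * circuitOp n gates) * permSchurMat σ m =
        permSchurMat σ m * gates.foldl (Gate.evolveBlock n m) B := by
    induction gates with
    | nil => intro A B h; simp [circuitOp, h]
    | cons g gates ih =>
      intro A B h
      have h1 : g.op n * permSchurMat σ m =
          permSchurMat σ m * g.gen.expBlock n m (-g.angle) := by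
        rw [← g.gen.exp_mul_permSchurMat σ hm, Gate.op, mul_neg]
      have h2 : (g.op n)ᴴ * permSchurMat σ m =
          permSchurMat σ m * g.gen.expBlock n m g.angle := by
        rw [← g.gen.exp_mul_permSchurMat σ hm, Gate.op, ← Matrix.exp_conjTranspose,
          Matrix.conjTranspose_smul, g.gen.op_conjTranspose]
        simp
      have h3 : ((g.op n)ᴴ * A * g.op n) * permSchurMat σ m =
          permSchurMat σ m * Gate.evolveBlock n m B g := by
        rw [Matrix.mul_assoc, h1, ← Matrix.mul_assoc, Matrix.mul_assoc _ A, h, ← Matrix.mul_assoc,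
          h2, Gate.evolveBlock, Matrix.mul_assoc, Matrix.mul_assoc, Matrix.mul_assoc]
      rw [List.foldl_cons, ← ih _ _ h3]
      simp only [circuitOp, List.map_cons, List.prod_cons, Matrix.conjTranspose_mul,
        Matrix.mul_assoc]
  exact key _ _ (O.mul_permSchurMat σ hm)

end intertwine

/-! ### Passing to normalized Schur vectors -/

/-- The norm of an unnormalized Schur vector. -/
def schurNorm (n m : ℕ) (q : Fin (n - 2 * m + 1)) : ℂ :=
  (Real.sqrt ((n - 2 * m).choose (q : ℕ) : ℝ) : ℂ)

theorem schurNorm_ne_zero (n m : ℕ) (q : Fin (n - 2 * m + 1)) : schurNorm n m q ≠ 0 := by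
  have : 0 < ((n - 2 * m).choose (q : ℕ) : ℝ) := by
    exact_mod_cast Nat.choose_pos (Nat.lt_succ_iff.1 q.2)
  rw [schurNorm, Ne, Complex.ofReal_eq_zero]
  exact (Real.sqrt_pos.2 this).ne'

theorem schurNorm_mul_self (n m : ℕ) (q : Fin (n - 2 * m + 1)) :
    schurNorm n m q * schurNorm n m q = ((n - 2 * m).choose (q : ℕ) : ℂ) := by
  rw [schurNorm, ← Complex.ofReal_mul, Real.mul_self_sqrt (by positivity)]
  simp

theorem permVec_schurVec {n m : ℕ} (σ : Equiv.Perm (Fin n)) (q : Fin (n - 2 * m + 1))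
    (x : Fin n → Fin 2) :
    permVec σ (schurVec n m q) x = permSchurMat σ m x q * (schurNorm n m q)⁻¹ := by
  rw [permVec, schurVec_eq]
  rfl

/-- Taking inner products with the columns of `T` multiplies row `k` by the squared norm of column
`k`; dividing by the two norms leaves their ratio. -/
theorem schurBlock_apply {n m : ℕ} (hm : 2 * m ≤ n) {A : Op n}
    {B : Matrix (Fin (n - 2 * m + 1)) (Fin (n - 2 * m + 1)) ℂ}
    (h : A * schurMat n m = schurMat n m * B) (k q : Fin (n - 2 * m + 1)) :
    schurBlock A m k q = B k q * schurNorm n m k / schurNorm n m q := by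
  have hvec : ∀ q : Fin (n - 2 * m + 1), schurVec n m q =
      (schurNorm n m q)⁻¹ • fun x => schurMat n m x q := by
    intro q
    funext x
    rw [schurVec_eq]
    simp [schurNorm, div_eq_inv_mul]
  have h1 : A *ᵥ (fun x => schurMat n m x q) = fun x => (schurMat n m * B) x q := by
    rw [← h]
    rfl
  have h2 : (star fun x => schurMat n m x k) ⬝ᵥ (fun x => (schurMat n m * B) x q) =
      ((n - 2 * m).choose (k : ℕ) : ℂ) * B k q := by
    rw [← Matrix.diagonal_mul (fun q : Fin (n - 2 * m + 1) => ((n - 2 * m).choose (q : ℕ) : ℂ)),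
      ← schurMat_gram n m hm, Matrix.mul_assoc]
    rfl
  have hstar : star (schurNorm n m k)⁻¹ = (schurNorm n m k)⁻¹ := by
    simp [schurNorm, Complex.conj_ofReal]
  rw [schurBlock, hvec, hvec, Matrix.mulVec_smul, star_smul, smul_dotProduct, dotProduct_smul, h1,
    h2, hstar, ← schurNorm_mul_self, smul_eq_mul, smul_eq_mul]
  have := schurNorm_ne_zero n m k
  field_simp

/-- The same `B` serves every `σ`, and the case `σ = 1` identifies it with the canonical block up to
normalization. -/
theorem mulVec_permVec_schurVec {n m : ℕ} (hm : 2 * m ≤ n) {A : Op n}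
    {B : Matrix (Fin (n - 2 * m + 1)) (Fin (n - 2 * m + 1)) ℂ}
    (h : ∀ σ : Equiv.Perm (Fin n), A * permSchurMat σ m = permSchurMat σ m * B)
    (σ : Equiv.Perm (Fin n)) (q : Fin (n - 2 * m + 1)) :
    A *ᵥ permVec σ (schurVec n m q) =
      ∑ k : Fin (n - 2 * m + 1), schurBlock A m k q • permVec σ (schurVec n m k) := by
  have hvec : permVec σ (schurVec n m q) =
      (schurNorm n m q)⁻¹ • fun x => permSchurMat σ m x q := by
    funext x
    rw [permVec_schurVec, mul_comm]
    rfl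
  have h1 : A *ᵥ (fun x => permSchurMat σ m x q) = fun x => (permSchurMat σ m * B) x q := by
    rw [← h]
    rfl
  rw [hvec, Matrix.mulVec_smul, h1]
  funext x
  simp only [Pi.smul_apply, Finset.sum_apply, smul_eq_mul, Matrix.mul_apply, Finset.mul_sum]
  refine Finset.sum_congr rfl fun k _ => ?_
  rw [schurBlock_apply hm (h 1), permVec_schurVec]
  have := schurNorm_ne_zero n m k
  field_simp

end SnCircuit

/-! ### Machine expressions for the matrix entries, with flags selecting the cases. -/

namespace CRAM

/-- The indicator of equality of two integer expressions. -/
def NExp.isEq (a b : NExp) : NExp := .sub (.lit 1) (.add (.sub a b) (.sub b a))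

@[simp] theorem NExp.eval_isEq (i : Input) (s : State) (a b : NExp) :
    (NExp.isEq a b).eval i s = if a.eval i s = b.eval i s then 1 else 0 := by
  simp only [NExp.isEq, NExp.eval]
  split_ifs <;> omega

@[simp] theorem NExp.safe_isEq (i : Input) (S : ℕ) (s : State) (a b : NExp) :
    (NExp.isEq a b).Safe i S s ↔ a.Safe i S s ∧ b.Safe i S s := by
  simp only [NExp.isEq, NExp.Safe]
  tauto

/-- Bank `b` contains the square matrix `A`, row by row. -/
def Holds (s : State) (b : ℕ) {d : ℕ} (A : Matrix (Fin d) (Fin d) ℂ) : Prop :=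
  ∀ k q : Fin d, s.cpx b (k * d + q) = A k q

/-- The expression `e` evaluates to the entry of `A` whose row, column and position are given in
the variables 10, 11 and 13. -/
def Computes (i : Input) (S : ℕ) (s : State) (e : CExp) {d : ℕ} (A : Matrix (Fin d) (Fin d) ℂ) :
    Prop :=
  ∀ k q : Fin d, s.var 10 = k → s.var 11 = q → s.var 13 = k * d + q →
    e.Safe i S s ∧ e.eval i s = A k q

theorem computes_mem {i : Input} {S : ℕ} {s : State} {b d : ℕ} {A : Matrix (Fin d) (Fin d) ℂ}
    (h : Holds s b A) (hS : d * d ≤ S) : Computes i S s (.mem b (.var 13)) A := by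
  intro k q _ _ h13
  refine ⟨⟨trivial, ?_⟩, ?_⟩
  · rw [NExp.eval, h13]
    have h1 : ((k : ℕ) + 1) * d ≤ d * d := Nat.mul_le_mul_right _ k.2
    have := q.2
    rw [Nat.succ_mul] at h1
    omega
  · rw [CExp.eval, NExp.eval, h13]
    exact h k q

end CRAM

namespace SnCircuit

open CRAM

/-! ### Invariants of the simulation program -/

def Pauli.isX : Pauli → ℕ
  | X => 1
  | Y => 0
  | Z => 0

def Pauli.isY : Pauli → ℕ
  | X => 0
  | Y => 1
  | Z => 0

def Pauli.isZ : Pauli → ℕ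
  | X => 0
  | Y => 0
  | Z => 1

def Observable.pauli : Observable → Pauli
  | gen G => G.pauli
  | glob P => P

def Observable.isOne : Observable → ℕ
  | gen (.one _) => 1
  | gen (.two _) => 0
  | glob _ => 0

def Observable.isTwo : Observable → ℕ
  | gen (.one _) => 0
  | gen (.two _) => 1
  | glob _ => 0

def Observable.isGlob : Observable → ℕ
  | gen _ => 0
  | glob _ => 1

/-- The label of the current observable, decoded into flags. -/
structure Flags (O : Observable) (s : State) : Prop where
  var14 : s.var 14 = O.pauli.isX
  var15 : s.var 15 = O.pauli.isY
  var16 : s.var 16 = O.pauli.isZ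
  var17 : s.var 17 = O.isTwo
  var18 : s.var 18 = O.isOne
  var19 : s.var 19 = O.isGlob

/-- Sizes of the current block. -/
structure Sizes (n m : ℕ) (s : State) : Prop where
  var0 : s.var 0 = n
  var1 : s.var 1 = m
  var2 : s.var 2 = n - 2 * m + 1
  var3 : s.var 3 = n - 2 * m

/-- Tables of powers of the imaginary unit and of two. -/
structure Tables (n : ℕ) (s : State) : Prop where
  powI : ∀ k ≤ 4 * n, s.cpx 1 k = Complex.I ^ k
  powTwo : ∀ k ≤ 4 * n, s.cpx 2 k = 2 ^ k

def krawMat (N : ℕ) : Matrix (Fin (N + 1)) (Fin (N + 1)) ℂ := fun k q => kraw N k q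

theorem Flags.of_eq {O : Observable} {s s' : State} (h : Flags O s)
    (hv : ∀ x ∈ ({14, 15, 16, 17, 18, 19} : Finset ℕ), s'.var x = s.var x) : Flags O s' := by
  obtain ⟨h1, h2, h3, h4, h5, h6⟩ := h
  constructor <;> rw [hv _ (by decide)] <;> assumption

theorem Sizes.of_eq {n m : ℕ} {s s' : State} (h : Sizes n m s)
    (hv : ∀ x ∈ ({0, 1, 2, 3} : Finset ℕ), s'.var x = s.var x) : Sizes n m s' := by
  obtain ⟨h1, h2, h3, h4⟩ := h
  constructor <;> rw [hv _ (by decide)] <;> assumption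

theorem Tables.of_eq {n : ℕ} {s s' : State} (h : Tables n s)
    (hb : ∀ b ∈ ({1, 2} : Finset ℕ), s'.cpx b = s.cpx b) : Tables n s' :=
  ⟨by rw [hb 1 (by decide)]; exact h.powI, by rw [hb 2 (by decide)]; exact h.powTwo⟩

theorem _root_.CRAM.Holds.of_eq {b d : ℕ} {A : Matrix (Fin d) (Fin d) ℂ} {s s' : State}
    (h : Holds s b A) (hb : s'.cpx b = s.cpx b) : Holds s' b A := by
  intro k q
  rw [hb]
  exact h k q

theorem position_lt {d : ℕ} (k q : Fin d) : (k : ℕ) * d + q < d * d := by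
  have h1 : ((k : ℕ) + 1) * d ≤ d * d := Nat.mul_le_mul_right _ k.2
  have := q.2
  rw [Nat.succ_mul] at h1
  omega

/-! ### Expressions for matrix entries -/

/-- An entry of the Kravchuk matrix, from the previous ones. -/
def krawExp : CExp :=
  let z : NExp := .sub (.lit 1) (.var 11)
  let r : NExp := .sub (.lit 1) (.var 10)
  .add (.ofNat z) (.mul (.ofNat (.sub (.lit 1) z)) (.add
    (.mul (.ofNat r) (.div (.mul (.mem 3 (.sub (.var 13) (.lit 1)))
      (.ofNat (.sub (.var 3) (.sub (.var 11) (.lit 1))))) (.ofNat (.add (.var 11) z))))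
    (.mul (.ofNat (.sub (.lit 1) r)) (.sub (.sub (.mem 3 (.sub (.var 13) (.var 2)))
      (.mem 3 (.sub (.sub (.var 13) (.var 2)) (.lit 1)))) (.mem 3 (.sub (.var 13) (.lit 1)))))))

/-- The truncated differences `z` and `r` indicate column zero and row zero. All cases are evaluated
at once, so even discarded reads need legal addresses, and adding `z` keeps the denominator nonzero.
-/
theorem krawExp_spec {i : Input} {S : ℕ} {s : State} {N : ℕ} (h2 : s.var 2 = N + 1)
    (h3 : s.var 3 = N) (hS : (N + 1) * (N + 1) ≤ S) (k q : Fin (N + 1))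
    (h10 : s.var 10 = k) (h11 : s.var 11 = q) (h13 : s.var 13 = k * (N + 1) + q)
    (hc : ∀ k' q' : Fin (N + 1), k' < k ∨ k' = k ∧ q' < q →
      s.cpx 3 (k' * (N + 1) + q') = kraw N k' q') :
    krawExp.Safe i S s ∧ krawExp.eval i s = kraw N k q := by
  have hpos := position_lt k q
  constructor
  · simp only [krawExp, CExp.Safe, NExp.Safe, NExp.eval, h11, h13, h2, CExp.eval,
      true_and, and_true]
    refine ⟨⟨by omega, ?_⟩, ⟨by omega, by omega⟩, by omega⟩
    have : (q : ℕ) + (1 - q) ≠ 0 := by omega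
    exact_mod_cast this
  · simp only [krawExp, CExp.eval, NExp.eval, h10, h11, h13, h2, h3]
    obtain ⟨k, hk⟩ := k
    obtain ⟨q, hq⟩ := q
    simp only at h10 h11 h13 hpos ⊢
    rcases q with _ | q
    · simp [kraw_zero_right]
    · have hA : s.cpx 3 (k * (N + 1) + (q + 1) - 1) = kraw N k q := by
        have := hc ⟨k, hk⟩ ⟨q, by omega⟩ (Or.inr ⟨rfl, by simp⟩)
        rw [← this]
        rfl
      rw [hA]
      rcases k with _ | k
      · have : (1 : ℕ) - (q + 1) = 0 := by omega
        rw [kraw_zero_succ]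
        simp [this]
      · have hB : s.cpx 3 ((k + 1) * (N + 1) + (q + 1) - (N + 1)) = kraw N k (q + 1) := by
          have := hc ⟨k, by omega⟩ ⟨q + 1, hq⟩ (Or.inl (by simp))
          rw [← this]
          congr 1
          rw [Nat.succ_mul]
          simp only
          omega
        have hC : s.cpx 3 ((k + 1) * (N + 1) + (q + 1) - (N + 1) - 1) = kraw N k q := by
          have := hc ⟨k, by omega⟩ ⟨q, by omega⟩ (Or.inl (by simp))
          rw [← this]
          congr 1
          rw [Nat.succ_mul]
          simp only
          omega
        rw [hB, hC, kraw_succ_succ (by omega)]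
        have h1 : (1 : ℕ) - (q + 1) = 0 := by omega
        have h1' : (1 : ℕ) - (k + 1) = 0 := by omega
        simp [h1, h1']

/-- The matrix of eigenvectors of the current Pauli label. -/
def eigenExp : CExp :=
  .add (.add (.mul (.ofNat (.var 14)) (.mem 3 (.var 13)))
    (.mul (.ofNat (.var 15)) (.mul (.mem 1 (.var 10)) (.mem 3 (.var 13)))))
    (.mul (.ofNat (.var 16)) (.ofNat (.isEq (.var 10) (.var 11))))

def tripleCol : NExp := .add (.var 11) (.add (.var 11) (.var 11))

def eigenInvExp : CExp :=
  .add (.div (.add (.mul (.ofNat (.var 14)) (.mem 3 (.var 13)))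
    (.mul (.ofNat (.var 15)) (.mul (.mem 3 (.var 13)) (.mem 1 tripleCol)))) (.mem 2 (.var 3)))
    (.mul (.ofNat (.var 16)) (.ofNat (.isEq (.var 10) (.var 11))))

section entries

variable {i : Input} {S n m : ℕ} {s : State} {O : Observable}

theorem eigenExp_computes (ht : Tables n s) (hf : Flags O s)
    (hk : Holds s 3 (krawMat (n - 2 * m)))
    (hS : (n - 2 * m + 1) * (n - 2 * m + 1) ≤ S) (hS' : 4 * n < S) :
    Computes i S s eigenExp (eigenMat O.pauli (n - 2 * m)) := by
  intro k q h10 h11 h13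
  have hpos := position_lt k q
  have h3 := hk k q
  have hI := ht.powI k (by omega)
  constructor
  · simp only [eigenExp, CExp.Safe, NExp.Safe, NExp.eval, NExp.safe_isEq, h10, h13, true_and,
      and_true]
    omega
  · simp only [eigenExp, CExp.eval, NExp.eval, NExp.eval_isEq, h10, h11, h13, h3, hI, hf.var14,
      hf.var15, hf.var16, eigenMat, krawMat]
    cases O.pauli <;> simp [Pauli.isX, Pauli.isY, Pauli.isZ, eigenEntry]

theorem eigenInvExp_computes (hs : Sizes n m s) (ht : Tables n s) (hf : Flags O s)
    (hk : Holds s 3 (krawMat (n - 2 * m)))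
    (hS : (n - 2 * m + 1) * (n - 2 * m + 1) ≤ S) (hS' : 4 * n < S) :
    Computes i S s eigenInvExp (eigenInvMat O.pauli (n - 2 * m)) := by
  intro k q h10 h11 h13
  have hpos := position_lt k q
  have h3 := hk k q
  have hI := ht.powI (3 * q) (by omega)
  have h2 := ht.powTwo (n - 2 * m) (by omega)
  have hq3 : (q : ℕ) + (q + q) = 3 * q := by ring
  constructor
  · simp only [eigenInvExp, tripleCol, CExp.Safe, NExp.Safe, NExp.eval, NExp.safe_isEq, h11,
      h13, true_and, and_true, CExp.eval, hs.var3, h2]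
    refine ⟨⟨by omega, by omega, by omega⟩, by omega, pow_ne_zero _ two_ne_zero⟩
  · simp only [eigenInvExp, tripleCol, CExp.eval, NExp.eval, NExp.eval_isEq, h10, h11, h13, h3,
      hI, hf.var14, hf.var15, hf.var16, hs.var3, h2, eigenInvMat, krawMat, hq3]
    cases O.pauli <;> simp [Pauli.isX, Pauli.isY, Pauli.isZ, eigenInvEntry]

/-- `P 1 0` for the current Pauli label `P`. -/
def lowerExp : CExp := .add (.ofNat (.var 14)) (.mul .imag (.ofNat (.var 15)))

/-- `P 0 1` for the current Pauli label `P`. -/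
def raiseExp : CExp := .sub (.ofNat (.var 14)) (.mul .imag (.ofNat (.var 15)))

theorem eval_lowerExp (hf : Flags O s) : lowerExp.eval i s = O.pauli.mat 1 0 := by
  simp only [lowerExp, CExp.eval, NExp.eval, hf.var14, hf.var15]
  cases O.pauli <;> simp [Pauli.isX, Pauli.isY, Pauli.mat]

theorem eval_raiseExp (hf : Flags O s) : raiseExp.eval i s = O.pauli.mat 0 1 := by
  simp only [raiseExp, CExp.eval, NExp.eval, hf.var14, hf.var15]
  cases O.pauli <;> simp [Pauli.isX, Pauli.isY, Pauli.mat]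

/-- `(N - k) * P 0 0 + k * P 1 1` for the current Pauli label `P` and row `k`. -/
def diagExp : CExp :=
  .mul (.ofNat (.var 16)) (.sub (.ofNat (.var 3)) (.ofNat (.add (.var 10) (.var 10))))

theorem eval_diagExp (hf : Flags O s) (hs : Sizes n m s) {k : ℕ} (h10 : s.var 10 = k) :
    diagExp.eval i s = (((n - 2 * m : ℕ) : ℂ) - k) * O.pauli.mat 0 0 + k * O.pauli.mat 1 1 := by
  simp only [diagExp, CExp.eval, NExp.eval, hf.var16, hs.var3, h10]
  cases O.pauli <;> simp [Pauli.isZ, Pauli.mat]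
  ring

def collectiveExp : CExp :=
  .add (.add (.mul (.ofNat (.isEq (.var 10) (.var 11))) diagExp)
    (.mul (.ofNat (.isEq (.add (.var 11) (.lit 1)) (.var 10))) (.mul (.ofNat (.var 10)) lowerExp)))
    (.mul (.ofNat (.isEq (.add (.var 10) (.lit 1)) (.var 11)))
      (.mul (.sub (.ofNat (.var 3)) (.ofNat (.var 10))) raiseExp))

theorem collectiveExp_computes (hs : Sizes n m s) (hf : Flags O s) :
    Computes i S s collectiveExp (collective O.pauli (n - 2 * m)) := by
  intro k q h10 h11 h13
  constructor
  · simp [collectiveExp, diagExp, lowerExp, raiseExp, CExp.Safe, NExp.Safe]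
  · simp only [collectiveExp, CExp.eval, NExp.eval, NExp.eval_isEq, h10, h11,
      eval_lowerExp hf, eval_raiseExp hf, eval_diagExp hf hs h10, hs.var3, collective,
      collectiveEntry]
    push_cast
    simp only [ite_mul, one_mul, zero_mul]

def sizeExp : CExp := .ofNat (.var 0)

def pairNormExp : CExp := .mul sizeExp (.sub sizeExp (.ofNat (.lit 1)))

theorem eval_pairNormExp (hs : Sizes n m s) :
    pairNormExp.eval i s = (n : ℂ) * ((n : ℂ) - 1) := by
  simp [pairNormExp, sizeExp, CExp.eval, NExp.eval, hs.var0]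

theorem pairNorm_ne_zero (hn : 2 ≤ n) : (n : ℂ) * ((n : ℂ) - 1) ≠ 0 := by
  have h1 : (n : ℂ) ≠ 0 := by exact_mod_cast (by omega : n ≠ 0)
  have h2 : (n : ℂ) ≠ 1 := by exact_mod_cast (by omega : n ≠ 1)
  exact mul_ne_zero h1 (sub_ne_zero.2 h2)

/-- The entry of the square of the collective operator stored in bank 4. -/
def squareExp : CExp :=
  .add (.add (.mul diagExp (.mem 4 (.var 13)))
    (.mul (.mul (.ofNat (.var 10)) lowerExp) (.mem 4 (.sub (.var 13) (.var 2)))))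
    (.mul (.mul (.sub (.ofNat (.var 3)) (.ofNat (.var 10))) raiseExp)
      (.mem 4 (.add (.var 13) (.var 2))))

/-- Tridiagonality makes each entry of the square a sum of three terms. The extra `d` cells in the
bound cover the read one row past the end. -/
theorem squareExp_computes (hs : Sizes n m s) (hf : Flags O s)
    (hc : Holds s 4 (collective O.pauli (n - 2 * m)))
    (hS : (n - 2 * m + 1) * (n - 2 * m + 1) + (n - 2 * m + 1) ≤ S) :
    Computes i S s squareExp (collective O.pauli (n - 2 * m) * collective O.pauli (n - 2 * m)) := by
  intro k q h10 h11 h13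
  have hpos := position_lt k q
  have hk : (k : ℕ) ≤ n - 2 * m := Nat.lt_succ_iff.1 k.2
  constructor
  · simp only [squareExp, diagExp, lowerExp, raiseExp, CExp.Safe, NExp.Safe, NExp.eval, h13,
      hs.var2, true_and, and_true]
    omega
  · rw [Matrix.mul_apply]
    have h := sum_fin_collectiveEntry_mul O.pauli hk
      (fun r => collectiveEntry O.pauli (n - 2 * m) r q)
    refine Eq.trans ?_ h.symm
    simp only [squareExp, CExp.eval, NExp.eval, h10, h13, eval_lowerExp hf, eval_raiseExp hf,
      eval_diagExp hf hs h10, hs.var2, hs.var3]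
    congr 1
    · congr 1
      · rw [hc k q]
        rfl
      -- In row zero the cell read is meaningless, but it is multiplied by `k = 0`.
      · rcases Nat.eq_zero_or_pos (k : ℕ) with h0 | h0
        · rw [h0]
          simp
        · have := hc ⟨k - 1, by omega⟩ q
          rw [show (k : ℕ) * (n - 2 * m + 1) + q - (n - 2 * m + 1) =
            (k - 1) * (n - 2 * m + 1) + q by
              obtain ⟨j, hj⟩ : ∃ j, (k : ℕ) = j + 1 := ⟨k - 1, by omega⟩
              rw [hj, Nat.succ_mul, Nat.add_sub_cancel]
              omega, this]
          rfl
    -- In the last row the cell read lies outside the array, and is multiplied by `N - k = 0`.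
    · rcases Nat.lt_or_ge (k : ℕ) (n - 2 * m) with h0 | h0
      · have := hc ⟨k + 1, by omega⟩ q
        rw [show (k : ℕ) * (n - 2 * m + 1) + q + (n - 2 * m + 1) =
          (k + 1) * (n - 2 * m + 1) + q by ring, this]
        rfl
      · rw [show (k : ℕ) = n - 2 * m by omega]
        simp

def globExp : CExp :=
  .add (.mul (.ofNat (.isEq (.add (.var 10) (.var 11)) (.var 3)))
    (.add (.mul (.ofNat (.var 14)) (.mem 1 (.add (.var 1) (.var 1))))
      (.mul (.ofNat (.var 15))
        (.mem 1 (.add (.add (.add (.var 1) (.var 1)) (.var 10)) tripleCol)))))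
    (.mul (.ofNat (.isEq (.var 10) (.var 11)))
      (.mul (.ofNat (.var 16))
        (.mem 1 (.add (.add (.var 1) (.var 1)) (.add (.var 11) (.var 11))))))

/-- The largest exponent of `i` is at most `2m + 4(n - 2m) ≤ 4n`, the length of the tables. -/
theorem globExp_computes (hs : Sizes n m s) (ht : Tables n s) (hf : Flags O s) (hm : 2 * m ≤ n)
    (hS : 4 * n < S) : Computes i S s globExp (globBlock O.pauli n m) := by
  intro k q h10 h11 h13
  have h1 := ht.powI (2 * m) (by omega)
  have h2 := ht.powI (2 * m + k + 3 * q) (by omega)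
  have h3 := ht.powI (2 * m + 2 * q) (by omega)
  have e1 : m + m = 2 * m := by ring
  have e2 : 2 * m + (k : ℕ) + (q + (q + q)) = 2 * m + k + 3 * q := by ring
  have e3 : 2 * m + ((q : ℕ) + q) = 2 * m + 2 * q := by ring
  constructor
  · simp only [globExp, tripleCol, CExp.Safe, NExp.Safe, NExp.eval, NExp.safe_isEq, h10, h11,
      hs.var1, true_and, and_true]
    omega
  · simp only [globExp, tripleCol, CExp.eval, NExp.eval, NExp.eval_isEq, h10, h11, hs.var1,
      hs.var3, h1, h2, h3, hf.var14, hf.var15, hf.var16, globBlock, e1, e2, e3]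
    cases O.pauli <;> simp [Pauli.isX, Pauli.isY, Pauli.isZ, globEntry]

def obsExp : CExp :=
  .add (.add (.mul (.ofNat (.var 18)) (.div (.mem 4 (.var 13)) sizeExp))
    (.mul (.ofNat (.var 17)) (.div (.sub squareExp
      (.mul sizeExp (.ofNat (.isEq (.var 10) (.var 11))))) pairNormExp)))
    (.mul (.ofNat (.var 19)) globExp)

theorem obsExp_computes (hs : Sizes n m s) (ht : Tables n s) (hf : Flags O s) (hm : 2 * m ≤ n)
    (hn : 2 ≤ n) (hc : Holds s 4 (collective O.pauli (n - 2 * m)))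
    (hS : (n - 2 * m + 1) * (n - 2 * m + 1) + (n - 2 * m + 1) ≤ S) (hS' : 4 * n < S) :
    Computes i S s obsExp (O.block n m) := by
  intro k q h10 h11 h13
  have hpos := position_lt k q
  have hsq := squareExp_computes (i := i) hs hf hc hS k q h10 h11 h13
  have hgl := globExp_computes (i := i) hs ht hf hm hS' k q h10 h11 h13
  have hn0 : (n : ℂ) ≠ 0 := by exact_mod_cast (by omega : n ≠ 0)
  constructor
  · refine ⟨⟨⟨trivial, ⟨trivial, ?_⟩, trivial, ?_⟩, trivial, ⟨hsq.1, trivial, ?_⟩, ?_, ?_⟩,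
      trivial, hgl.1⟩
    · rw [NExp.eval, h13]; omega
    · simpa [sizeExp, CExp.eval, NExp.eval, hs.var0] using hn0
    · simp [CExp.Safe, NExp.Safe]
    · simp [pairNormExp, sizeExp, CExp.Safe, NExp.Safe]
    · rw [eval_pairNormExp hs]
      exact pairNorm_ne_zero hn
  · simp only [obsExp, CExp.eval, NExp.eval, NExp.eval_isEq, hsq.2, hgl.2, eval_pairNormExp hs,
      h10, h11, h13, hc k q, sizeExp, hs.var0, hf.var17, hf.var18, hf.var19]
    rcases O with (P | P) | P
    · simp [Observable.isOne, Observable.isTwo, Observable.isGlob, Observable.block,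
        Generator.block, Observable.pauli, Generator.pauli, div_eq_inv_mul]
    · simp [Observable.isOne, Observable.isTwo, Observable.isGlob, Observable.block,
        Generator.block, Observable.pauli, Generator.pauli, div_eq_inv_mul, Matrix.one_apply,
        Fin.ext_iff]
    · simp [Observable.isOne, Observable.isTwo, Observable.isGlob, Observable.block,
        Observable.pauli]

/-- The eigenvalue of the current generator for the weight index `x`. -/
def eigExp (x : NExp) : CExp :=
  let w : CExp := .sub (.ofNat (.var 3)) (.ofNat (.add x x))
  .add (.mul (.ofNat (.var 18)) (.div w sizeExp))
    (.mul (.ofNat (.var 17)) (.div (.sub (.mul w w) sizeExp) pairNormExp))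

theorem eigExp_spec {G : Generator} {x : NExp} (hs : Sizes n m s) (hf : Flags (.gen G) s)
    (hn : 2 ≤ n) (hx : x.Safe i S s) (k : Fin (n - 2 * m + 1)) (hxk : x.eval i s = k) :
    (eigExp x).Safe i S s ∧ (eigExp x).eval i s = G.eig n m k := by
  have hn0 : (n : ℂ) ≠ 0 := by exact_mod_cast (by omega : n ≠ 0)
  constructor
  · simp only [eigExp, CExp.Safe, NExp.Safe, hx, true_and, and_true, eval_pairNormExp hs]
    refine ⟨⟨trivial, ?_⟩, trivial, ?_, pairNorm_ne_zero hn⟩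
    · simpa [sizeExp, CExp.eval, NExp.eval, hs.var0] using hn0
    · simp [pairNormExp, sizeExp, CExp.Safe, NExp.Safe]
  · simp only [eigExp, CExp.eval, NExp.eval, hxk, eval_pairNormExp hs, sizeExp, hs.var0, hs.var3,
      hf.var17, hf.var18]
    cases G <;> simp [Observable.isOne, Observable.isTwo, Generator.eig, weight, two_mul]

/-- The entry in bank 34, multiplied with the phases of the current gate. -/
def phaseExp : CExp :=
  .mul (.mul (.mem 34 (.var 13)) (.exp (.mul (.mul .imag (.inp (.var 6))) (eigExp (.var 10)))))
    (.exp (.mul (.mul .imag (.sub (.ofNat (.lit 0)) (.inp (.var 6)))) (eigExp (.var 11))))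

theorem phaseExp_computes {g : Gate} {A : Matrix (Fin (n - 2 * m + 1)) (Fin (n - 2 * m + 1)) ℂ}
    (hs : Sizes n m s) (hf : Flags (.gen g.gen) s) (hn : 2 ≤ n) (hA : Holds s 34 A)
    (hθ : i.cpx (s.var 6) = g.angle) (hS : (n - 2 * m + 1) * (n - 2 * m + 1) ≤ S) :
    Computes i S s phaseExp
      (Matrix.diagonal (fun k => Complex.exp (Complex.I * g.angle * g.gen.eig n m k)) * A *
        Matrix.diagonal (fun k => Complex.exp (Complex.I * (-g.angle) * g.gen.eig n m k))) := by
  intro k q h10 h11 h13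
  have hpos := position_lt k q
  obtain ⟨hk1, hk2⟩ := eigExp_spec (i := i) (S := S) (x := .var 10) hs hf hn trivial k h10
  obtain ⟨hq1, hq2⟩ := eigExp_spec (i := i) (S := S) (x := .var 11) hs hf hn trivial q h11
  constructor
  · simp only [phaseExp, CExp.Safe, NExp.Safe, NExp.eval, h13, hk1, hq1, true_and, and_true]
    omega
  · rw [Matrix.mul_diagonal, Matrix.diagonal_mul]
    simp only [phaseExp, CExp.eval, NExp.eval, h13, hk2, hq2, hA k q, hθ]
    rw [Nat.cast_zero, zero_sub]
    ring

/-- The normalized entry of the block. -/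
def outExp : CExp :=
  .div (.mul (.mem 5 (.var 13)) (.sqrt (.mem 3 (.var 10)))) (.sqrt (.mem 3 (.var 11)))

/-- Row zero of the Kravchuk table consists of the binomial coefficients, so it also supplies the
squared norms. -/
theorem outExp_computes {A : Matrix (Fin (n - 2 * m + 1)) (Fin (n - 2 * m + 1)) ℂ}
    (hk : Holds s 3 (krawMat (n - 2 * m))) (hA : Holds s 5 A)
    (hS : (n - 2 * m + 1) * (n - 2 * m + 1) ≤ S) :
    Computes i S s outExp (fun k q => A k q * schurNorm n m k / schurNorm n m q) := by
  intro k q h10 h11 h13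
  have hpos := position_lt k q
  have hd : n - 2 * m + 1 ≤ (n - 2 * m + 1) * (n - 2 * m + 1) := Nat.le_mul_self _
  have hrow : ∀ q : Fin (n - 2 * m + 1), s.cpx 3 q = ((n - 2 * m).choose (q : ℕ) : ℂ) := by
    intro q
    have := hk 0 q
    simpa [krawMat, kraw_zero_left] using this
  have hnorm : ∀ q : Fin (n - 2 * m + 1), ((Real.sqrt (s.cpx 3 q).re : ℝ) : ℂ) =
      schurNorm n m q := by
    intro q
    rw [hrow, Complex.natCast_re]
    rfl
  have hk2 := k.2
  have hq2 := q.2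
  constructor
  · simp only [outExp, CExp.Safe, NExp.Safe, NExp.eval, CExp.eval, h10, h11, h13, true_and,
      hrow]
    refine ⟨⟨by omega, by omega, _, Nat.cast_nonneg _, (Complex.ofReal_natCast _).symm⟩,
      ⟨by omega, _, Nat.cast_nonneg _, (Complex.ofReal_natCast _).symm⟩, schurNorm_ne_zero n m q⟩
  · simp only [outExp, CExp.eval, NExp.eval, h10, h11, h13, hA k q, hnorm]

end entries

end SnCircuit

/-! ### Safe calls to the given multiplication program. -/

namespace CRAM

/-! ### Frames below the names of a shifted program -/

/-- Among the names below `K`, only the variables in `V` and the complex banks in `B` may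
differ. -/
def LowFrame (K : ℕ) (V B : Finset ℕ) (s s' : State) : Prop :=
  (∀ x < K, x ∉ V → s'.var x = s.var x) ∧ ∀ b < K, b ∉ B → s'.cpx b = s.cpx b

namespace LowFrame

variable {K : ℕ} {V B V' B' : Finset ℕ} {s s' s'' : State}

theorem trans (h : LowFrame K V B s s') (h' : LowFrame K V B s' s'') : LowFrame K V B s s'' :=
  ⟨fun x hx hV => (h'.1 x hx hV).trans (h.1 x hx hV),
    fun b hb hB => (h'.2 b hb hB).trans (h.2 b hb hB)⟩

theorem mono (h : LowFrame K V B s s') (hV : V ⊆ V') (hB : B ⊆ B') : LowFrame K V' B' s s' :=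
  ⟨fun x hx hx' => h.1 x hx fun h' => hx' (hV h'), fun b hb hb' => h.2 b hb fun h' => hb' (hB h')⟩

end LowFrame

theorem Frame.low {K : ℕ} {V B V' B' : Finset ℕ} {s s' : State} (h : Frame V B s s')
    (hV : ∀ x ∈ V, x < K → x ∈ V') (hB : ∀ b ∈ B, b < K → b ∈ B') : LowFrame K V' B' s s' :=
  ⟨fun x hx hx' => h.1 x fun h' => hx' (hV x h' hx),
    fun b hb hb' => h.2 b fun h' => hb' (hB b h' hb)⟩

theorem SameBelow.low {K : ℕ} {V B : Finset ℕ} {s s' : State} (h : SameBelow K s s') :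
    LowFrame K V B s s' :=
  ⟨fun x hx _ => h.1 x hx, fun b hb _ => h.2 b hb⟩

/-! ### Calling the matrix multiplication program -/

/-- The program `P` multiplies matrices of size at most `n` within time `τ`. -/
def Multiplies (i : Input) (S τ n : ℕ) (P : Prog) : Prop :=
  ∀ d, 1 ≤ d → d ≤ n → ∀ (A B : Matrix (Fin d) (Fin d) ℂ) (s : State), s.var 0 = d →
    Holds s 0 A → Holds s 1 B → Runs i S P s τ fun s' => Holds s' 2 (A * B)

theorem Multiplies.runs_shift {i : Input} {S τ n : ℕ} {P : Prog} (h : Multiplies i S τ n P)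
    (K : ℕ) {d : ℕ} (hd1 : 1 ≤ d) (hd : d ≤ n) {A B : Matrix (Fin d) (Fin d) ℂ} {s : State}
    (hs : s.var K = d) (hA : Holds s K A) (hB : Holds s (K + 1) B) :
    Runs i S (P.shift K) s τ fun s' => SameBelow K s s' ∧ Holds s' (K + 2) (A * B) := by
  obtain ⟨s', t, hx, ht, hr⟩ := h d hd1 hd A B (s.view K) (by simpa [State.view] using hs)
    (by simpa [State.view, Holds] using hA)
    (by simpa [State.view, Holds, add_comm] using hB)
  obtain ⟨r', hx', hv, hb⟩ := hx.shift K s rfl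
  refine ⟨r', t, hx', ht, hb, ?_⟩
  subst hv
  simpa [State.view, Holds, add_comm] using hr

/-- Fills a square array starting at address zero. -/
def Prog.fillMat (b : ℕ) (e : CExp) : Prog := .fill b (.lit 0) (.lit 0) e

theorem runs_fillMat {i : Input} {S : ℕ} {s : State} {b : ℕ} {e : CExp} {d : ℕ}
    (A : Matrix (Fin d) (Fin d) ℂ) (hd : s.var 2 = d) (hd1 : 1 ≤ d) (hS : d * d ≤ S)
    (he : ∀ s₁, Frame fillVars {b} s s₁ → Computes i S s₁ e A) :
    Runs i S (.fillMat b e) s ((e.cost + 62) * d ^ 2) fun s' =>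
      Frame fillVars {b} s s' ∧ Holds s' b A := by
  refine (runs_fill (a₀ := .lit 0) (pad := .lit 0) A hd hd1 (A := 0) (p := 0) trivial rfl (fun _ _ => ⟨trivial, rfl⟩)
    (by simpa using hS) fun k q s₁ hF h10 h11 h13 _ => he s₁ hF k q h10 h11 h13).weaken ?_ ?_
  · simp only [NExp.cost]
    exact Nat.mul_le_mul_right _ (by omega)
  · rintro s' ⟨hF, hc, -⟩
    exact ⟨hF, fun k q => by simpa using hc k q⟩

/-- Multiplies the matrices given by two expressions; the result is in bank 34. -/
def Prog.mulWith (P : Prog) (eA eB : CExp) : Prog :=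
  .seq (.fillMat 32 eA) <| .seq (.fillMat 33 eB) <| .seq (.setVar 32 (.var 2)) (P.shift 32)

/-- The factors may be read from bank 34, the previous product: it stays intact until both factors
have been copied. Nothing is claimed afterwards about names from 32 on, except the product itself.
-/
theorem runs_mulWith {i : Input} {S τ n : ℕ} {P : Prog} (hP : Multiplies i S τ n P) {s : State}
    {eA eB : CExp} {d : ℕ} {A B : Matrix (Fin d) (Fin d) ℂ} (hd : s.var 2 = d) (hd1 : 1 ≤ d)
    (hdn : d ≤ n) (hS : d * d ≤ S) (hcA : eA.cost ≤ 400) (hcB : eB.cost ≤ 400)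
    (hA : ∀ s₁, Frame fillVars {32, 33} s s₁ → Computes i S s₁ eA A)
    (hB : ∀ s₁, Frame fillVars {32, 33} s s₁ → Computes i S s₁ eB B) :
    Runs i S (P.mulWith eA eB) s (1000 * n ^ 2 + τ) fun s' =>
      LowFrame 32 fillVars ∅ s s' ∧ Holds s' 34 (A * B) := by
  have hdn2 : d ^ 2 ≤ n ^ 2 := Nat.pow_le_pow_left hdn 2
  have h1 : 1 ≤ d ^ 2 := Nat.one_le_pow _ _ hd1
  have hmain : Runs i S (P.mulWith eA eB) s (462 * d ^ 2 + (462 * d ^ 2 + (2 + τ))) fun s' =>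
      LowFrame 32 fillVars ∅ s s' ∧ Holds s' 34 (A * B) := by
    refine Runs.seq _ ((runs_fillMat A hd hd1 hS fun s₁ h₁ =>
      hA s₁ (h₁.mono (by decide) (by decide))).weaken (Nat.mul_le_mul_right _ (by omega))
        fun _ h => h) ?_
    rintro s₁ ⟨hF₁, hA₁⟩
    have hF₁' : Frame fillVars {32, 33} s s₁ := hF₁.mono (by decide) (by decide)
    refine Runs.seq _ ((runs_fillMat B (by rw [hF₁.1 2 (by decide), hd]) hd1 hS fun s₂ h₂ =>
      hB s₂ (hF₁'.trans (h₂.mono (by decide) (by decide)))).weaken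
        (Nat.mul_le_mul_right _ (by omega)) fun _ h => h) ?_
    rintro s₂ ⟨hF₂, hB₂⟩
    have hF₂' : Frame fillVars {32, 33} s s₂ := hF₁'.trans (hF₂.mono (by decide) (by decide))
    refine Runs.seq _ (Runs.setVar trivial (by simp [NExp.cost]) rfl) ?_
    rintro s₃ rfl
    have hF₃ : LowFrame 32 fillVars ∅ s (s₂.setVar 32 ((NExp.var 2).eval i s₂)) := by
      refine (hF₂'.low (by decide) (by decide)).trans ⟨fun x hx _ => ?_, fun _ _ _ => rfl⟩
      simp [show x ≠ 32 by omega]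
    refine (hP.runs_shift 32 hd1 hdn (A := A) (B := B) ?_ ?_ ?_).weaken le_rfl ?_
    · simp [NExp.eval, hF₂'.1 2 (by decide), hd]
    · exact hA₁.of_eq (hF₂.2 32 (by decide))
    · exact hB₂
    · rintro s' ⟨hb, hr⟩
      exact ⟨hF₃.trans hb.low, hr⟩
  refine hmain.weaken ?_ fun _ h => h
  omega

end CRAM

/-! ### Decoding labels and evolving one block through the gates. -/

namespace SnCircuit

open CRAM

/-! ### Decoding labels -/

def timesThree (e : NExp) : NExp := .add e (.add e e)

/-- Decodes the label given by an expression into flags. -/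
def decodeProg (e : NExp) : Prog :=
  .seq (.setVar 7 e) <|
  .seq (.setVar 19 (.sub (.lit 1) (.sub (.lit 6) (.var 7)))) <|
  .seq (.setVar 7 (.sub (.var 7) (timesThree (.add (.var 19) (.var 19))))) <|
  .seq (.setVar 17 (.sub (.lit 1) (.sub (.lit 3) (.var 7)))) <|
  .seq (.setVar 7 (.sub (.var 7) (timesThree (.var 17)))) <|
  .seq (.setVar 14 (.sub (.lit 1) (.var 7))) <|
  .seq (.setVar 16 (.sub (.var 7) (.lit 1))) <|
  .seq (.setVar 15 (.sub (.lit 1) (.add (.var 14) (.var 16)))) <|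
  .setVar 18 (.sub (.lit 1) (.add (.var 17) (.var 19)))

/-- The variables used for decoding. -/
abbrev decodeVars : Finset ℕ := {7, 14, 15, 16, 17, 18, 19}

theorem runs_decodeProg {i : Input} {S : ℕ} {s : State} {e : NExp} (O : Observable)
    (he : e.Safe i S s) (hO : e.eval i s = O.code) :
    Runs i S (decodeProg e) s (e.cost + 100) fun s' => Frame decodeVars ∅ s s' ∧ Flags O s' := by
  have hmain : Runs i S (decodeProg e) s
      ((e.cost + 1) + (10 + (20 + (10 + (20 + (5 + (5 + (10 + 10)))))))) fun s' =>
        Frame decodeVars ∅ s s' ∧ Flags O s' := by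
    refine Runs.seq _ (Runs.setVar he le_rfl rfl) ?_
    rintro _ rfl
    refine Runs.seq _ (Runs.setVar (by simp [NExp.Safe]) (by simp [NExp.cost]) rfl) ?_
    rintro _ rfl
    refine Runs.seq _ (Runs.setVar (by simp [NExp.Safe, timesThree])
      (by simp [NExp.cost, timesThree]) rfl) ?_
    rintro _ rfl
    refine Runs.seq _ (Runs.setVar (by simp [NExp.Safe]) (by simp [NExp.cost]) rfl) ?_
    rintro _ rfl
    refine Runs.seq _ (Runs.setVar (by simp [NExp.Safe, timesThree])
      (by simp [NExp.cost, timesThree]) rfl) ?_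
    rintro _ rfl
    refine Runs.seq _ (Runs.setVar (by simp [NExp.Safe]) (by simp [NExp.cost]) rfl) ?_
    rintro _ rfl
    refine Runs.seq _ (Runs.setVar (by simp [NExp.Safe]) (by simp [NExp.cost]) rfl) ?_
    rintro _ rfl
    refine Runs.seq _ (Runs.setVar (by simp [NExp.Safe]) (by simp [NExp.cost]) rfl) ?_
    rintro _ rfl
    refine Runs.setVar (by simp [NExp.Safe]) (by simp [NExp.cost]) ⟨?_, ?_⟩
    · refine Frame.setVar (Frame.setVar (Frame.setVar (Frame.setVar (Frame.setVar (Frame.setVar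
        (Frame.setVar (Frame.setVar (Frame.setVar (Frame.refl s) ?_ _) ?_ _) ?_ _) ?_ _) ?_ _)
          ?_ _) ?_ _) ?_ _) ?_ _ <;> decide
    -- Codes are `3 * kind + Pauli`; `1 - (c - x)` with truncated subtraction tests `c ≤ x`. The
    -- nine labels are checked individually.
    · rcases O with (P | P) | P <;> cases P <;> constructor <;>
        simp [NExp.eval, timesThree, hO, Observable.code, Generator.code, Pauli.code,
          Observable.pauli, Generator.pauli, Pauli.isX, Pauli.isY, Pauli.isZ, Observable.isOne,
          Observable.isTwo, Observable.isGlob]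
  refine hmain.weaken (by omega) fun _ h => h

/-! ### One gate -/

/-- Everything the evaluation of matrix entries depends on. -/
structure Env (n m : ℕ) (O : Observable) (s : State) : Prop where
  sizes : Sizes n m s
  tables : Tables n s
  flags : Flags O s
  kraw : Holds s 3 (krawMat (n - 2 * m))

theorem Env.of_low {n m : ℕ} {O : Observable} {s s' : State} (h : Env n m O s)
    (hF : LowFrame 32 fillVars {4, 5} s s') : Env n m O s' where
  sizes := h.sizes.of_eq fun x hx => by
    refine hF.1 x ?_ ?_ <;> revert x <;> decide
  tables := h.tables.of_eq fun x hx => by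
    refine hF.2 x ?_ ?_ <;> revert x <;> decide
  flags := h.flags.of_eq fun x hx => by
    refine hF.1 x ?_ ?_ <;> revert x <;> decide
  kraw := h.kraw.of_eq (hF.2 3 (by decide) (by decide))

/-- Replaces the block in bank 5 by its evolution under the current gate. -/
def gateProg (P : Prog) : Prog :=
  .seq (P.mulWith eigenInvExp (.mem 5 (.var 13))) <|
  .seq (P.mulWith (.mem 34 (.var 13)) eigenExp) <|
  .seq (P.mulWith eigenExp phaseExp) <|
  .seq (P.mulWith (.mem 34 (.var 13)) eigenInvExp) <|
  .fillMat 5 (.mem 34 (.var 13))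

/-- The block is evaluated as `V (D (W A V) D') W`: the two diagonal factors are applied entrywise
while a factor is copied, so four multiplications suffice. -/
theorem runs_gateProg {i : Input} {S τ n m : ℕ} {P : Prog} (hP : Multiplies i S τ (n + 1) P)
    {s : State} {g : Gate} {A : Matrix (Fin (n - 2 * m + 1)) (Fin (n - 2 * m + 1)) ℂ}
    (hn : 2 ≤ n) (hS : (n + 1) ^ 2 ≤ S) (hS' : 4 * n < S) (hE : Env n m (.gen g.gen) s)
    (hA : Holds s 5 A) (hθ : i.cpx (s.var 6) = g.angle) :
    Runs i S (gateProg P) s (5000 * (n + 1) ^ 2 + 4 * τ) fun s' =>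
      LowFrame 32 fillVars {5} s s' ∧ Holds s' 5 (Gate.evolveBlock n m A g) := by
  have hd1 : 1 ≤ n - 2 * m + 1 := by omega
  have hdn : n - 2 * m + 1 ≤ n + 1 := by omega
  have hdS : (n - 2 * m + 1) * (n - 2 * m + 1) ≤ S := le_trans (Nat.mul_le_mul hdn hdn) (by rwa [← pow_two])
  have hdn2 : (n - 2 * m + 1) ^ 2 ≤ (n + 1) ^ 2 := Nat.pow_le_pow_left hdn 2
  set V := eigenMat g.gen.pauli (n - 2 * m) with hV
  set W := eigenInvMat g.gen.pauli (n - 2 * m) with hW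
  have hEF : ∀ {s₀ s₁}, Env n m (.gen g.gen) s₀ → Frame fillVars {32, 33} s₀ s₁ →
      Env n m (.gen g.gen) s₁ := fun h hF => h.of_low (hF.low (by decide) (by decide))
  have hcV : ∀ {s₀}, Env n m (.gen g.gen) s₀ → ∀ s₁, Frame fillVars {32, 33} s₀ s₁ →
      Computes i S s₁ eigenExp V := fun h s₁ hF => by
    have h' := hEF h hF
    exact eigenExp_computes h'.tables h'.flags h'.kraw hdS hS'
  have hcW : ∀ {s₀}, Env n m (.gen g.gen) s₀ → ∀ s₁, Frame fillVars {32, 33} s₀ s₁ →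
      Computes i S s₁ eigenInvExp W := fun h s₁ hF => by
    have h' := hEF h hF
    exact eigenInvExp_computes h'.sizes h'.tables h'.flags h'.kraw hdS hS'
  have hmem : ∀ {b : ℕ} {M : Matrix (Fin (n - 2 * m + 1)) (Fin (n - 2 * m + 1)) ℂ} {s₀}, b ∉ ({32, 33} : Finset ℕ) →
      Holds s₀ b M → ∀ s₁, Frame fillVars {32, 33} s₀ s₁ →
      Computes i S s₁ (.mem b (.var 13)) M := fun hb h s₁ hF =>
    computes_mem (h.of_eq (hF.2 _ hb)) hdS
  have hmain : Runs i S (gateProg P) s ((1000 * (n + 1) ^ 2 + τ) + ((1000 * (n + 1) ^ 2 + τ) +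
      ((1000 * (n + 1) ^ 2 + τ) + ((1000 * (n + 1) ^ 2 + τ) + 65 * (n - 2 * m + 1) ^ 2)))) fun s' =>
      LowFrame 32 fillVars {5} s s' ∧ Holds s' 5 (Gate.evolveBlock n m A g) := by
    refine Runs.seq _ (runs_mulWith hP hE.sizes.var2 hd1 hdn hdS (by decide) (by decide)
      (hcW hE) (hmem (by decide) hA)) ?_
    rintro s₁ ⟨hF₁, hA₁⟩
    have hE₁ := hE.of_low (hF₁.mono (by decide) (by decide))
    refine Runs.seq _ (runs_mulWith hP hE₁.sizes.var2 hd1 hdn hdS (by decide) (by decide)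
      (hmem (by decide) hA₁) (hcV hE₁)) ?_
    rintro s₂ ⟨hF₂, hA₂⟩
    have hE₂ := hE₁.of_low (hF₂.mono (by decide) (by decide))
    have h6 : s₂.var 6 = s.var 6 := by
      rw [hF₂.1 6 (by decide) (by decide), hF₁.1 6 (by decide) (by decide)]
    refine Runs.seq _ (runs_mulWith hP hE₂.sizes.var2 hd1 hdn hdS (by decide) (by decide)
      (hcV hE₂) (fun s' hF' => phaseExp_computes (hEF hE₂ hF').sizes (hEF hE₂ hF').flags hn
        (hA₂.of_eq (hF'.2 34 (by decide))) (by rw [hF'.1 6 (by decide), h6, hθ]) hdS)) ?_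
    rintro s₃ ⟨hF₃, hA₃⟩
    have hE₃ := hE₂.of_low (hF₃.mono (by decide) (by decide))
    refine Runs.seq _ (runs_mulWith hP hE₃.sizes.var2 hd1 hdn hdS (by decide) (by decide)
      (hmem (by decide) hA₃) (hcW hE₃)) ?_
    rintro s₄ ⟨hF₄, hA₄⟩
    have hE₄ := hE₃.of_low (hF₄.mono (by decide) (by decide))
    refine (runs_fillMat _ hE₄.sizes.var2 hd1 hdS fun s' hF' =>
      computes_mem (hA₄.of_eq (hF'.2 34 (by decide))) hdS).weaken (Nat.mul_le_mul_right _ (by decide)) ?_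
    rintro s₅ ⟨hF₅, hA₅⟩
    refine ⟨((((hF₁.trans hF₂).trans hF₃).trans hF₄).mono (by decide) (by decide)).trans
      (hF₅.low (by decide) (by decide)), ?_⟩
    convert hA₅ using 1
    simp only [Gate.evolveBlock, Generator.expBlock, Matrix.mul_assoc, hV, hW]
  refine hmain.weaken ?_ fun _ h => h
  omega

/-! ### All gates -/

theorem taskInput_nat_zero (n : ℕ) (gates : List Gate) (O : Observable) :
    (taskInput n gates O).nat 0 = n := rfl

theorem taskInput_nat_one (n : ℕ) (gates : List Gate) (O : Observable) :
    (taskInput n gates O).nat 1 = gates.length := rfl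

theorem taskInput_nat_two (n : ℕ) (gates : List Gate) (O : Observable) :
    (taskInput n gates O).nat 2 = O.code := rfl

theorem taskInput_nat_gate (n : ℕ) (gates : List Gate) (O : Observable) (l : ℕ)
    (hl : l < gates.length) : (taskInput n gates O).nat (3 + l) = gates[l].gen.code := by
  rw [add_comm]
  simp [taskInput, hl]

theorem taskInput_cpx (n : ℕ) (gates : List Gate) (O : Observable) (l : ℕ)
    (hl : l < gates.length) : (taskInput n gates O).cpx l = gates[l].angle := by
  simp [taskInput, hl]

def gatesProg (P : Prog) : Prog :=
  .seq (.setVar 6 (.lit 0)) <| .loop (.var 6) (.inp (.lit 1)) <|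
    .seq (decodeProg (.inp (.add (.lit 3) (.var 6)))) <|
    .seq (gateProg P) (.setVar 6 (.add (.var 6) (.lit 1)))

/-- The variables used while processing the gates. -/
abbrev gatesVars : Finset ℕ := {6, 7, 10, 11, 12, 13, 14, 15, 16, 17, 18, 19}

/-- The incoming flags are those of an arbitrary `O'`, since every round overwrites them with those
of its gate; sizes, tables and the Kravchuk matrix are kept. -/
theorem runs_gatesProg {S τ n m : ℕ} {P : Prog} {gates : List Gate} {O O' : Observable}
    (hP : Multiplies (taskInput n gates O) S τ (n + 1) P)
    {s : State} {A : Matrix (Fin (n - 2 * m + 1)) (Fin (n - 2 * m + 1)) ℂ}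
    (hn : 2 ≤ n) (hS : (n + 1) ^ 2 ≤ S) (hS' : 4 * n < S) (hE : Env n m O' s)
    (hA : Holds s 5 A) :
    Runs (taskInput n gates O) S (gatesProg P) s
      (10 + gates.length * (6000 * (n + 1) ^ 2 + 4 * τ)) fun s' =>
      LowFrame 32 gatesVars {5} s s' ∧ Holds s' 5 (gates.foldl (Gate.evolveBlock n m) A) := by
  let Inv : ℕ → State → Prop := fun l s' => LowFrame 32 gatesVars {5} s s' ∧ s'.var 6 = l ∧
    Holds s' 5 ((gates.take l).foldl (Gate.evolveBlock n m) A)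
  have h1 : 1 ≤ (n + 1) ^ 2 := Nat.one_le_pow _ _ (by omega)
  have hbody : ∀ l s₁, l < gates.length → Inv l s₁ → Runs (taskInput n gates O) S
      (.seq (decodeProg (.inp (.add (.lit 3) (.var 6)))) <|
        .seq (gateProg P) (.setVar 6 (.add (.var 6) (.lit 1)))) s₁
      (104 + ((5000 * (n + 1) ^ 2 + 4 * τ) + 4)) (Inv (l + 1)) := by
    rintro l s₁ hl ⟨hF, h6, hA₁⟩
    refine Runs.seq _ (runs_decodeProg (.gen gates[l].gen) (by simp [NExp.Safe]) ?_) ?_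
    · simp only [NExp.eval, h6]
      exact taskInput_nat_gate n gates O l hl
    rintro s₂ ⟨hF₂, hflags⟩
    have hF₂' : LowFrame 32 gatesVars {5} s s₂ := hF.trans (hF₂.low (by decide) (by decide))
    have hE₂ : Env n m (.gen gates[l].gen) s₂ :=
      { sizes := hE.sizes.of_eq fun x hx => by
          refine hF₂'.1 x ?_ ?_ <;> revert x <;> decide
        tables := hE.tables.of_eq fun x hx => by
          refine hF₂'.2 x ?_ ?_ <;> revert x <;> decide
        flags := hflags
        kraw := hE.kraw.of_eq (hF₂'.2 3 (by decide) (by decide)) }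
    have h6' : s₂.var 6 = l := by rw [hF₂.1 6 (by decide), h6]
    refine Runs.seq _ (runs_gateProg hP hn hS hS' hE₂ (hA₁.of_eq (hF₂.2 5 (by decide)))
      (by rw [h6']; exact taskInput_cpx n gates O l hl)) ?_
    rintro s₃ ⟨hF₃, hA₃⟩
    refine Runs.setVar (by simp [NExp.Safe]) (by simp [NExp.cost]) ⟨?_, ?_, ?_⟩
    · refine (hF₂'.trans (hF₃.mono (by decide) (by decide))).trans
        (((Frame.refl s₃).setVar (V := gatesVars) (B := ∅) (by decide) _).low
          (by decide) (by decide))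
    · simp [NExp.eval, hF₃.1 6 (by decide) (by decide), h6']
    · rw [List.take_succ_eq_append_getElem hl, List.foldl_append]
      exact hA₃
  have hmain : Runs (taskInput n gates O) S (gatesProg P) s
      (2 + (gates.length * ((104 + ((5000 * (n + 1) ^ 2 + 4 * τ) + 4)) + (1 + 2 + 1)) +
        (1 + 2 + 1))) (Inv gates.length) := by
    refine Runs.seq (Inv 0) (Runs.setVar trivial (by simp [NExp.cost]) ⟨?_, ?_, ?_⟩) ?_
    · exact ((Frame.refl s).setVar (V := gatesVars) (B := ∅) (by decide) _).low
        (by decide) (by decide)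
    · simp [NExp.eval]
    · exact hA
    · intro s₁ hI
      refine Runs.loop Inv ?_ hbody hI
      rintro l s₂ hl ⟨hF, h6, -⟩
      refine ⟨trivial, trivial, ?_⟩
      simp only [NExp.eval, h6, taskInput_nat_one]
  refine hmain.weaken ?_ ?_
  · have : gates.length * ((104 + ((5000 * (n + 1) ^ 2 + 4 * τ) + 4)) + (1 + 2 + 1)) ≤
        gates.length * (6000 * (n + 1) ^ 2 + 4 * τ) := Nat.mul_le_mul_left _ (by omega)
    omega
  · rintro s' ⟨hF, -, hA'⟩
    rw [List.take_length] at hA'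
    exact ⟨hF, hA'⟩

end SnCircuit

/-! ### The complete simulation program and its cost. -/

namespace SnCircuit

open CRAM

/-! ### Initialization -/

def tablesProg : Prog :=
  .seq (.setCpx 1 (.lit 0) (.ofNat (.lit 1))) <| .seq (.setCpx 2 (.lit 0) (.ofNat (.lit 1))) <|
  .seq (.setVar 20 (.lit 0)) <|
  .loop (.var 20) (.add (.add (.var 0) (.var 0)) (.add (.var 0) (.var 0))) <|
    .seq (.setCpx 1 (.add (.var 20) (.lit 1)) (.mul (.mem 1 (.var 20)) .imag)) <|
    .seq (.setCpx 2 (.add (.var 20) (.lit 1)) (.mul (.mem 2 (.var 20)) (.ofNat (.lit 2)))) <|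
    .setVar 20 (.add (.var 20) (.lit 1))

theorem runs_tablesProg {i : Input} {S n : ℕ} {s : State} (h0 : s.var 0 = n) (hS : 4 * n < S) :
    Runs i S tablesProg s (200 * (n + 1)) fun s' => Frame {20} {1, 2} s s' ∧ Tables n s' := by
  let Inv : ℕ → State → Prop := fun l s' => Frame {20} {1, 2} s s' ∧ s'.var 20 = l ∧
    (∀ k ≤ l, s'.cpx 1 k = Complex.I ^ k) ∧ ∀ k ≤ l, s'.cpx 2 k = 2 ^ k
  have hbody : ∀ l s₁, l < 4 * n → Inv l s₁ → Runs i S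
      (.seq (.setCpx 1 (.add (.var 20) (.lit 1)) (.mul (.mem 1 (.var 20)) .imag)) <|
        .seq (.setCpx 2 (.add (.var 20) (.lit 1)) (.mul (.mem 2 (.var 20)) (.ofNat (.lit 2)))) <|
        .setVar 20 (.add (.var 20) (.lit 1))) s₁ (8 + (9 + 4)) (Inv (l + 1)) := by
    rintro l s₁ hl ⟨hF, h20, h1, h2⟩
    refine Runs.seq _ (Runs.setCpx ?_ ?_ ?_ (by simp [NExp.cost, CExp.cost]) rfl) ?_
    · simp [NExp.Safe]
    · simp only [CExp.Safe, NExp.Safe, NExp.eval, h20, true_and, and_true]; omega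
    · simp only [NExp.eval, h20]; omega
    rintro _ rfl
    refine Runs.seq _ (Runs.setCpx ?_ ?_ ?_ (by simp [NExp.cost, CExp.cost]) rfl) ?_
    · simp [NExp.Safe]
    · simp only [CExp.Safe, NExp.Safe, NExp.eval, State.var_setCpx, h20, true_and, and_true]; omega
    · simp only [NExp.eval, State.var_setCpx, h20]; omega
    rintro _ rfl
    refine Runs.setVar (by simp [NExp.Safe]) (by simp [NExp.cost]) ⟨?_, ?_, ?_, ?_⟩
    · exact ((hF.setCpx (by decide) _ _).setCpx (by decide) _ _).setVar (by decide) _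
    · simp [NExp.eval, h20]
    · intro k hk
      rcases Nat.lt_or_eq_of_le hk with hk | rfl
      · have : k ≠ l + 1 := by omega
        simp [NExp.eval, h20, this, h1 k (by omega)]
      · simp [NExp.eval, CExp.eval, h20, h1 l le_rfl, pow_succ]
    · intro k hk
      rcases Nat.lt_or_eq_of_le hk with hk | rfl
      · have : k ≠ l + 1 := by omega
        simp [NExp.eval, h20, this, h2 k (by omega)]
      · simp [NExp.eval, CExp.eval, h20, h2 l le_rfl, pow_succ]
  have hmain : Runs i S tablesProg s (4 + (4 + (2 + (4 * n * (8 + (9 + 4) + (1 + 7 + 1)) +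
      (1 + 7 + 1))))) (Inv (4 * n)) := by
    refine Runs.seq _ (Runs.setCpx trivial trivial (by simp only [NExp.eval]; omega)
      (by simp [NExp.cost, CExp.cost]) rfl) ?_
    rintro _ rfl
    refine Runs.seq _ (Runs.setCpx trivial trivial (by simp only [NExp.eval]; omega)
      (by simp [NExp.cost, CExp.cost]) rfl) ?_
    rintro _ rfl
    refine Runs.seq (Inv 0) (Runs.setVar trivial (by simp [NExp.cost]) ⟨?_, ?_, ?_, ?_⟩) ?_
    · exact (((Frame.refl s).setCpx (by decide) _ _).setCpx (by decide) _ _).setVar (by decide) _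
    · simp [NExp.eval]
    · intro k hk
      obtain rfl : k = 0 := by omega
      simp [NExp.eval, CExp.eval]
    · intro k hk
      obtain rfl : k = 0 := by omega
      simp [NExp.eval, CExp.eval]
    · intro s₁ hI
      refine Runs.loop Inv ?_ hbody hI
      rintro l s₂ hl ⟨hF, h20, -⟩
      simp only [NExp.Safe, NExp.eval, h20, hF.1 0 (by decide), h0, and_self, true_and]
      omega
  exact hmain.weaken (by omega) fun s' ⟨hF, _, h1, h2⟩ => ⟨hF, h1, h2⟩

def squareProg : Prog :=
  .seq (.setVar 5 (.lit 0)) <| .seq (.setVar 20 (.lit 0)) <|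
  .loop (.var 20) (.add (.var 0) (.lit 1)) <|
    .seq (.setVar 5 (.add (.var 5) (.add (.var 0) (.lit 1)))) <|
    .setVar 20 (.add (.var 20) (.lit 1))

/-- The stride between output blocks is found by repeated addition, as integers cannot be multiplied
in one step. -/
theorem runs_squareProg {i : Input} {S n : ℕ} {s : State} (h0 : s.var 0 = n) :
    Runs i S squareProg s (100 * (n + 1)) fun s' =>
      Frame {5, 20} ∅ s s' ∧ s'.var 5 = (n + 1) ^ 2 := by
  let Inv : ℕ → State → Prop := fun l s' => Frame {5, 20} ∅ s s' ∧ s'.var 20 = l ∧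
    s'.var 5 = l * (n + 1)
  have hbody : ∀ l s₁, l < n + 1 → Inv l s₁ → Runs i S
      (.seq (.setVar 5 (.add (.var 5) (.add (.var 0) (.lit 1)))) <|
        .setVar 20 (.add (.var 20) (.lit 1))) s₁ (6 + 4) (Inv (l + 1)) := by
    rintro l s₁ hl ⟨hF, h20, h5⟩
    refine Runs.seq _ (Runs.setVar (by simp [NExp.Safe]) (by simp [NExp.cost]) rfl) ?_
    rintro _ rfl
    refine Runs.setVar (by simp [NExp.Safe]) (by simp [NExp.cost]) ⟨?_, ?_, ?_⟩
    · exact (hF.setVar (by decide) _).setVar (by decide) _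
    · simp [NExp.eval, h20]
    · simp [NExp.eval, h5, hF.1 0 (by decide), h0]
      ring
  have hmain : Runs i S squareProg s (2 + (2 + ((n + 1) * ((6 + 4) + (1 + 3 + 1)) + (1 + 3 + 1))))
      (Inv (n + 1)) := by
    refine Runs.seq _ (Runs.setVar trivial (by simp [NExp.cost]) rfl) ?_
    rintro _ rfl
    refine Runs.seq (Inv 0) (Runs.setVar trivial (by simp [NExp.cost]) ⟨?_, ?_, ?_⟩) ?_
    · exact ((Frame.refl s).setVar (by decide) _).setVar (by decide) _
    · simp [NExp.eval]
    · simp [NExp.eval]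
    · intro s₁ hI
      refine Runs.loop Inv ?_ hbody hI
      rintro l s₂ hl ⟨hF, h20, -⟩
      simp [NExp.Safe, NExp.eval, h20, hF.1 0 (by decide), h0]
  refine hmain.weaken (by omega) fun s' ⟨hF, _, h5⟩ => ⟨hF, by rw [h5, pow_two]⟩

/-! ### All blocks -/

/-- The normalized block of the evolved observable. -/
def resultBlock (n : ℕ) (gates : List Gate) (O : Observable) (m : ℕ) :
    Matrix (Fin (n - 2 * m + 1)) (Fin (n - 2 * m + 1)) ℂ :=
  fun k q => gates.foldl (Gate.evolveBlock n m) (O.block n m) k q *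
    schurNorm n m k / schurNorm n m q

/-- The state before the block number `m` is processed. -/
structure BlocksDone (n : ℕ) (gates : List Gate) (O : Observable) (m : ℕ) (s : State) : Prop where
  var0 : s.var 0 = n
  var1 : s.var 1 = m
  var4 : s.var 4 = m * (n + 1) ^ 2
  var5 : s.var 5 = (n + 1) ^ 2
  tables : Tables n s
  done : ∀ m' < m, ∀ k q : Fin (n - 2 * m' + 1),
    s.cpx 0 (m' * (n + 1) ^ 2 + k * (n + 1) + q) = resultBlock n gates O m' k q

def initProg : Prog :=
  .seq (.setVar 0 (.inp (.lit 0))) <| .seq tablesProg <| .seq squareProg <|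
  .seq (.setVar 4 (.lit 0)) (.setVar 1 (.lit 0))

theorem runs_initProg {S n : ℕ} {gates : List Gate} {O : Observable} {s : State}
    (hS : 4 * n < S) : Runs (taskInput n gates O) S initProg s (400 * (n + 1))
      (BlocksDone n gates O 0) := by
  have hmain : Runs (taskInput n gates O) S initProg s
      (3 + (200 * (n + 1) + (100 * (n + 1) + (2 + 2)))) (BlocksDone n gates O 0) := by
    refine Runs.seq _ (Runs.setVar trivial (by simp [NExp.cost]) rfl) ?_
    rintro _ rfl
    refine Runs.seq _ (runs_tablesProg (n := n) ?_ hS) ?_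
    · simp [NExp.eval, taskInput_nat_zero]
    rintro s₁ ⟨hF₁, ht₁⟩
    have h0 : s₁.var 0 = n := by
      rw [hF₁.1 0 (by decide)]
      simp [NExp.eval, taskInput_nat_zero]
    refine Runs.seq _ (runs_squareProg h0) ?_
    rintro s₂ ⟨hF₂, h5⟩
    refine Runs.seq _ (Runs.setVar trivial (by simp [NExp.cost]) rfl) ?_
    rintro _ rfl
    refine Runs.setVar trivial (by simp [NExp.cost]) ⟨?_, ?_, ?_, ?_, ?_, ?_⟩
    · simp [hF₂.1 0 (by decide), h0]
    · simp [NExp.eval]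
    · simp [NExp.eval]
    · simp [h5]
    · exact ht₁.of_eq fun b _ => hF₂.2 b (Finset.notMem_empty b)
    · intro m' hm'
      omega
  exact hmain.weaken (by omega) fun _ h => h

/-- Computes one block and writes it to bank 0. -/
def blockProg (P : Prog) : Prog :=
  .seq (.setVar 3 (.sub (.var 0) (.add (.var 1) (.var 1)))) <|
  .seq (.setVar 2 (.add (.var 3) (.lit 1))) <|
  .seq (.fillMat 3 krawExp) <|
  .seq (decodeProg (.inp (.lit 2))) <|
  .seq (.fillMat 4 collectiveExp) <|
  .seq (.fillMat 5 obsExp) <|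
  .seq (gatesProg P) <|
  .seq (.fill 0 (.var 4) (.sub (.var 0) (.var 3)) outExp) <|
  .seq (.setVar 4 (.add (.var 4) (.var 5))) <|
  .setVar 1 (.add (.var 1) (.lit 1))

/-- The observable is decoded afresh for each block, because processing gates destroys its flags. -/
theorem runs_blockProg {S τ n m : ℕ} {P : Prog} {gates : List Gate} {O : Observable}
    (hP : Multiplies (taskInput n gates O) S τ (n + 1) P) {s : State} (hn : 2 ≤ n)
    (hm : 2 * m ≤ n) (hS : (n + 1) ^ 3 ≤ S) (h : BlocksDone n gates O m s) :
    Runs (taskInput n gates O) S (blockProg P) s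
      (3000 * (n + 1) ^ 2 + gates.length * (6000 * (n + 1) ^ 2 + 4 * τ))
      (BlocksDone n gates O (m + 1)) := by
  have hd1 : 1 ≤ n - 2 * m + 1 := by omega
  have hdn : n - 2 * m + 1 ≤ n + 1 := by omega
  have hdd : (n - 2 * m + 1) * (n - 2 * m + 1) ≤ (n + 1) * (n + 1) := Nat.mul_le_mul hdn hdn
  have hcube : (n + 1) ^ 3 = (n + 1) * ((n + 1) * (n + 1)) := by ring
  have h3 : 3 * ((n + 1) * (n + 1)) ≤ (n + 1) * ((n + 1) * (n + 1)) :=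
    Nat.mul_le_mul_right _ (by omega)
  have h3' : 3 * (n + 1) ≤ (n + 1) * (n + 1) := Nat.mul_le_mul_right _ (by omega)
  have hS2 : (n + 1) ^ 2 ≤ S := by rw [pow_two]; omega
  have hS4 : 4 * n < S := by omega
  have hSd : (n - 2 * m + 1) * (n - 2 * m + 1) + (n - 2 * m + 1) ≤ S := by omega
  have hSd' : (n - 2 * m + 1) * (n - 2 * m + 1) ≤ S := by omega
  have hdn2 : (n - 2 * m + 1) ^ 2 ≤ (n + 1) ^ 2 := Nat.pow_le_pow_left hdn 2
  have h1 : 1 ≤ (n + 1) ^ 2 := Nat.one_le_pow _ _ (by omega)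
  have hfill : ∀ c ≤ 462, c * (n - 2 * m + 1) ^ 2 ≤ 462 * (n + 1) ^ 2 := fun c hc =>
    Nat.mul_le_mul hc hdn2
  have hmain : Runs (taskInput n gates O) S (blockProg P) s (6 + (4 + (462 * (n + 1) ^ 2 +
      (102 + (462 * (n + 1) ^ 2 + (462 * (n + 1) ^ 2 +
      ((10 + gates.length * (6000 * (n + 1) ^ 2 + 4 * τ)) + (462 * (n + 1) ^ 2 + (4 + 4)))))))))
      (BlocksDone n gates O (m + 1)) := by
    refine Runs.seq _ (Runs.setVar (by simp [NExp.Safe]) (by simp [NExp.cost]) rfl) ?_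
    rintro _ rfl
    refine Runs.seq (fun s' => Frame {2, 3} ∅ s s' ∧ Sizes n m s')
      (Runs.setVar (by simp [NExp.Safe]) (by simp [NExp.cost]) ⟨?_, ?_⟩) ?_
    · exact ((Frame.refl s).setVar (by decide) _).setVar (by decide) _
    · constructor <;> simp [NExp.eval, h.var0, h.var1] <;> omega
    rintro s₁ ⟨hF₁, hs₁⟩
    refine Runs.seq _ ((runs_fill (a₀ := .lit 0) (pad := .lit 0) (A := 0) (p := 0)
      (krawMat (n - 2 * m)) hs₁.var2 hd1 trivial rfl (fun _ _ => ⟨trivial, rfl⟩)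
      (by rwa [zero_add, add_zero])
      ?_).weaken (hfill _ (by decide)) fun _ h => h) ?_
    · intro k q s' hF h10 h11 h13 hc
      refine krawExp_spec (by rw [hF.1 2 (by decide), hs₁.var2])
        (by rw [hF.1 3 (by decide), hs₁.var3]) hSd' k q h10 h11 h13 fun k' q' hkq => ?_
      simpa [krawMat] using hc k' q' hkq
    rintro s₂ ⟨hF₂, hk₂, -⟩
    have hk₂' : Holds s₂ 3 (krawMat (n - 2 * m)) := fun k q => by simpa using hk₂ k q
    refine Runs.seq _ (runs_decodeProg O trivial (taskInput_nat_two n gates O)) ?_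
    rintro s₃ ⟨hF₃, hf₃⟩
    have hE₃ : Env n m O s₃ :=
      { sizes := hs₁.of_eq fun x hx => by
          rw [hF₃.1 x (by revert x; decide), hF₂.1 x (by revert x; decide)]
        tables := h.tables.of_eq fun b hb => by
          rw [hF₃.2 b (Finset.notMem_empty b), hF₂.2 b (by revert b; decide),
            hF₁.2 b (Finset.notMem_empty b)]
        flags := hf₃
        kraw := hk₂'.of_eq (hF₃.2 3 (Finset.notMem_empty 3)) }
    refine Runs.seq _ ((runs_fillMat (collective O.pauli (n - 2 * m)) hE₃.sizes.var2 hd1 hSd'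
      fun s' hF' => ?_).weaken (hfill _ (by decide)) fun _ h => h) ?_
    · have hE' := hE₃.of_low (hF'.low (by decide) (by decide))
      exact collectiveExp_computes hE'.sizes hE'.flags
    rintro s₄ ⟨hF₄, hc₄⟩
    have hE₄ := hE₃.of_low (hF₄.low (by decide) (by decide))
    refine Runs.seq _ ((runs_fillMat (O.block n m) hE₄.sizes.var2 hd1 hSd'
      fun s' hF' => ?_).weaken (hfill _ (by decide)) fun _ h => h) ?_
    · have hE' := hE₄.of_low (hF'.low (by decide) (by decide))
      exact obsExp_computes hE'.sizes hE'.tables hE'.flags hm hn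
        (hc₄.of_eq (hF'.2 4 (by decide))) hSd hS4
    rintro s₅ ⟨hF₅, hA₅⟩
    have hE₅ := hE₄.of_low (hF₅.low (by decide) (by decide))
    refine Runs.seq _ (runs_gatesProg hP hn hS2 hS4 hE₅ hA₅) ?_
    rintro s₆ ⟨hF₆, hA₆⟩
    have hF : LowFrame 32 ({2, 3} ∪ gatesVars) {3, 4, 5} s s₆ :=
      (((((hF₁.low (by decide) (by decide)).trans (hF₂.low (by decide) (by decide))).trans
        (hF₃.low (by decide) (by decide))).trans (hF₄.low (by decide) (by decide))).trans
        (hF₅.low (by decide) (by decide))).trans (hF₆.mono (by decide) (by decide))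
    have hs₆ : Sizes n m s₆ := hE₅.sizes.of_eq fun x hx => by
      refine hF₆.1 x ?_ ?_ <;> revert x <;> decide
    have hk₆ : Holds s₆ 3 (krawMat (n - 2 * m)) := hE₅.kraw.of_eq (hF₆.2 3 (by decide) (by decide))
    have h4₆ : s₆.var 4 = m * (n + 1) ^ 2 := by rw [hF.1 4 (by decide) (by decide), h.var4]
    -- Padding each row by `2m` gives all blocks the same row length `n + 1` in the output.
    have hstride : n - 2 * m + 1 + 2 * m = n + 1 := by omega
    refine Runs.seq _ ((runs_fill (a₀ := .var 4) (pad := .sub (.var 0) (.var 3))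
      (A := m * (n + 1) ^ 2) (p := 2 * m)
      (resultBlock n gates O m) hs₆.var2 hd1 trivial h4₆ (fun s' hF' => ⟨by simp [NExp.Safe], ?_⟩)
      ?_ fun k q s' hF' h10 h11 h13 _ => ?_).weaken (hfill _ (by decide)) fun _ h => h) ?_
    · simp only [NExp.eval, hF'.1 0 (by decide), hF'.1 3 (by decide), hs₆.var0, hs₆.var3]
      omega
    · rw [hstride]
      have e1 : m * (n + 1) ^ 2 + (n + 1) * (n + 1) = (m + 1) * ((n + 1) * (n + 1)) := by ring
      have e2 : (m + 1) * ((n + 1) * (n + 1)) ≤ (n + 1) * ((n + 1) * (n + 1)) :=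
        Nat.mul_le_mul_right _ (by omega)
      have e3 : (n - 2 * m + 1) * (n + 1) ≤ (n + 1) * (n + 1) := Nat.mul_le_mul_right _ hdn
      omega
    · exact outExp_computes (hk₆.of_eq (hF'.2 3 (by decide))) (hA₆.of_eq (hF'.2 5 (by decide)))
        hSd' k q h10 h11 h13
    rintro s₇ ⟨hF₇, hr₇, hlow₇⟩
    refine Runs.seq _ (Runs.setVar (by simp [NExp.Safe]) (by simp [NExp.cost]) rfl) ?_
    rintro _ rfl
    refine Runs.setVar (by simp [NExp.Safe]) (by simp [NExp.cost]) ⟨?_, ?_, ?_, ?_, ?_, ?_⟩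
    · simp [hF₇.1 0 (by decide), hs₆.var0]
    · simp [NExp.eval, hF₇.1 1 (by decide), hs₆.var1]
    · simp [NExp.eval, hF₇.1 4 (by decide), h4₆, hF₇.1 5 (by decide),
        hF.1 5 (by decide) (by decide), h.var5]
      ring
    · simp [hF₇.1 5 (by decide), hF.1 5 (by decide) (by decide), h.var5]
    · refine h.tables.of_eq fun b hb => ?_
      simp only [State.cpx_setVar]
      rw [hF₇.2 b (by revert b; decide)]
      refine hF.2 b ?_ ?_ <;> revert b <;> decide
    · intro m' hm' k q
      simp only [State.cpx_setVar]
      rcases Nat.lt_or_eq_of_le (Nat.lt_succ_iff.1 hm') with hlt | rfl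
      -- Earlier blocks lie entirely below the starting address of block `m`, so filling it leaves
      -- them intact.
      · rw [hlow₇, hF.2 0 (by decide) (by decide), h.done m' hlt k q]
        have hk := k.2
        have hq := q.2
        have e1 : (m' + 1) * ((n + 1) * (n + 1)) ≤ m * ((n + 1) * (n + 1)) :=
          Nat.mul_le_mul_right _ hlt
        have e2 : ((k : ℕ) + 1) * (n + 1) ≤ (n + 1) * (n + 1) :=
          Nat.mul_le_mul_right _ (by omega)
        rw [Nat.succ_mul] at e1 e2
        rw [pow_two]
        omega
      · rw [← hr₇ k q, hstride]
  refine hmain.weaken ?_ fun _ h => h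
  omega

/-- The simulation program. -/
def simulationProg (P : Prog) : Prog :=
  .seq initProg <| .loop (.add (.var 1) (.var 1)) (.add (.var 0) (.lit 1)) (blockProg P)

/-- The guard `2m < n + 1` first fails at `m = n / 2 + 1`; bounding this number of blocks by `n + 1`
gives the extra factor `n`. -/
theorem runs_simulationProg {S τ n : ℕ} {P : Prog} {gates : List Gate} {O : Observable}
    (hP : Multiplies (taskInput n gates O) S τ (n + 1) P) {s : State} (hn : 2 ≤ n)
    (hS : (n + 1) ^ 3 ≤ S) :
    Runs (taskInput n gates O) S (simulationProg P) s
      (4000 * (n + 1) ^ 3 + gates.length * ((n + 1) * (6000 * (n + 1) ^ 2 + 4 * τ)))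
      (BlocksDone n gates O (n / 2 + 1)) := by
  have h3 : 3 * ((n + 1) * (n + 1)) ≤ (n + 1) * ((n + 1) * (n + 1)) :=
    Nat.mul_le_mul_right _ (by omega)
  have h3' : 3 * (n + 1) ≤ (n + 1) * (n + 1) := Nat.mul_le_mul_right _ (by omega)
  have hcube : (n + 1) ^ 3 = (n + 1) * ((n + 1) * (n + 1)) := by ring
  have hmain : Runs (taskInput n gates O) S (simulationProg P) s (400 * (n + 1) +
      ((n / 2 + 1) * ((3000 * (n + 1) ^ 2 + gates.length * (6000 * (n + 1) ^ 2 + 4 * τ)) +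
        (3 + 3 + 1)) + (3 + 3 + 1))) (BlocksDone n gates O (n / 2 + 1)) := by
    refine Runs.seq _ (runs_initProg (by omega)) fun s₁ h₁ => ?_
    refine Runs.loop (BlocksDone n gates O) ?_
      (fun m s₂ hm h₂ => runs_blockProg hP hn (by omega) hS h₂) h₁
    intro m s₂ hm h₂
    simp only [NExp.Safe, NExp.eval, h₂.var0, h₂.var1, and_self, true_and]
    omega
  refine hmain.weaken ?_ fun _ h => h
  have hle : (n / 2 + 1) * ((3000 * (n + 1) ^ 2 +
      gates.length * (6000 * (n + 1) ^ 2 + 4 * τ)) + (3 + 3 + 1)) ≤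
      (n + 1) * ((3000 * (n + 1) ^ 2 +
      gates.length * (6000 * (n + 1) ^ 2 + 4 * τ)) + (3 + 3 + 1)) :=
    Nat.mul_le_mul_right _ (by omega)
  have he : (n + 1) * ((3000 * (n + 1) ^ 2 +
      gates.length * (6000 * (n + 1) ^ 2 + 4 * τ)) + (3 + 3 + 1)) =
      3000 * (n + 1) ^ 3 + gates.length * ((n + 1) * (6000 * (n + 1) ^ 2 + 4 * τ)) +
        7 * (n + 1) := by ring
  omega

/-- Since `ω` is nonnegative, the bound for the largest size covers all smaller blocks; the floor
converts it into an integer time. -/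
theorem multiplies_of_exec {ω : ℝ} (hω : 2 ≤ ω) {P : Prog} {C : ℕ}
    (h : ∀ (d : ℕ), 1 ≤ d → ∀ (A B : Matrix (Fin d) (Fin d) ℂ) (i : Input)
      (s : State), s.var 0 = d →
      (∀ j k : Fin d, s.cpx 0 ((j : ℕ) * d + k) = A j k) →
      (∀ j k : Fin d, s.cpx 1 ((j : ℕ) * d + k) = B j k) →
      ∃ (s' : State) (t : ℕ), Exec i (C * d ^ 3) P s s' t ∧ (t : ℝ) ≤ C * (d : ℝ) ^ ω ∧
        ∀ j k : Fin d, s'.cpx 2 ((j : ℕ) * d + k) = (A * B) j k)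
    (i : Input) {S n : ℕ} (hS : C * n ^ 3 ≤ S) :
    Multiplies i S ⌊(C : ℝ) * (n : ℝ) ^ ω⌋₊ n P := by
  intro d hd1 hdn A B s hs hA hB
  obtain ⟨s', t, hx, ht, hr⟩ := h d hd1 A B i s hs hA hB
  refine ⟨s', t, hx.mono (le_trans ?_ hS), Nat.le_floor (ht.trans ?_), hr⟩
  · exact Nat.mul_le_mul_left _ (Nat.pow_le_pow_left hdn 3)
  · have : (d : ℝ) ≤ n := by exact_mod_cast hdn
    gcongr

/-- The total time in the form required by the theorem. -/
theorem time_bound {ω : ℝ} (hω : 2 ≤ ω) (C n L : ℕ) (hn : 2 ≤ n) :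
    ((4000 * (n + 1) ^ 3 +
      L * ((n + 1) * (6000 * (n + 1) ^ 2 + 4 * ⌊(C : ℝ) * ((n + 1 : ℕ) : ℝ) ^ ω⌋₊)) : ℕ) : ℝ) ≤
    ((48000 + ⌈8 * (C : ℝ) * 2 ^ ω⌉₊ : ℕ) : ℝ) * ((n : ℝ) ^ 3 + L * (n : ℝ) ^ (ω + 1)) := by
  have hn0 : (0 : ℝ) < n := by exact_mod_cast (by omega : 0 < n)
  have hn1 : (1 : ℝ) ≤ n := by exact_mod_cast (by omega : 1 ≤ n)
  -- This accounts for the constants: `6000 * 2 ^ 3 = 48000`, and `4 * 2 * 2 ^ ω * C` for the four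
  -- multiplications.
  have hX : ((n + 1 : ℕ) : ℝ) ≤ 2 * n := by push_cast; linarith
  have hX0 : (0 : ℝ) ≤ ((n + 1 : ℕ) : ℝ) := Nat.cast_nonneg _
  have hτ : (⌊(C : ℝ) * ((n + 1 : ℕ) : ℝ) ^ ω⌋₊ : ℝ) ≤ C * (2 ^ ω * (n : ℝ) ^ ω) := by
    refine (Nat.floor_le (by positivity)).trans ?_
    rw [← Real.mul_rpow (by norm_num) hn0.le]
    gcongr
  have hpow : (n : ℝ) ^ (ω + 1) = (n : ℝ) ^ ω * n := by rw [Real.rpow_add hn0, Real.rpow_one]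
  have hcube : (n : ℝ) ^ 3 ≤ (n : ℝ) ^ (ω + 1) := by
    rw [← Real.rpow_natCast]
    exact Real.rpow_le_rpow_of_exponent_le hn1 (by push_cast; linarith)
  have hceil : 8 * (C : ℝ) * 2 ^ ω ≤ (⌈8 * (C : ℝ) * 2 ^ ω⌉₊ : ℝ) := Nat.le_ceil _
  set τ := ⌊(C : ℝ) * ((n + 1 : ℕ) : ℝ) ^ ω⌋₊
  set c := ⌈8 * (C : ℝ) * 2 ^ ω⌉₊
  have hc0 : (0 : ℝ) ≤ c := Nat.cast_nonneg _
  have hY0 : 0 ≤ (n : ℝ) ^ (ω + 1) := by positivity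
  have h1 : ((n + 1 : ℕ) : ℝ) ^ 3 ≤ 8 * (n : ℝ) ^ 3 := by
    calc ((n + 1 : ℕ) : ℝ) ^ 3 ≤ (2 * n) ^ 3 := by gcongr
      _ = _ := by ring
  have h2 : ((n + 1 : ℕ) : ℝ) * τ ≤ 2 * C * 2 ^ ω * (n : ℝ) ^ (ω + 1) := by
    calc ((n + 1 : ℕ) : ℝ) * τ ≤ (2 * n) * (C * (2 ^ ω * (n : ℝ) ^ ω)) := by gcongr
      _ = _ := by rw [hpow]; ring
  have h3 : ((n + 1 : ℕ) : ℝ) * (6000 * ((n + 1 : ℕ) : ℝ) ^ 2 + 4 * τ) ≤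
      (48000 + c) * (n : ℝ) ^ (ω + 1) := by
    have h4 : 8 * (C : ℝ) * 2 ^ ω * (n : ℝ) ^ (ω + 1) ≤ c * (n : ℝ) ^ (ω + 1) := by gcongr
    nlinarith
  have hL : (0 : ℝ) ≤ L := Nat.cast_nonneg _
  have h5 := mul_le_mul_of_nonneg_left h3 hL
  have h6 : 0 ≤ c * (n : ℝ) ^ 3 := by positivity
  have h7 : 0 ≤ (n : ℝ) ^ 3 := by positivity
  push_cast at h1 h5 ⊢
  nlinarith

end SnCircuit

end

theorem theorem1 (ω : ℝ) (hω : CRAM.IsMatMulExponent ω) :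
    ∃ (P : CRAM.Prog) (C : ℕ), ∀ (n : ℕ), 2 ≤ n →
      ∀ (gates : List SnCircuit.Gate) (O : SnCircuit.Observable) (s : CRAM.State),
        ∃ (s' : CRAM.State) (t : ℕ),
          CRAM.Exec (SnCircuit.taskInput n gates O) (C * n ^ 3) P s s' t ∧
          (t : ℝ) ≤ C * ((n : ℝ) ^ 3 + (gates.length : ℝ) * (n : ℝ) ^ (ω + 1)) ∧
          ∀ (m : ℕ), 2 * m ≤ n →
            (∀ q q' : Fin (n - 2 * m + 1),
              s'.cpx 0 (m * (n + 1) ^ 2 + (q : ℕ) * (n + 1) + (q' : ℕ)) =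
                SnCircuit.schurBlock (SnCircuit.heisenberg n gates O) m q q') ∧
            (∀ (σ : Equiv.Perm (Fin n)) (q' : Fin (n - 2 * m + 1)),
              (SnCircuit.heisenberg n gates O) *ᵥ
                  SnCircuit.permVec σ (SnCircuit.schurVec n m q') =
                ∑ q : Fin (n - 2 * m + 1),
                  SnCircuit.schurBlock (SnCircuit.heisenberg n gates O) m q q' •
                    SnCircuit.permVec σ (SnCircuit.schurVec n m q)) := by
  have hω2 := hω.two_le
  obtain ⟨P, C, h⟩ := hω
  refine ⟨SnCircuit.simulationProg P, 48000 + ⌈8 * (C : ℝ) * 2 ^ ω⌉₊ + 4 * C,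
    fun n hn gates O s => ?_⟩
  -- The largest block has size `n + 1`; for `n ≥ 2` the factor 4 turns the multiplier's memory
  -- bound `C (n + 1) ^ 3` into `4 C n ^ 3`, hence the summand `4 * C` in the constant.
  have hcube : (n + 1) ^ 3 ≤ 4 * n ^ 3 := by
    obtain ⟨a, rfl⟩ := Nat.exists_eq_add_of_le hn
    ring_nf
    nlinarith [Nat.zero_le a, Nat.zero_le (a ^ 2), Nat.zero_le (a ^ 3)]
  obtain ⟨s', t, hx, ht, hdone⟩ := SnCircuit.runs_simulationProg (gates := gates) (O := O) (s := s)
    (S := (48000 + ⌈8 * (C : ℝ) * 2 ^ ω⌉₊ + 4 * C) * n ^ 3)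
    (SnCircuit.multiplies_of_exec hω2 h _ (n := n + 1) (by
      calc C * (n + 1) ^ 3 ≤ C * (4 * n ^ 3) := Nat.mul_le_mul_left _ hcube
        _ = (4 * C) * n ^ 3 := by ring
        _ ≤ _ := Nat.mul_le_mul_right _ (by omega))) hn
    (hcube.trans (Nat.mul_le_mul_right _ (by omega)))
  refine ⟨s', t, hx, ?_, fun m hm => ⟨fun q q' => ?_, fun σ q' => ?_⟩⟩
  · have h1 : (t : ℝ) ≤ _ := (Nat.cast_le.2 ht).trans
      (SnCircuit.time_bound hω2 C n gates.length hn)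
    exact h1.trans (mul_le_mul_of_nonneg_right (Nat.cast_le.2 (Nat.le_add_right _ _))
      (by positivity))
  · rw [hdone.done m (by omega) q q', SnCircuit.schurBlock_apply hm
      (SnCircuit.heisenberg_mul_permSchurMat 1 hm gates O)]
    rfl
  · exact SnCircuit.mulVec_permVec_schurVec hm
      (fun σ => SnCircuit.heisenberg_mul_permSchurMat σ hm gates O) σ q'
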